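/- **Definitions.** An $n$-qubit Pauli observable is a Hermitian operator $P=\lambda X^{\mathbf a}Z^{\mathbf b}$ on $(\mathbb C^2)^{\otimes n}$ with $\lambda\in\{\pm1,\pm i\}$ and $\mathbf a,\mathbf b\in\mathbb F_2^n$; it is stored as the bit string $(\lambda,\mathbf a,\mathbf b)$. Let $\mathcal M=\{P_1,\dots,P_m\}$ be a set of $m$ distinct $n$-qubit Pauli observables. - A pure stabilizer state is $|\psi\rangle\langle\psi|$, where the unit vector $\psi$ is a joint $+1$ eigenvector of an Abelian subgroup of the Pauli group that does not contain $-\mathbb 1$ and has rank $n$. $\mathrm{STAB}_n$ is the convex hull of the pure stabilizer states, and the reduced stabilizer polytope is $\mathrm{STAB}(\mathcal M)=\{(\mathrm{tr}(P_1\rho),\dots,\mathrm{tr}(P_m\rho)):\rho\in\mathrm{STAB}_n\}\subseteq\mathbb R^m$. - The frustration graph $G_{\mathcal M}$ has vertex set $\mathcal M$, with an edge between $P_i$ and $P_j$ iff $P_iP_j=-P_jP_i$. $I_{\max}(G_{\mathcal M})$ is the set of its (inclusion-)maximal independent sets. - For $S\in I_{\max}(G_{\mathcal M})$, $B_S$ is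 the set of $f\in\{\pm1\}^S$ with $\prod_{P\in S'}f_PP\neq-\mathbb 1$ for all $S'\subseteq S$. For $f\in B_S$ the vector $\vec v_{S,f}\in\{0,\pm1\}^m$ has the entry $f_P$ at each $P\in S$ and $0$ at each $P\notin S$. **Theorem.** There is a classical algorithm that takes $\mathcal M$ (the list of the $m$ symplectic representations) as input and outputs a list, without repetitions, of the vectors $\{\vec v_{S,f}:S\in I_{\max}(G_{\mathcal M}),\ f\in B_S\}$; these form a $V$-representation of the reduced stabilizer polytope, i.e. $\mathrm{STAB}(\mathcal M)=\mathrm{conv}\{\vec v_{S,f}\}$. The algorithm consists of three successive phases: it computes the frustration graph $G_{\mathcal M}$ (its adjacency matrix); from this it lists $I_{\max}(G_{\mathcal M})$; then, for each listed $S$ in turn, it lists the vectors $\vec v_{S,f}$ of all admissible sign assignments $f\in B_S$. Its total running time is at most $$p(n,m)\cdot2^{\,c\,(\min\{m,n\}+\min\{m,n^2\})}$$ for all $n,m$ and $\mathcal M$, where the polynomial $p$ and the constant $c$ do not depend on $n$, $m$ or $\mathcal M$. (Time is counted as the number of steps in a model polynomially equivalent to multitape Turing machines, namely while-programs over binary trees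 where each instruction is charged the size of the data it acts on; the claim does not depend on the choice among such models.) -/

import Mathlib

namespace ReducedStabilizer

section Model

/-- Binary trees (S-expressions), the data on which programs operate. -/
inductive Data : Type
  | nil : Data
  | cons : Data → Data → Data

namespace Data

/-- The number of cells (nodes, including leaves) that are needed to write down a tree. -/
def size : Data → ℕ
  | nil => 1
  | cons x y => 1 + size x + size y

/-- First component, with the convention that `nil` has first component `nil`. -/
def head : Data → Data
  | nil => nil
  | cons x _ => x

/-- Second component, with the convention that `nil` has second component `nil`. -/
def tail : Data → Data
  | nil => nil
  | cons _ y => y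

/-- A bit as a tree. -/
def ofBool : Bool → Data
  | false => nil
  | true => cons nil nil

/-- An entry in `{0, 1, -1}` as a tree. -/
def ofSign : SignType → Data
  | SignType.zero => nil
  | SignType.pos => cons nil nil
  | SignType.neg => cons (cons nil nil) nil

/-- A list as a tree, for a given representation of its entries. -/
def ofList {α : Type} (enc : α → Data) : List α → Data
  | [] => nil
  | a :: l => cons (enc a) (ofList enc l)

/-- A vector of length `k`, as the list of its entries. -/
def ofVec {α : Type} {k : ℕ} (enc : α → Data) (v : Fin k → α) : Data :=
  ofList enc (List.ofFn v)

end Data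

/-- Programs of the `while` language over binary trees. A program transforms a tree.
`seq f g` runs `f` and then `g`; `pair f g` runs `f` and `g` on copies of the input and joins the
two results; `cond c f g` runs `f` if the result of the test `c` on the input is not `nil`, and `g`
otherwise; `loop c f` repeats `f` as long as the result of the test `c` is not `nil`. -/
inductive Prog : Type
  | id : Prog
  | nil : Prog
  | head : Prog
  | tail : Prog
  | pair : Prog → Prog → Prog
  | seq : Prog → Prog → Prog
  | cond : Prog → Prog → Prog → Prog
  | loop : Prog → Prog → Prog

/-- `Runs c x y t`: on input `x` the program `c` halts with output `y` after `t` elementary steps.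
No data are shared and nothing is free: each instruction, and each pass through a loop, is charged
one step plus the number of cells of the tree it acts on (it may have to read, copy or erase all of
it), in addition to the steps of its parts. So the size of every intermediate result is at most the
time, and the time agrees up to a polynomial with that of multitape Turing machines. -/
inductive Runs : Prog → Data → Data → ℕ → Prop
  | id (x : Data) : Runs Prog.id x x (1 + x.size)
  | nil (x : Data) : Runs Prog.nil x Data.nil (1 + x.size)
  | head (x : Data) : Runs Prog.head x x.head (1 + x.size)
  | tail (x : Data) : Runs Prog.tail x x.tail (1 + x.size)
  | pair {f g : Prog} {x y z : Data} {s t : ℕ} (hf : Runs f x y s) (hg : Runs g x z t) :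
      Runs (Prog.pair f g) x (Data.cons y z) (1 + x.size + s + t)
  | seq {f g : Prog} {x y z : Data} {s t : ℕ} (hf : Runs f x y s) (hg : Runs g y z t) :
      Runs (Prog.seq f g) x z (1 + x.size + s + t)
  | cond_true {c f g : Prog} {x b y : Data} {s t : ℕ} (hc : Runs c x b s) (hb : b ≠ Data.nil)
      (hf : Runs f x y t) : Runs (Prog.cond c f g) x y (1 + x.size + s + t)
  | cond_false {c f g : Prog} {x y : Data} {s t : ℕ} (hc : Runs c x Data.nil s)
      (hg : Runs g x y t) : Runs (Prog.cond c f g) x y (1 + x.size + s + t)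
  | loop_stop {c f : Prog} {x : Data} {s : ℕ} (hc : Runs c x Data.nil s) :
      Runs (Prog.loop c f) x x (1 + x.size + s)
  | loop_step {c f : Prog} {x b y z : Data} {s t r : ℕ} (hc : Runs c x b s) (hb : b ≠ Data.nil)
      (hf : Runs f x y t) (hr : Runs (Prog.loop c f) y z r) :
      Runs (Prog.loop c f) x z (1 + x.size + s + t + r)

end Model

noncomputable section Paulis

/-- Operators on the Hilbert space of `n` qubits, as matrices in the computational basis. -/
abbrev Operator (n : ℕ) : Type := Matrix (Fin n → Fin 2) (Fin n → Fin 2) ℂ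

/-- The tensor product of `n` single-qubit operators. -/
def tensor {n : ℕ} (A : Fin n → Matrix (Fin 2) (Fin 2) ℂ) : Operator n :=
  Matrix.of fun x y => ∏ i, A i (x i) (y i)

/-- The single-qubit Pauli matrix `X`. -/
def pauliX : Matrix (Fin 2) (Fin 2) ℂ := !![0, 1; 1, 0]

/-- The single-qubit Pauli matrix `Z`. -/
def pauliZ : Matrix (Fin 2) (Fin 2) ℂ := !![1, 0; 0, -1]

/-- The symplectic representation `(lam, a, b)` of an `n`-qubit Pauli operator `lam X^a Z^b`, where
the phase `lam` is `(-1)^neg * I^im`. -/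
structure Pauli (n : ℕ) where
  neg : Bool
  im : Bool
  a : Fin n → Bool
  b : Fin n → Bool

namespace Pauli

variable {n : ℕ}

/-- The phase `lam` in `{1, -1, I, -I}`. -/
def phase (P : Pauli n) : ℂ :=
  (if P.neg then -1 else 1) * (if P.im then Complex.I else 1)

/-- The operator `lam X^a Z^b`. -/
def op (P : Pauli n) : Operator n :=
  P.phase • (tensor (fun i => if P.a i then pauliX else 1) *
    tensor (fun i => if P.b i then pauliZ else 1))

/-- The representation of a Pauli operator as a tree, with `2 n + 2` bits. -/
def toData (P : Pauli n) : Data :=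
  Data.cons (Data.cons (Data.ofBool P.neg) (Data.ofBool P.im))
    (Data.cons (Data.ofVec Data.ofBool P.a) (Data.ofVec Data.ofBool P.b))

end Pauli

/-- The `n`-qubit Pauli group, with phases. -/
def pauliGroup (n : ℕ) : Subgroup (Operator n)ˣ :=
  Subgroup.closure {u | ∃ P : Pauli n, (u : Operator n) = P.op}

/-- Stabilizer groups of maximal rank: Abelian subgroups of the Pauli group that do not contain
`-1` and have rank `n`. -/
structure IsMaxStabilizerGroup {n : ℕ} (G : Subgroup (Operator n)ˣ) : Prop where
  le_pauliGroup : G ≤ pauliGroup n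
  comm : ∀ s ∈ G, ∀ t ∈ G, s * t = t * s
  neg_one_notMem : (-1 : (Operator n)ˣ) ∉ G
  rank_eq : ∃ _ : Group.FG G, Group.rank G = n

/-- The pure stabilizer states `|ψ⟩⟨ψ|`, where the unit vector `ψ` is a joint `+1` eigenvector of a
stabilizer group of maximal rank. -/
def pureStabStates (n : ℕ) : Set (Operator n) :=
  {ρ | ∃ G : Subgroup (Operator n)ˣ, IsMaxStabilizerGroup G ∧
    ∃ ψ : (Fin n → Fin 2) → ℂ, star ψ ⬝ᵥ ψ = 1 ∧
      (∀ s ∈ G, (s : Operator n).mulVec ψ = ψ) ∧ ρ = Matrix.vecMulVec ψ (star ψ)}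

/-- The stabilizer polytope. -/
def stabPolytope (n : ℕ) : Set (Operator n) := convexHull ℝ (pureStabStates n)

variable {n m : ℕ}

/-- The (real) expectation values `tr (P i * ρ)` of a family of Pauli observables. -/
def expectations (M : Fin m → Pauli n) (ρ : Operator n) : Fin m → ℝ :=
  fun i => (Matrix.trace ((M i).op * ρ)).re

/-- The reduced stabilizer polytope: the projection of the stabilizer polytope to the expectation
values of the observables in `M`. -/
def reducedPolytope (M : Fin m → Pauli n) : Set (Fin m → ℝ) :=
  expectations M '' stabPolytope n

/-- The frustration graph: its vertices are the members of `M`, and two of them are joined if they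
anticommute. -/
def frustrationGraph (M : Fin m → Pauli n) : SimpleGraph (Fin m) where
  Adj i j := i ≠ j ∧ (M i).op * (M j).op = -((M j).op * (M i).op)
  symm := ⟨fun _ _ h => ⟨h.1.symm, by rw [h.2, neg_neg]⟩⟩
  loopless := ⟨fun _ h => h.1 rfl⟩

/-- The maximal independent sets of the frustration graph. -/
def maxIndepSets (M : Fin m → Pauli n) : Set (Finset (Fin m)) :=
  {S | Maximal (fun T : Finset (Fin m) => (frustrationGraph M).IsIndepSet (T : Set (Fin m))) S}

/-- The admissible sign assignments on `S`: no subset of the signed members of `S` has product `-1`.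
The product is taken in the order of the indices, which is immaterial when `S` is independent, since
then the members of `S` commute. -/
def admissibleSigns (M : Fin m → Pauli n) (S : Finset (Fin m)) : Set (S → ℤˣ) :=
  {f | ∀ T : Finset S,
    ((T.sort (· ≤ ·)).map fun i => (((f i : ℤˣ) : ℤ) : ℂ) • (M i).op).prod ≠ (-1 : Operator n)}

/-- The vector `v_{S,f}`: the sign `f i` at `i ∈ S`, and `0` outside `S`. -/
def vertex (S : Finset (Fin m)) (f : S → ℤˣ) : Fin m → SignType :=
  fun i => if h : i ∈ S then SignType.sign ((f ⟨i, h⟩ : ℤˣ) : ℤ) else 0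

/-- The set of all `v_{S,f}`, with `S` a maximal independent set and `f` admissible on `S`. -/
def vertices (M : Fin m → Pauli n) : Set (Fin m → SignType) :=
  {v | ∃ S ∈ maxIndepSets M, ∃ f ∈ admissibleSigns M S, v = vertex S f}

/-- A vector with entries in `{0, 1, -1}` as a real vector. -/
def realVec (v : Fin m → SignType) : Fin m → ℝ := fun i => (v i : ℝ)

/-- The input: the list of the symplectic representations. -/
def inputData (M : Fin m → Pauli n) : Data := Data.ofVec Pauli.toData M

open Classical in
/-- A graph as a tree: its adjacency matrix, row by row. -/
def graphData (G : SimpleGraph (Fin m)) : Data :=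
  Data.ofVec (fun i => Data.ofVec Data.ofBool fun j => decide (G.Adj i j)) (fun i : Fin m => i)

/-- A list of subsets as a tree: the list of their characteristic vectors. -/
def setsData (L : List (Finset (Fin m))) : Data :=
  Data.ofList (fun S => Data.ofVec Data.ofBool fun i => decide (i ∈ S)) L

/-- The output: a list of vectors with entries in `{0, 1, -1}`. -/
def vectorsData (V : List (Fin m → SignType)) : Data :=
  Data.ofList (Data.ofVec Data.ofSign) V

end Paulis

end ReducedStabilizer

open ReducedStabilizer

namespace ReducedStabilizer

/-! The polytope. A maximal stabilizer group has order `2 ^ n`, and in its state a Hermitian Pauli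
operator has expectation `1`, `-1` or `0` according to whether it, its negative or neither lies in
the group (`IsStab.trace_state`). If `S` is maximal independent and `f` is admissible, the signed
members of `S` generate a group without `-1`. It extends to a maximal one (`IsStab.exists_max`),
which fixes a vector (`IsStab.exists_fixed`). Each observable outside `S` anticommutes with a member
of `S`, so this state realizes `v_{S,f}`. Conversely, call an observable determined by a stabilizer
group `G` if it lies in `G` up to sign. The determined observables form an independent set. If it is
not maximal, some undetermined `R` in the family commutes with all of them. The part `H` of `G` that
commutes with `R` has the same expectations, and these are the average of the expectations for the
groups generated by `H` together with `R` or with `-R` (`expec_adjoin`). Both groups determine more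
observables, so induction writes the expectations of `G` as a convex combination of vectors
`v_{S,f}` (`expecVec_mem_convexHull`).

The running time. All phases are built from folds, and a fold costs a polynomial in the cost of its
steps and the sizes of its intermediate results (`Comp.foldl`). It remains to bound these results.
The second phase adds one vertex at a time and keeps exactly the maximal independent sets of the
graph induced so far (`setStep_spec`). There are at most `2 ^ m` of them. There are also at most `2
^ O(n ^ 2)` up to a constant factor, because such a set is recovered from the subgroup it generates
(`isMis_closure_injective`) and the Pauli group has few subgroups (`card_subgroup_le`). The third
phase keeps all admissible partial sign vectors, each with a complete list of the group generated so
far. A new observable either lies in the group up to sign, which forces its sign, or is independent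
of it, so that both signs are allowed and the group doubles. The alternative is the same for all
partial vectors (`partGroup_signs`). Hence there are always as many partial vectors as elements in
each group, at most `2 ^ m` and at most `4 * 4 ^ n` (`StatesSpec`). All bounds are polynomial in
`timeBase`, the product of a linear polynomial and the exponential, so a single exponent supplies
both the polynomial and the constant of the theorem. -/

/-! ### Polynomial domination of cost functions -/

/-- `mu` is bounded by a polynomial in `nu`. -/
def Dom {α : Type} (mu nu : α → ℕ) : Prop := ∃ k, ∀ a, mu a ≤ (nu a + 2) ^ k

namespace Dom

variable {α : Type} {mu nu xi : α → ℕ}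

theorem of_le (h : ∀ a, mu a ≤ nu a) : Dom mu nu :=
  ⟨1, fun a => by have := h a; simp; omega⟩

theorem refl (mu : α → ℕ) : Dom mu mu := of_le fun _ => le_rfl

/-- A constant goes into the exponent, since `c < 2 ^ c` and the shift in `Dom` makes the base at
least 2. -/
theorem const (c : ℕ) : Dom (fun _ => c) nu :=
  ⟨c, fun a => (Nat.lt_two_pow_self.le).trans (Nat.pow_le_pow_left (by omega) _)⟩

/-- Composing two bounds applies the shift by 2 twice; two additional powers of the base absorb the
second one. -/
theorem pow_add_two_le (x k : ℕ) : (x + 2) ^ k + 2 ≤ (x + 2) ^ (k + 2) := by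
  have h1 : 1 ≤ (x + 2) ^ k := Nat.one_le_pow _ _ (by omega)
  have h2 : 4 ≤ (x + 2) ^ 2 := Nat.pow_le_pow_left (show 2 ≤ x + 2 by omega) 2
  rw [pow_add]
  nlinarith

theorem trans (h : Dom mu nu) (h' : Dom nu xi) : Dom mu xi := by
  obtain ⟨k, hk⟩ := h
  obtain ⟨l, hl⟩ := h'
  refine ⟨(l + 2) * k, fun a => (hk a).trans ?_⟩
  rw [pow_mul]
  refine Nat.pow_le_pow_left (le_trans ?_ (pow_add_two_le _ _)) _
  have := hl a
  omega

theorem mul (h : Dom mu xi) (h' : Dom nu xi) : Dom (fun a => mu a * nu a) xi := by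
  obtain ⟨k, hk⟩ := h
  obtain ⟨l, hl⟩ := h'
  exact ⟨k + l, fun a => by rw [pow_add]; exact Nat.mul_le_mul (hk a) (hl a)⟩

theorem add (h : Dom mu xi) (h' : Dom nu xi) : Dom (fun a => mu a + nu a) xi := by
  obtain ⟨k, hk⟩ := h
  obtain ⟨l, hl⟩ := h'
  refine ⟨k + l + 1, fun a => ?_⟩
  have h1 : (xi a + 2) ^ k ≤ (xi a + 2) ^ (k + l) := Nat.pow_le_pow_right (by omega) (by omega)
  have h2 : (xi a + 2) ^ l ≤ (xi a + 2) ^ (k + l) := Nat.pow_le_pow_right (by omega) (by omega)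
  have h3 := hk a
  have h4 := hl a
  rw [pow_succ]
  nlinarith

theorem pow (h : Dom mu xi) (k : ℕ) : Dom (fun a => mu a ^ k) xi := by
  induction k with
  | zero => simpa using const 1
  | succ k ih => simpa [pow_succ] using ih.mul h

theorem mono_left {mu' : α → ℕ} (h : Dom mu nu) (h' : ∀ a, mu' a ≤ mu a) : Dom mu' nu :=
  (of_le h').trans h

theorem comp {β : Type} (h : Dom mu nu) (f : β → α) : Dom (fun b => mu (f b)) fun b => nu (f b) := by
  obtain ⟨k, hk⟩ := h
  exact ⟨k, fun b => hk _⟩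

end Dom

/-! ### Encodings and computable functions with a cost bound -/

/-- A representation of the elements of a type as trees. -/
class Enc (α : Type) where
  enc : α → Data

open Enc

instance : Enc Bool := ⟨Data.ofBool⟩
instance : Enc SignType := ⟨Data.ofSign⟩
instance {α β : Type} [Enc α] [Enc β] : Enc (α × β) := ⟨fun p => Data.cons (enc p.1) (enc p.2)⟩
instance {α : Type} [Enc α] : Enc (List α) := ⟨Data.ofList enc⟩

/-! ### Sizes of encoded objects. -/

section Size

variable {α β : Type} [Enc α] [Enc β]

@[simp] theorem enc_prod (a : α) (b : β) : enc (a, b) = Data.cons (enc a) (enc b) := rfl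
@[simp] theorem enc_nil : enc ([] : List α) = Data.nil := rfl
@[simp] theorem enc_cons (a : α) (l : List α) : enc (a :: l) = Data.cons (enc a) (enc l) := rfl

/-- The number of cells of the representation. -/
def sz (a : α) : ℕ := (enc a).size

theorem sz_pos (a : α) : 1 ≤ sz a := by
  unfold sz; cases enc a <;> simp [Data.size]; omega

@[simp] theorem sz_prod (a : α) (b : β) : sz (a, b) = 1 + sz a + sz b := rfl
@[simp] theorem sz_nil : sz ([] : List α) = 1 := rfl
@[simp] theorem sz_cons (a : α) (l : List α) : sz (a :: l) = 1 + sz a + sz l := rfl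

theorem sz_prod' (p : α × β) : sz p = 1 + sz p.1 + sz p.2 := rfl

theorem sz_bool (b : Bool) : sz b ≤ 3 := by cases b <;> decide

theorem sz_sign (b : SignType) : sz b ≤ 5 := by cases b <;> decide

theorem length_lt_sz (l : List α) : l.length < sz l := by
  induction l with
  | nil => simp
  | cons a l ih => simp; omega

theorem sz_le_of_mem {a : α} {l : List α} (h : a ∈ l) : sz a ≤ sz l := by
  induction l with
  | nil => simp at h
  | cons b l ih =>
    rcases List.mem_cons.1 h with rfl | h
    · simp; omega
    · have := ih h; simp; omega

theorem sz_append (l l' : List α) : sz (l ++ l') + 1 = sz l + sz l' := by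
  induction l with
  | nil => simp; omega
  | cons a l ih => simp; omega

theorem sz_list_le {l : List α} {N : ℕ} (h : ∀ a ∈ l, sz a ≤ N) :
    sz l ≤ 1 + l.length * (1 + N) := by
  induction l with
  | nil => simp
  | cons a l ih =>
    have h1 := ih fun a ha => h a (List.mem_cons_of_mem _ ha)
    have h2 := h a List.mem_cons_self
    simp only [sz_cons, List.length_cons]
    nlinarith

theorem sz_le_of_sublist {l l' : List α} (h : l.Sublist l') : sz l ≤ sz l' := by
  induction h with
  | slnil => simp
  | cons a _ ih => simp; omega
  | cons_cons a _ ih => simp; omega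

@[simp] theorem sz_reverse (l : List α) : sz l.reverse = sz l := by
  induction l with
  | nil => rfl
  | cons a l ih =>
    have := sz_append l.reverse [a]
    simp only [List.reverse_cons, sz_cons, sz_nil] at *
    omega

end Size

/-- A run takes at least as many steps as its output has cells. -/
theorem Runs.size_le {c : Prog} {x y : Data} {t : ℕ} (h : Runs c x y t) : y.size ≤ t := by
  induction h with
  | id x => omega
  | nil x => simp [Data.size]
  | head x => cases x <;> simp [Data.head, Data.size]; omega
  | tail x => cases x <;> simp [Data.tail, Data.size]; omega
  | pair _ _ h1 h2 => simp [Data.size]; omega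
  | _ => omega

/-- The program `c` computes `f`, with cost at most `mu`. -/
def Computes {α β : Type} [Enc α] [Enc β] (c : Prog) (f : α → β) (mu : α → ℕ) : Prop :=
  ∀ a, ∃ t ≤ mu a, Runs c (enc a) (enc (f a)) t

/-- `f` is computed by a program with cost polynomial in `mu`. -/
def Comp {α β : Type} [Enc α] [Enc β] (f : α → β) (mu : α → ℕ) : Prop :=
  ∃ c tau, Computes c f tau ∧ Dom tau mu

/-- `f` is computable in polynomial time. -/
def PT {α β : Type} [Enc α] [Enc β] (f : α → β) : Prop := Comp f sz

/-! ### Closure properties of polynomial-time computability. -/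

section Closure

variable {α β γ X σ : Type} [Enc α] [Enc β] [Enc γ] [Enc X] [Enc σ]

theorem Comp.mono {f : α → β} {mu nu : α → ℕ} (h : Comp f mu) (h' : Dom mu nu) : Comp f nu := by
  obtain ⟨c, t, hc, ht⟩ := h
  exact ⟨c, t, hc, ht.trans h'⟩

theorem Comp.of_eq {f g : α → β} {mu : α → ℕ} (h : Comp f mu) (e : ∀ a, f a = g a) : Comp g mu := by
  rwa [← show f = g from funext e]

theorem PT.of_eq {f g : α → β} (h : PT f) (e : ∀ a, f a = g a) : PT g := Comp.of_eq h e

/-- Every cell of the output has been paid for, so a time bound is also a size bound. This makes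
polynomial time closed under composition. -/
theorem Comp.sz_dom {f : α → β} {mu : α → ℕ} (h : Comp f mu) : Dom (fun a => sz (f a)) mu := by
  obtain ⟨c, t, hc, ht⟩ := h
  refine ht.mono_left fun a => ?_
  obtain ⟨t, ht, hr⟩ := hc a
  exact hr.size_le.trans ht

theorem PT.sz_dom {f : α → β} (h : PT f) : Dom (fun a => sz (f a)) sz := Comp.sz_dom h

theorem Comp.comp {g : β → γ} {f : α → β} {mu : α → ℕ} {nu : β → ℕ} (hg : Comp g nu)
    (hf : Comp f mu) : Comp (fun a => g (f a)) (fun a => sz a + mu a + nu (f a)) := by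
  obtain ⟨c, t, hc, ht⟩ := hf
  obtain ⟨d, u, hd, hu⟩ := hg
  refine ⟨Prog.seq c d, fun a => 1 + sz a + t a + u (f a), fun a => ?_, ?_⟩
  · obtain ⟨t', h1, h2⟩ := hc a
    obtain ⟨u', h3, h4⟩ := hd (f a)
    exact ⟨_, by dsimp only [sz]; omega, Runs.seq h2 h4⟩
  · exact (((Dom.const 1).add (Dom.of_le fun a => by omega)).add
      (ht.trans (Dom.of_le fun a => by omega))).add
      ((hu.comp f).trans (Dom.of_le fun a => by omega))

theorem PT.comp {g : β → γ} {f : α → β} (hg : PT g) (hf : PT f) : PT (fun a => g (f a)) :=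
  (Comp.comp hg hf).mono (((Dom.refl _).add (Dom.refl _)).add hf.sz_dom)

theorem Comp.pair {f : α → β} {g : α → γ} {mu nu : α → ℕ} (hf : Comp f mu) (hg : Comp g nu) :
    Comp (fun a => (f a, g a)) (fun a => sz a + mu a + nu a) := by
  obtain ⟨c, t, hc, ht⟩ := hf
  obtain ⟨d, u, hd, hu⟩ := hg
  refine ⟨Prog.pair c d, fun a => 1 + sz a + t a + u a, fun a => ?_, ?_⟩
  · obtain ⟨t', h1, h2⟩ := hc a
    obtain ⟨u', h3, h4⟩ := hd a
    exact ⟨_, by dsimp only [sz]; omega, Runs.pair h2 h4⟩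
  · exact (((Dom.const 1).add (Dom.of_le fun a => by omega)).add
      (ht.trans (Dom.of_le fun a => by omega))).add (hu.trans (Dom.of_le fun a => by omega))

theorem PT.pair {f : α → β} {g : α → γ} (hf : PT f) (hg : PT g) : PT (fun a => (f a, g a)) :=
  (Comp.pair hf hg).mono (((Dom.refl _).add (Dom.refl _)).add (Dom.refl _))

theorem PT.of_prog {f : α → β} (c : Prog) (h : ∀ a, Runs c (enc a) (enc (f a)) (1 + sz a)) :
    PT f :=
  ⟨c, fun a => 1 + sz a, fun a => ⟨_, le_rfl, h a⟩, (Dom.const 1).add (Dom.refl _)⟩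

theorem PT.id : PT (fun a : α => a) := PT.of_prog Prog.id fun _ => Runs.id _

theorem PT.fst : PT (fun p : α × β => p.1) := PT.of_prog Prog.head fun p => Runs.head (enc p)

theorem PT.snd : PT (fun p : α × β => p.2) := PT.of_prog Prog.tail fun p => Runs.tail (enc p)

theorem PT.fst' {f : X → α × β} (h : PT f) : PT fun x => (f x).1 := PT.comp PT.fst h

theorem PT.snd' {f : X → α × β} (h : PT f) : PT fun x => (f x).2 := PT.comp PT.snd h

theorem PT.const (b : β) : PT (fun _ : α => b) := by
  -- Each inner node of the constant tree takes one `pair`, so the factor `k` depends on the tree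
  -- and not on the input.
  suffices h : ∀ d : Data, ∃ c k, ∀ x, ∃ t ≤ k * (1 + x.size), Runs c x d t by
    obtain ⟨c, k, h⟩ := h (enc b)
    exact ⟨c, fun a => k * (1 + sz a), fun a => h (enc a),
      (Dom.const k).mul ((Dom.const 1).add (Dom.refl _))⟩
  intro d
  induction d with
  | nil => exact ⟨Prog.nil, 1, fun x => ⟨_, by omega, Runs.nil x⟩⟩
  | cons d e ih1 ih2 =>
    obtain ⟨c1, k1, h1⟩ := ih1
    obtain ⟨c2, k2, h2⟩ := ih2
    refine ⟨Prog.pair c1 c2, 1 + k1 + k2, fun x => ?_⟩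
    obtain ⟨t1, h3, h4⟩ := h1 x
    obtain ⟨t2, h5, h6⟩ := h2 x
    exact ⟨_, by nlinarith, Runs.pair h4 h6⟩

theorem PT.cond {c : X → Bool} {f g : X → α} (hc : PT c) (hf : PT f) (hg : PT g) :
    PT (fun x => bif c x then f x else g x) := by
  obtain ⟨pc, t, hpc, ht⟩ := hc
  obtain ⟨pf, u, hpf, hu⟩ := hf
  obtain ⟨pg, v, hpg, hv⟩ := hg
  refine ⟨Prog.cond pc pf pg, fun a => 1 + sz a + t a + u a + v a, fun a => ?_,
    ((((Dom.const 1).add (Dom.refl _)).add ht).add hu).add hv⟩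
  obtain ⟨t', h1, h2⟩ := hpc a
  obtain ⟨u', h3, h4⟩ := hpf a
  obtain ⟨v', h5, h6⟩ := hpg a
  cases hca : c a with
  | true =>
    rw [hca] at h2
    simp only [hca, cond_true]
    exact ⟨1 + (enc a).size + t' + u', by dsimp only [sz]; omega,
      Runs.cond_true h2 (by simp [enc, Data.ofBool]) h4⟩
  | false =>
    rw [hca] at h2
    simp only [hca, cond_false]
    exact ⟨1 + (enc a).size + t' + v', by dsimp only [sz]; omega, Runs.cond_false h2 h6⟩

theorem PT.cons {f : X → α} {g : X → List α} (hf : PT f) (hg : PT g) : PT fun x => f x :: g x := by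
  obtain ⟨c, t, hc, ht⟩ := PT.pair hf hg
  exact ⟨c, t, hc, ht⟩

/-- The test whether a list is nonempty. -/
theorem PT.isEmpty {f : X → List α} (hf : PT f) : PT fun x => (f x).isEmpty := by
  have h : PT fun l : List α => l.isEmpty := by
    refine ⟨Prog.cond Prog.id Prog.nil (Prog.pair Prog.nil Prog.nil),
      fun l => 5 * (1 + sz l), fun l => ?_, (Dom.const 5).mul ((Dom.const 1).add (Dom.refl _))⟩
    cases l with
    | nil => exact ⟨_, by simp [Data.size], Runs.cond_false (Runs.id _)
        (Runs.pair (Runs.nil _) (Runs.nil _))⟩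
    | cons a l => exact ⟨_, by simp [Data.size, sz]; omega, Runs.cond_true (Runs.id _)
        (by simp) (Runs.nil _)⟩
  exact PT.comp h hf

theorem PT.tail {f : X → List α} (hf : PT f) : PT fun x => (f x).tail := by
  have h : PT fun l : List α => l.tail :=
    PT.of_prog Prog.tail fun l => by cases l <;> exact Runs.tail _
  exact PT.comp h hf

/-- The convention that `nil` has head `nil` turns into a default value, provided that this value is
encoded by `nil`. -/
theorem PT.head_default {f : X → List α} {d : α} (hd : enc d = Data.nil) (hf : PT f) :
    PT fun x => (f x).headD d := by
  have h : PT fun l : List α => l.headD d := PT.of_prog Prog.head fun l => by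
    cases l with
    | nil => simp only [List.headD_nil, hd]; exact Runs.head _
    | cons a l => exact Runs.head _
  exact PT.comp h hf

end Closure

/-! ### Folds and the list operations derived from them. -/

theorem foldl_cons_map {α β : Type} (g : α → β) (l : List α) (s : List β) :
    l.foldl (fun s a => g a :: s) s = (l.map g).reverse ++ s := by
  induction l generalizing s with
  | nil => rfl
  | cons a l ih => simp [ih]

theorem foldl_append_left {α : Type} (l : List (List α)) (s : List α) :
    l.foldl (fun s a => a ++ s) s = l.reverse.flatten ++ s := by
  induction l generalizing s with
  | nil => rfl
  | cons a l ih => simp [ih]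

/-- The step of the computation of `List.zip`. -/
def zipStep {α : Type} (s : List (α × Bool) × List Bool) (a : α) : List (α × Bool) × List Bool :=
  bif s.2.isEmpty then s else ((a, s.2.headD false) :: s.1, s.2.tail)

/-- The unread part of the second list travels in the state. Once it is exhausted the state freezes,
in agreement with the truncation by `List.zip`. -/
theorem foldl_zipStep {α : Type} (l : List α) (r : List Bool) (s : List (α × Bool)) :
    l.foldl zipStep (s, r) = ((l.zip r).reverse ++ s, r.drop l.length) := by
  induction l generalizing s r with
  | nil => simp
  | cons a l ih =>
    cases r with
    | nil => simpa [zipStep] using ih [] s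
    | cons b r => simp [zipStep, ih]

section Fold

variable {α β γ X σ : Type} [Enc α] [Enc β] [Enc γ] [Enc X] [Enc σ]

/-- One pass through the loop of a fold, on states `(l, x, s)`. -/
def foldBody (c : Prog) : Prog :=
  Prog.pair (Prog.seq Prog.head Prog.tail)
    (Prog.pair (Prog.seq Prog.tail Prog.head)
      (Prog.seq
        (Prog.pair (Prog.seq Prog.tail Prog.head)
          (Prog.pair (Prog.seq Prog.tail Prog.tail) (Prog.seq Prog.head Prog.head))) c))

/-- A pass rearranges `((a, l), x, s)` into the argument `(x, s, a)` of the step by a fixed number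
of projections and pairings; 100 is a generous constant for their cost. -/
theorem foldBody_runs {c : Prog} {a l x s s' : Data} {t : ℕ}
    (h : Runs c (Data.cons x (Data.cons s a)) s' t) :
    ∃ t' ≤ 100 * (1 + a.size + l.size + x.size + s.size) + t,
      Runs (foldBody c) (Data.cons (Data.cons a l) (Data.cons x s))
        (Data.cons l (Data.cons x s')) t' := by
  refine ⟨_, ?_, Runs.pair (Runs.seq (Runs.head _) (Runs.tail _))
    (Runs.pair (Runs.seq (Runs.tail _) (Runs.head _))
      (Runs.seq (Runs.pair (Runs.seq (Runs.tail _) (Runs.head _))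
        (Runs.pair (Runs.seq (Runs.tail _) (Runs.tail _))
          (Runs.seq (Runs.head _) (Runs.head _)))) h))⟩
  simp only [Data.head, Data.tail, Data.size]
  omega

/-- The bounds `S` on the accumulator and `T` on the step cost are needed only at prefixes of the
list, that is, at states that the loop reaches. -/
theorem foldLoop_runs {step : X → σ → α → σ} {c : Prog} {tau : X × σ × α → ℕ}
    (hc : Computes c (fun p : X × σ × α => step p.1 p.2.1 p.2.2) tau) (x : X) (S T : ℕ) (l : List α)
    (s : σ) (hT : ∀ l₁ a l₂, l = l₁ ++ a :: l₂ → tau (x, l₁.foldl (step x) s, a) ≤ T)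
    (hS : ∀ l₁ l₂, l = l₁ ++ l₂ → sz (l₁.foldl (step x) s) ≤ S) :
    ∃ t ≤ (l.length + 1) * (120 * (1 + sz l + sz x + S) + T),
      Runs (Prog.loop Prog.head (foldBody c)) (enc (l, x, s)) (enc (([] : List α), x, l.foldl (step x) s)) t := by
  induction l generalizing s with
  | nil =>
    have h0 := hS [] [] rfl
    -- The test `Prog.head` returns the whole remaining list, the first component of the state; its
    -- tree is `nil` exactly when the list is empty.
    refine ⟨_, ?_, Runs.loop_stop (Runs.head _)⟩
    simp only [enc_prod, enc_nil, Data.size, List.length_nil, sz, List.foldl_nil] at *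
    omega
  | cons a l ih =>
    have h0 := hS [] (a :: l) rfl
    obtain ⟨t1, ht1, hr1⟩ := hc (x, s, a)
    have ht1' := hT [] a l rfl
    obtain ⟨t2, ht2, hr2⟩ := foldBody_runs (l := enc l) hr1
    obtain ⟨t3, ht3, hr3⟩ := ih (step x s a)
      (fun l₁ b l₂ h => by simpa using hT (a :: l₁) b l₂ (by simp [h]))
      (fun l₁ l₂ h => by simpa using hS (a :: l₁) l₂ (by simp [h]))
    refine ⟨_, ?_, Runs.loop_step (b := Data.cons (enc a) (enc l)) (Runs.head _) (by simp) hr2 hr3⟩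
    have key : (l.length + 1) * (120 * (1 + sz l + sz x + S) + T) ≤
        (l.length + 1) * (120 * (1 + sz (a :: l) + sz x + S) + T) :=
      Nat.mul_le_mul_left _ (by simp only [sz_cons]; omega)
    have key2 : ((a :: l).length + 1) * (120 * (1 + sz (a :: l) + sz x + S) + T) =
      (l.length + 1) * (120 * (1 + sz (a :: l) + sz x + S) + T) +
        (120 * (1 + sz (a :: l) + sz x + S) + T) := by rw [List.length_cons]; ring
    rw [key2]
    simp only [List.foldl_nil] at h0 ht1'
    have h4 : (enc (a :: l, x, s)).size = 1 + (1 + sz a + sz l) + (1 + sz x + sz s) := rfl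
    have h5 : sz (a :: l) = 1 + sz a + sz l := rfl
    simp only [sz] at *
    omega

/-- Folds: the cost is polynomial in the cost of the steps and the size of all intermediate
results. -/
theorem Comp.foldl {f : X → List α} {i : X → σ} {step : X → σ → α → σ} {nu : X × σ × α → ℕ}
    {N : X → ℕ} (hf : PT f) (hi : PT i)
    (hstep : Comp (fun p : X × σ × α => step p.1 p.2.1 p.2.2) nu)
    (hN : ∀ x l₁ a l₂, f x = l₁ ++ a :: l₂ → nu (x, l₁.foldl (step x) (i x), a) ≤ N x)
    (hS : ∀ x l₁ l₂, f x = l₁ ++ l₂ → sz (l₁.foldl (step x) (i x)) ≤ N x) :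
    Comp (fun x => (f x).foldl (step x) (i x)) (fun x => sz x + N x) := by
  obtain ⟨c, tau, hc, k, hk⟩ := hstep
  obtain ⟨d, u, hd, hu⟩ := PT.pair hf (PT.pair PT.id hi)
  refine ⟨Prog.seq d (Prog.seq (Prog.loop Prog.head (foldBody c)) (Prog.seq Prog.tail Prog.tail)),
    fun x => 20 * (1 + sz x + u x + N x) +
      (sz (f x) + 1) * (120 * (1 + sz (f x) + sz x + N x) + (N x + 2) ^ k), fun x => ?_, ?_⟩
  · obtain ⟨t1, ht1, hr1⟩ := hd x
    obtain ⟨t2, ht2, hr2⟩ := foldLoop_runs (step := step) hc x (N x) ((N x + 2) ^ k) (f x) (i x)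
      (fun l₁ a l₂ h => (hk _).trans (Nat.pow_le_pow_left (by have := hN x l₁ a l₂ h; omega) _))
      (hS x)
    have h3 := hr1.size_le
    have h4 := hS x (f x) [] (by simp)
    refine ⟨_, ?_, Runs.seq hr1 (Runs.seq hr2 (Runs.seq (Runs.tail _) (Runs.tail _)))⟩
    have h5 : ((f x).length + 1) * (120 * (1 + sz (f x) + sz x + N x) + (N x + 2) ^ k) ≤
      (sz (f x) + 1) * (120 * (1 + sz (f x) + sz x + N x) + (N x + 2) ^ k) :=
        Nat.mul_le_mul_right _ (by have := length_lt_sz (f x); omega)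
    simp only [enc_prod, enc_nil, Data.size, Data.tail, sz] at *
    omega
  · have hx : Dom (fun x : X => sz x) (fun x => sz x + N x) := Dom.of_le fun _ => by omega
    have hn : Dom (fun x : X => N x) (fun x => sz x + N x) := Dom.of_le fun _ => by omega
    have hF : Dom (fun x : X => sz (f x)) (fun x => sz x + N x) := hf.sz_dom.trans hx
    exact ((Dom.const 20).mul ((((Dom.const 1).add hx).add (hu.trans hx)).add hn)).add
      ((hF.add (Dom.const 1)).mul (((Dom.const 120).mul
        ((((Dom.const 1).add hF).add hx).add hn)).add ((hn.add (Dom.const 2)).pow k)))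

/-- Polynomial-time steps alone could let the accumulator grow exponentially; the bound `N` on all
intermediate accumulators excludes this. -/
theorem PT.foldl {f : X → List α} {i : X → σ} {step : X → σ → α → σ} {N : X → ℕ}
    (hf : PT f) (hi : PT i) (hstep : PT (fun p : X × σ × α => step p.1 p.2.1 p.2.2))
    (hN : Dom N sz)
    (hS : ∀ x l₁ l₂, f x = l₁ ++ l₂ → sz (l₁.foldl (step x) (i x)) ≤ N x) :
    PT (fun x => (f x).foldl (step x) (i x)) := by
  refine (Comp.foldl (N := fun x => 2 + sz x + N x + sz (f x)) hf hi hstep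
    (fun x l₁ a l₂ h => ?_) (fun x l₁ l₂ h => ?_)).mono ?_
  · have := hS x l₁ _ h
    have h2 : sz a ≤ sz (f x) := sz_le_of_mem (by simp [h])
    simp only [sz_prod]
    omega
  · have := hS x l₁ _ h
    omega
  · exact (Dom.refl _).add ((((Dom.const 2).add (Dom.refl _)).add hN).add hf.sz_dom)

theorem PT.reverse {f : X → List α} (hf : PT f) : PT fun x => (f x).reverse := by
  have h := PT.foldl (step := fun _ (s : List α) a => a :: s) (N := fun x => sz (f x)) hf
    (PT.const []) (PT.cons PT.id.snd'.snd' PT.id.snd'.fst') hf.sz_dom fun x l₁ l₂ h => by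
      rw [foldl_cons_map (fun a => a), h]
      have := sz_append l₁ l₂
      have := sz_pos l₂
      simp
      omega
  exact h.of_eq fun x => by rw [foldl_cons_map (fun a => a)]; simp

theorem PT.map {f : X → List α} {g : X → α → β} (hf : PT f)
    (hg : PT fun p : X × α => g p.1 p.2) : PT fun x => (f x).map (g x) := by
  obtain ⟨k, hk⟩ := hg.sz_dom
  have hE : Dom (fun x => 1 + sz (f x) * (1 + (1 + sz x + sz (f x) + 2) ^ k)) (sz : X → ℕ) :=
    (Dom.const 1).add (hf.sz_dom.mul ((Dom.const 1).add
      (((((Dom.const 1).add (Dom.refl _)).add hf.sz_dom).add (Dom.const 2)).pow k)))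
  have h := PT.foldl (step := fun x (s : List β) a => g x a :: s) hf
    (PT.const []) (PT.cons (PT.comp hg (PT.pair PT.id.fst' PT.id.snd'.snd')) PT.id.snd'.fst') hE
    fun x l₁ l₂ h => by
      rw [foldl_cons_map, List.append_nil, sz_reverse]
      have hb : ∀ b ∈ l₁.map (g x), sz b ≤ (1 + sz x + sz (f x) + 2) ^ k := by
        intro b hb
        obtain ⟨a, ha, rfl⟩ := List.mem_map.1 hb
        refine (hk (x, a)).trans (Nat.pow_le_pow_left ?_ _)
        have : sz a ≤ sz (f x) := sz_le_of_mem (by simp [h, ha])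
        simp only [sz_prod]
        omega
      refine (sz_list_le hb).trans (Nat.add_le_add_left (Nat.mul_le_mul_right _ ?_) _)
      have := length_lt_sz (f x)
      simp only [h, List.length_append, List.length_map] at *
      omega
  exact (PT.reverse h).of_eq fun x => by rw [foldl_cons_map]; simp

theorem PT.append {f g : X → List α} (hf : PT f) (hg : PT g) : PT fun x => f x ++ g x := by
  have h := PT.foldl (step := fun _ (s : List α) a => a :: s) (N := fun x => sz (f x) + sz (g x))
    (PT.reverse hf) hg (PT.cons PT.id.snd'.snd' PT.id.snd'.fst') (hf.sz_dom.add hg.sz_dom)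
    fun x l₁ l₂ h => by
      have h1 := congrArg sz h
      rw [sz_reverse] at h1
      rw [foldl_cons_map (fun a => a), h1]
      have := sz_append l₁ l₂
      have := sz_append l₁.reverse (g x)
      have := sz_pos l₂
      simp at *
      omega
  exact h.of_eq fun x => by rw [foldl_cons_map (fun a => a)]; simp

theorem sz_flatten_le (l : List (List α)) : sz l.flatten ≤ sz l := by
  induction l with
  | nil => rfl
  | cons a l ih => have := sz_append a l.flatten; simp at *; omega

theorem PT.flatten {f : X → List (List α)} (hf : PT f) : PT fun x => (f x).flatten := by
  have h := PT.foldl (step := fun _ (s : List α) a => a ++ s) (N := fun x => sz (f x))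
    (PT.reverse hf) (PT.const []) (PT.append PT.id.snd'.snd' PT.id.snd'.fst') hf.sz_dom
    fun x l₁ l₂ h => by
      have h1 := congrArg sz h
      rw [sz_reverse] at h1
      rw [foldl_append_left, List.append_nil, h1]
      have := sz_append l₁ l₂
      have := sz_flatten_le l₁.reverse
      have := sz_pos l₂
      simp at *
      omega
  exact h.of_eq fun x => by rw [foldl_append_left]; simp

theorem PT.flatMap {f : X → List α} {g : X → α → List β} (hf : PT f)
    (hg : PT fun p : X × α => g p.1 p.2) : PT fun x => (f x).flatMap (g x) :=
  (PT.flatten (PT.map hf hg)).of_eq fun x => by simp [List.flatMap]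

theorem PT.filter {f : X → List α} {g : X → α → Bool} (hf : PT f)
    (hg : PT fun p : X × α => g p.1 p.2) : PT fun x => (f x).filter (g x) := by
  refine (PT.flatMap (g := fun x a => bif g x a then [a] else []) hf
    (PT.cond hg (PT.cons PT.id.snd' (PT.const [])) (PT.const []))).of_eq fun x => ?_
  induction f x with
  | nil => rfl
  | cons a l ih => cases h : g x a <;> simp [h, ih]

theorem PT.not {f : X → Bool} (hf : PT f) : PT fun x => !f x :=
  (PT.cond hf (PT.const false) (PT.const true)).of_eq fun x => by cases f x <;> rfl

theorem PT.and {f g : X → Bool} (hf : PT f) (hg : PT g) : PT fun x => f x && g x :=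
  (PT.cond hf hg (PT.const false)).of_eq fun x => by cases f x <;> rfl

theorem PT.xor {f g : X → Bool} (hf : PT f) (hg : PT g) : PT fun x => f x ^^ g x :=
  (PT.cond hf (PT.not hg) hg).of_eq fun x => by cases f x <;> simp

theorem PT.all {f : X → List α} {g : X → α → Bool} (hf : PT f)
    (hg : PT fun p : X × α => g p.1 p.2) : PT fun x => (f x).all (g x) := by
  refine (PT.foldl (step := fun x s a => s && g x a) (i := fun _ => true) (N := fun _ => 3) hf
    (PT.const _) (PT.and PT.id.snd'.fst' (PT.comp hg (PT.pair PT.id.fst' PT.id.snd'.snd')))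
    (Dom.const 3) fun x l₁ l₂ h => sz_bool _).of_eq fun x => ?_
  suffices h : ∀ (l : List α) s, l.foldl (fun s a => s && g x a) s = (s && l.all (g x)) by
    simp [h]
  intro l
  induction l with
  | nil => simp
  | cons a l ih => intro s; simp [ih, Bool.and_assoc]

theorem PT.any {f : X → List α} {g : X → α → Bool} (hf : PT f)
    (hg : PT fun p : X × α => g p.1 p.2) : PT fun x => (f x).any (g x) :=
  (PT.not (PT.all (g := fun x a => !g x a) hf (PT.not hg))).of_eq fun x => by simp [List.all_eq_not_any_not]

theorem PT.zip {f : X → List α} {g : X → List Bool} (hf : PT f) (hg : PT g) :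
    PT fun x => (f x).zip (g x) := by
  have hs : PT (fun p : X × (List (α × Bool) × List Bool) × α => zipStep p.2.1 p.2.2) :=
    PT.cond (PT.isEmpty PT.id.snd'.fst'.snd') PT.id.snd'.fst'
      (PT.pair (PT.cons (PT.pair PT.id.snd'.snd' (PT.head_default rfl PT.id.snd'.fst'.snd'))
        PT.id.snd'.fst'.fst') (PT.tail PT.id.snd'.fst'.snd'))
  have h := PT.foldl (N := fun x => 2 * sz (f x) + 2 * sz (g x) + 2)
    (i := fun x => (([] : List (α × Bool)), g x)) hf (PT.pair (PT.const _) hg) hs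
    (((((Dom.const 2).mul hf.sz_dom)).add ((Dom.const 2).mul hg.sz_dom)).add (Dom.const 2))
    fun x l₁ l₂ h => by
      have h1 : sz l₁ ≤ sz (f x) := sz_le_of_sublist (by simp [h])
      generalize g x = r at *
      rw [foldl_zipStep, List.append_nil, sz_prod, sz_reverse]
      have h2 : sz (r.drop l₁.length) ≤ sz r := sz_le_of_sublist (List.drop_sublist _ _)
      have h3 : ∀ (l : List α) (r : List Bool), sz (l.zip r) ≤ 2 * sz l + sz r := by
        intro l
        induction l with
        | nil => simp; intros; omega
        | cons a l ih =>
          intro r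
          cases r with
          | nil => simp
          | cons b r => have := ih r; simp; omega
      have := h3 l₁ r
      omega
  exact (PT.reverse h.fst').of_eq fun x => by rw [foldl_zipStep]; simp

theorem PT.zipWith {f : X → List α} {g : X → List Bool} {h : X → α → Bool → β} (hf : PT f)
    (hg : PT g) (hh : PT fun p : X × α × Bool => h p.1 p.2.1 p.2.2) :
    PT fun x => (f x).zipWith (h x) (g x) :=
  (PT.map (g := fun x q => h x q.1 q.2) (PT.zip hf hg) hh).of_eq fun x => by
    rw [List.zip, List.map_zipWith]

theorem PT.beqBool {f g : X → Bool} (hf : PT f) (hg : PT g) : PT fun x => f x == g x :=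
  (PT.not (PT.xor hf hg)).of_eq fun x => by cases f x <;> cases g x <;> rfl

theorem PT.beqProd {α β X : Type} [Enc X] [BEq α] [BEq β]
    {f g : X → α × β} (hf : PT fun x => (f x).1 == (g x).1) (hg : PT fun x => (f x).2 == (g x).2) :
    PT fun x => f x == g x :=
  (PT.and hf hg).of_eq fun _ => rfl

/-- The step of the comparison of two lists. -/
def beqStep (s : Bool × List Bool) (a : Bool) : Bool × List Bool :=
  (s.1 && (!s.2.isEmpty && (a == s.2.headD false)), s.2.tail)

/-- The flag detects a disagreement or a second list that is too short. A second list that is too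
long shows only in the remainder, hence the conjunction. -/
theorem foldl_beqStep (l r : List Bool) (s : Bool) :
    ((l.foldl beqStep (s, r)).1 && (l.foldl beqStep (s, r)).2.isEmpty) = (s && (l == r)) := by
  induction l generalizing s r with
  | nil => cases r <;> simp
  | cons a l ih => cases r <;> simp [beqStep, ih, Bool.and_assoc]

theorem PT.beqList {f g : X → List Bool} (hf : PT f) (hg : PT g) : PT fun x => f x == g x := by
  have hs : PT (fun p : X × (Bool × List Bool) × Bool => beqStep p.2.1 p.2.2) :=
    PT.pair (PT.and PT.id.snd'.fst'.fst' (PT.and (PT.not (PT.isEmpty PT.id.snd'.fst'.snd'))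
      (PT.beqBool PT.id.snd'.snd' (PT.head_default rfl PT.id.snd'.fst'.snd'))))
      (PT.tail PT.id.snd'.fst'.snd')
  have h := PT.foldl (N := fun x => sz (g x) + 4)
    (i := fun x => (true, g x)) hf (PT.pair (PT.const _) hg) hs
    (hg.sz_dom.add (Dom.const 4))
    fun x l₁ l₂ h => by
      have h3 : ∀ (l : List Bool) (s : Bool × List Bool),
          (l.foldl beqStep s).2 = s.2.drop l.length := by
        intro l
        induction l with
        | nil => simp
        | cons a l ih => intro s; simp [ih, beqStep]
      rw [sz_prod', h3]
      have := sz_bool (l₁.foldl beqStep (true, g x)).1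
      have h2 : sz ((g x).drop l₁.length) ≤ sz (g x) := sz_le_of_sublist (List.drop_sublist _ _)
      simp only
      omega
  exact (PT.and h.fst' (PT.isEmpty h.snd')).of_eq fun x => by rw [foldl_beqStep]; simp

theorem PT.elem [BEq α] {f : X → List α} {g : X → α} (hf : PT f) (hg : PT g)
    (he : PT fun p : α × α => p.1 == p.2) : PT fun x => (f x).elem (g x) :=
  (PT.any (g := fun x a => g x == a) hf
    (PT.comp he (PT.pair (PT.comp hg PT.id.fst') PT.id.snd'))).of_eq fun x => by
      induction f x with
      | nil => rfl
      | cons a l ih => rw [List.any_cons, ih, List.elem_cons]; cases g x == a <;> rfl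

/-- A list without its repetitions. -/
def nub {α : Type} [BEq α] (l : List α) : List α :=
  l.foldl (fun s a => bif s.elem a then s else a :: s) []

theorem PT.nub [BEq α] {f : X → List α} (hf : PT f)
    (he : PT fun p : α × α => p.1 == p.2) : PT fun x => nub (f x) := by
  refine PT.foldl (N := fun x => sz (f x)) hf (PT.const _)
    (step := fun _ s a => bif s.elem a then s else a :: s)
    (PT.cond (PT.elem PT.id.snd'.fst' PT.id.snd'.snd' he) PT.id.snd'.fst'
      (PT.cons PT.id.snd'.snd' PT.id.snd'.fst')) hf.sz_dom fun x l₁ l₂ h => ?_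
  have h1 : sz l₁ ≤ sz (f x) := sz_le_of_sublist (by simp [h])
  suffices h : ∀ (l s : List α),
      sz (l.foldl (fun s a => bif s.elem a then s else a :: s) s) + 1 ≤ sz s + sz l by
    have := h l₁ []
    simp only [sz_nil] at this
    omega
  intro l
  induction l with
  | nil => simp
  | cons a l ih =>
    intro s
    simp only [List.foldl_cons]
    have := ih (bif s.elem a then s else a :: s)
    cases hsa : s.elem a <;> simp only [hsa, cond_true, cond_false, sz_cons] at * <;> omega

end Fold

theorem nub_spec {α : Type} [BEq α] [LawfulBEq α] (l : List α) : (nub l).Nodup ∧ ∀ a, a ∈ nub l ↔ a ∈ l := by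
  suffices h : ∀ (l s : List α), s.Nodup →
      (l.foldl (fun s a => bif s.elem a then s else a :: s) s).Nodup ∧
      ∀ a, a ∈ (l.foldl (fun s a => bif s.elem a then s else a :: s) s) ↔ a ∈ s ∨ a ∈ l by
    have := h l [] List.nodup_nil
    simp only [List.not_mem_nil, false_or] at this
    exact this
  intro l
  induction l with
  | nil => simp
  | cons b l ih =>
    intro s hs
    by_cases hb : b ∈ s
    · obtain ⟨h1, h2⟩ := ih s hs
      simp only [List.foldl_cons, List.elem_eq_contains, List.contains_iff_mem.2 hb, cond_true] at *
      refine ⟨h1, fun a => ?_⟩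
      rw [h2, List.mem_cons]
      constructor
      · tauto
      · rintro (h | rfl | h) <;> tauto
    · obtain ⟨h1, h2⟩ := ih (b :: s) (List.nodup_cons.2 ⟨hb, hs⟩)
      have hb' : s.contains b = false := by simpa using hb
      simp only [List.foldl_cons, List.elem_eq_contains, hb', cond_false] at *
      refine ⟨h1, fun a => ?_⟩
      rw [h2, List.mem_cons, List.mem_cons]
      tauto

/-! ### The algorithm -/

/-- Symplectic representations, with lists of bits: `((neg, im), a, b)`. -/
abbrev PauliCode : Type := (Bool × Bool) × (List Bool × List Bool)

/-- The dot product of two bit strings. -/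
def dot (a b : List Bool) : Bool := (a.zipWith Bool.and b).foldl Bool.xor false

namespace PauliCode

/-- The symplectic form: whether two Pauli operators anticommute. -/
def symp (P Q : PauliCode) : Bool := dot P.2.1 Q.2.2 ^^ dot P.2.2 Q.2.1

/-- The product of two Pauli operators. -/
def mul (P Q : PauliCode) : PauliCode :=
  (((P.1.1 ^^ Q.1.1) ^^ ((P.1.2 && Q.1.2) ^^ dot P.2.2 Q.2.1), P.1.2 ^^ Q.1.2),
    (P.2.1.zipWith Bool.xor Q.2.1, P.2.2.zipWith Bool.xor Q.2.2))

/-- The negative of a Pauli operator. -/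
def neg (P : PauliCode) : PauliCode := ((!P.1.1, P.1.2), P.2)

end PauliCode

/-- The first phase: the input together with the adjacency matrix of the frustration graph. -/
def graphAlg (l : List PauliCode) : List PauliCode × List (List Bool) :=
  (l, l.map fun P => l.map fun Q => P.symp Q)

/-- Whether the characteristic vector `J` is that of a maximal independent set of the graph induced
by the first `J.length` vertices. -/
def misTest (A : List (List Bool)) (J : List Bool) : Bool :=
  (A.zip J).all fun q => q.2 ^^ (q.1.zipWith Bool.and J).any fun b => b

/-- The two candidates that come from a maximal independent set when a vertex is added. -/
def candidates (r I : List Bool) : List (List Bool) :=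
  [I ++ [false], (r.zipWith (fun r i => i && !r) I) ++ [true]]

/-- The step from the maximal independent sets of the graph induced by the first `k` vertices to
those for the first `k + 1` vertices. -/
def setStep (A : List (List Bool)) (L : List (List Bool)) (r : List Bool) : List (List Bool) :=
  nub ((L.flatMap (candidates r)).filter (misTest A))

/-- The second phase: the input together with the list of maximal independent sets. -/
def setsAlg (x : List PauliCode × List (List Bool)) : List PauliCode × List (List Bool) :=
  (x.1, x.2.foldl (setStep x.2) [[]])

/-- The states of the third phase: a partial vector and the list of all elements of the group that
is generated by the signed observables. -/
abbrev SignState : Type := List SignType × List PauliCode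

/-- The group that is generated by `G` and `P`. -/
def adjoin (G : List PauliCode) (P : PauliCode) : List PauliCode :=
  bif G.elem P then G else G ++ G.map P.mul

/-- Extend a state by the signed observable `P` with sign `s`, unless this is not admissible. -/
def extend (P : PauliCode) (s : SignType) (st : SignState) : List SignState :=
  bif st.2.elem P.neg then [] else [(st.1 ++ [s], adjoin st.2 P)]

/-- The step of the third phase for the observable `q.1`, where `q.2` tells whether it is selected. -/
def signStep (A : List SignState) (q : PauliCode × Bool) : List SignState :=
  bif q.2 then A.flatMap fun st => extend q.1 1 st ++ extend q.1.neg (-1) st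
  else A.map fun st => (st.1 ++ [0], st.2)

/-- The states before the first step. -/
def signInit (l : List PauliCode) : List SignState := [([], nub (l.map fun P => P.mul P))]

/-- The vectors of all admissible signs for the set with characteristic vector `S`. -/
def signs (l : List PauliCode) (S : List Bool) : List (List SignType) :=
  ((l.zip S).foldl signStep (signInit l)).map Prod.fst

/-- The third phase. -/
def signsAlg (x : List PauliCode × List (List Bool)) : List (List SignType) :=
  x.2.foldl (fun s S => s ++ signs x.1 S) []

/-! ### Folds whose intermediate results may be of exponential size. -/

section FoldCost

variable {α σ : Type} [Enc σ]

/-- The sum of the sizes of all intermediate results of a fold. -/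
def foldCost (step : σ → α → σ) (i : σ) (l : List α) : ℕ :=
  (l.inits.map fun l₁ => sz (l₁.foldl step i)).sum

theorem le_foldCost (step : σ → α → σ) (i : σ) {l l₁ l₂ : List α} (h : l = l₁ ++ l₂) :
    sz (l₁.foldl step i) ≤ foldCost step i l :=
  List.le_sum_of_mem (List.mem_map.2 ⟨l₁, (List.mem_inits _ _).2 ⟨l₂, h.symm⟩, rfl⟩)

theorem foldCost_le (step : σ → α → σ) (i : σ) {l : List α} {B : ℕ}
    (h : ∀ l₁ l₂, l = l₁ ++ l₂ → sz (l₁.foldl step i) ≤ B) :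
    foldCost step i l ≤ (l.length + 1) * B := by
  refine (List.sum_le_card_nsmul _ B ?_).trans (by simp)
  intro b hb
  obtain ⟨l₁, h1, rfl⟩ := List.mem_map.1 hb
  obtain ⟨l₂, h2⟩ := (List.mem_inits _ _).1 h1
  exact h l₁ l₂ h2.symm

end FoldCost

/-! ### Cost of the three phases in terms of their intermediate results. -/

section Complexity

variable {α σ X : Type} [Enc α] [Enc σ] [Enc X]

theorem PT.dot {f g : X → List Bool} (hf : PT f) (hg : PT g) : PT fun x => dot (f x) (g x) :=
  PT.foldl (f := fun x => (f x).zipWith Bool.and (g x)) (i := fun _ => false)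
    (step := fun _ => Bool.xor) (N := fun _ => 3)
    (PT.zipWith (h := fun _ => Bool.and) hf hg (PT.and PT.id.snd'.fst' PT.id.snd'.snd'))
    (PT.const _) (PT.xor PT.id.snd'.fst' PT.id.snd'.snd') (Dom.const 3) fun _ _ _ _ => sz_bool _

theorem PT.symp {f g : X → PauliCode} (hf : PT f) (hg : PT g) : PT fun x => (f x).symp (g x) :=
  PT.xor (PT.dot hf.snd'.fst' hg.snd'.snd') (PT.dot hf.snd'.snd' hg.snd'.fst')

theorem PT.zipXor {f g : X → List Bool} (hf : PT f) (hg : PT g) :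
    PT fun x => (f x).zipWith Bool.xor (g x) :=
  PT.zipWith (h := fun _ => Bool.xor) hf hg (PT.xor PT.id.snd'.fst' PT.id.snd'.snd')

theorem PT.mul {f g : X → PauliCode} (hf : PT f) (hg : PT g) : PT fun x => (f x).mul (g x) :=
  PT.pair (PT.pair (PT.xor (PT.xor hf.fst'.fst' hg.fst'.fst')
      (PT.xor (PT.and hf.fst'.snd' hg.fst'.snd') (PT.dot hf.snd'.snd' hg.snd'.fst')))
      (PT.xor hf.fst'.snd' hg.fst'.snd'))
    (PT.pair (PT.zipXor hf.snd'.fst' hg.snd'.fst') (PT.zipXor hf.snd'.snd' hg.snd'.snd'))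

theorem PT.neg {f : X → PauliCode} (hf : PT f) : PT fun x => (f x).neg :=
  PT.pair (PT.pair (PT.not hf.fst'.fst') hf.fst'.snd') hf.snd'

theorem PT.beqCode : PT fun p : PauliCode × PauliCode => p.1 == p.2 :=
  PT.beqProd (PT.beqProd (PT.beqBool PT.id.fst'.fst'.fst' PT.id.snd'.fst'.fst')
      (PT.beqBool PT.id.fst'.fst'.snd' PT.id.snd'.fst'.snd'))
    (PT.beqProd (PT.beqList PT.id.fst'.snd'.fst' PT.id.snd'.snd'.fst')
      (PT.beqList PT.id.fst'.snd'.snd' PT.id.snd'.snd'.snd'))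

theorem graphAlg_PT : PT graphAlg :=
  PT.pair PT.id (PT.map (g := fun l (P : PauliCode) => l.map fun Q => P.symp Q) PT.id
    (PT.map (g := fun (p : List PauliCode × PauliCode) Q => p.2.symp Q) PT.id.fst'
      (PT.symp PT.id.fst'.snd' PT.id.snd')))

theorem PT.misTest {f : X → List (List Bool)} {g : X → List Bool} (hf : PT f) (hg : PT g) :
    PT fun x => misTest (f x) (g x) :=
  PT.all (g := fun x (q : List Bool × Bool) => q.2 ^^ (q.1.zipWith Bool.and (g x)).any fun b => b)
    (PT.zip hf hg)
    (PT.xor PT.id.snd'.snd' (PT.any (g := fun _ b => b)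
      (PT.zipWith (h := fun _ => Bool.and) PT.id.snd'.fst' (PT.comp hg PT.id.fst')
        (PT.and PT.id.snd'.fst' PT.id.snd'.snd')) PT.id.snd'))

theorem PT.candidates {f g : X → List Bool} (hf : PT f) (hg : PT g) :
    PT fun x => candidates (f x) (g x) :=
  PT.cons (PT.append hg (PT.const _)) (PT.cons (PT.append
    (PT.zipWith (h := fun _ r i => i && !r) hf hg (PT.and PT.id.snd'.snd' (PT.not PT.id.snd'.fst')))
    (PT.const _)) (PT.const _))

theorem PT.setStep {f g : X → List (List Bool)} {h : X → List Bool} (hf : PT f) (hg : PT g)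
    (hh : PT h) : PT fun x => setStep (f x) (g x) (h x) :=
  PT.nub (PT.filter (g := fun x => ReducedStabilizer.misTest (f x))
    (PT.flatMap (g := fun x => ReducedStabilizer.candidates (h x)) hg
      (PT.candidates (PT.comp hh PT.id.fst') PT.id.snd'))
    (PT.misTest (PT.comp hf PT.id.fst') PT.id.snd')) (PT.beqList PT.id.fst' PT.id.snd')

/-- No polynomial bound on the accumulators is assumed: their total size enters the cost, to be
bounded later by counting sets and signs. -/
theorem Comp.foldl_cost {f : X → List α} {i : X → σ} {step : X → σ → α → σ} (hf : PT f) (hi : PT i)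
    (hstep : PT (fun p : X × σ × α => step p.1 p.2.1 p.2.2)) :
    Comp (fun x => (f x).foldl (step x) (i x)) (fun x => sz x + foldCost (step x) (i x) (f x)) := by
  refine (Comp.foldl (N := fun x => 2 + sz x + foldCost (step x) (i x) (f x) + sz (f x)) hf hi hstep
    (fun x l₁ a l₂ h => ?_) (fun x l₁ l₂ h => ?_)).mono ?_
  · have := le_foldCost (step x) (i x) h
    have h2 : sz a ≤ sz (f x) := sz_le_of_mem (by simp [h])
    simp only [sz_prod]
    omega
  · have := le_foldCost (step x) (i x) h
    omega
  · have hx : Dom (fun x : X => sz x) (fun x => sz x + foldCost (step x) (i x) (f x)) :=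
      Dom.of_le fun _ => by omega
    exact hx.add ((((Dom.const 2).add hx).add (Dom.of_le fun _ => by omega)).add
      (hf.sz_dom.trans hx))

theorem setsAlg_comp : Comp setsAlg fun x => sz x + foldCost (setStep x.2) [[]] x.2 := by
  refine (Comp.pair PT.fst (Comp.foldl_cost (f := fun x : List PauliCode × List (List Bool) => x.2)
    (i := fun _ => [[]]) (step := fun x => setStep x.2) PT.snd (PT.const _)
    (PT.setStep PT.id.fst'.snd' PT.id.snd'.fst' PT.id.snd'.snd'))).mono ?_
  exact ((Dom.of_le fun _ => by omega).add (Dom.of_le fun _ => by omega)).add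
    (Dom.of_le fun _ => by omega)

theorem PT.adjoin {f : X → List PauliCode} {g : X → PauliCode} (hf : PT f) (hg : PT g) :
    PT fun x => adjoin (f x) (g x) :=
  PT.cond (PT.elem hf hg PT.beqCode) hf (PT.append hf (PT.map (g := fun x => (g x).mul) hf
    (PT.mul (PT.comp hg PT.id.fst') PT.id.snd')))

theorem PT.extend {f : X → PauliCode} {s : SignType} {g : X → SignState} (hf : PT f) (hg : PT g) :
    PT fun x => extend (f x) s (g x) :=
  PT.cond (PT.elem hg.snd' (PT.neg hf) PT.beqCode) (PT.const _)
    (PT.cons (PT.pair (PT.append hg.fst' (PT.const _)) (PT.adjoin hg.snd' hf)) (PT.const _))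

theorem PT.signStep {f : X → List SignState} {g : X → PauliCode × Bool} (hf : PT f) (hg : PT g) :
    PT fun x => signStep (f x) (g x) := by
  have hg' : PT fun p : X × SignState => g p.1 := PT.comp hg PT.id.fst'
  exact PT.cond hg.snd'
    (PT.flatMap (g := fun x st => ReducedStabilizer.extend (g x).1 1 st ++
      ReducedStabilizer.extend (g x).1.neg (-1) st) hf
      (PT.append (PT.extend hg'.fst' PT.id.snd') (PT.extend (PT.neg hg'.fst') PT.id.snd')))
    (PT.map (g := fun _ (st : SignState) => (st.1 ++ [0], st.2)) hf
      (PT.pair (PT.append PT.id.snd'.fst' (PT.const _)) PT.id.snd'.snd'))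

theorem PT.signInit {f : X → List PauliCode} (hf : PT f) : PT fun x => signInit (f x) :=
  PT.cons (PT.pair (PT.const _) (PT.nub (PT.map (g := fun _ P => P.mul P) hf
    (PT.mul PT.id.snd' PT.id.snd')) PT.beqCode)) (PT.const _)

/-- The cost of the third phase for one set. -/
def signsCost (l : List PauliCode) (S : List Bool) : ℕ :=
  foldCost signStep (signInit l) (l.zip S)

theorem signs_comp : Comp (fun p : List PauliCode × List Bool => signs p.1 p.2)
    fun p => sz p + signsCost p.1 p.2 := by
  have h := Comp.foldl_cost (f := fun p : List PauliCode × List Bool => p.1.zip p.2)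
    (i := fun p => signInit p.1) (step := fun _ => signStep) (PT.zip PT.fst PT.snd)
    (PT.signInit PT.fst) (PT.signStep PT.id.snd'.fst' PT.id.snd'.snd')
  have hm : PT fun A : List SignState => A.map Prod.fst :=
    PT.map (g := fun _ => Prod.fst) PT.id PT.id.snd'.fst'
  exact (Comp.comp hm h).mono (((Dom.of_le fun _ => by omega).add (Dom.refl _)).add h.sz_dom)

/-- The cost of the third phase. -/
def signsAlgCost (l : List PauliCode) (Ls : List (List Bool)) : ℕ :=
  foldCost (fun s S => s ++ signs l S) [] Ls + (Ls.map (signsCost l)).sum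

/-- The step of the outer fold is not polynomial in its argument, as it contains the inner fold over
the observables. Its cost is charged to the sum of `signsCost` over the listed sets. -/
theorem signsAlg_comp : Comp signsAlg fun x => sz x + signsAlgCost x.1 x.2 := by
  have hs : Comp (fun p : (List PauliCode × List (List Bool)) × List (List SignType) × List Bool =>
      signs p.1.1 p.2.2) fun p => sz p + signsCost p.1.1 p.2.2 := by
    refine (Comp.comp signs_comp (f := fun p : (List PauliCode × List (List Bool)) ×
      List (List SignType) × List Bool => (p.1.1, p.2.2))
      (PT.pair PT.id.fst'.fst' PT.id.snd'.snd')).mono ?_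
    refine ((Dom.of_le fun _ => by omega).add (Dom.of_le fun _ => by omega)).add
      (Dom.of_le fun p => ?_)
    simp only [sz_prod']
    omega
  have hstep : Comp (fun p : (List PauliCode × List (List Bool)) × List (List SignType) × List Bool =>
      p.2.1 ++ signs p.1.1 p.2.2) fun p => sz p + signsCost p.1.1 p.2.2 := by
    have hp := Comp.pair (PT.id.snd'.fst' : PT fun p : (List PauliCode × List (List Bool)) ×
      List (List SignType) × List Bool => p.2.1) hs
    refine (Comp.comp (PT.append PT.fst PT.snd) hp).mono
      (((Dom.of_le fun _ => by omega).add ?_).add (hp.sz_dom.trans ?_)) <;>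
    exact ((Dom.of_le fun _ => by omega).add (Dom.of_le fun _ => by omega)).add
      (Dom.of_le fun _ => by omega)
  refine (Comp.foldl (f := fun x : List PauliCode × List (List Bool) => x.2) (i := fun _ => [])
    (step := fun x s S => s ++ signs x.1 S)
    (N := fun x => 2 + 2 * sz x + signsAlgCost x.1 x.2) PT.snd (PT.const _) hstep
    (fun x l₁ a l₂ h => ?_) fun x l₁ l₂ h => ?_).mono ?_
  · have h1 := le_foldCost (fun s S => s ++ signs x.1 S) [] h
    have h2 : sz a ≤ sz x.2 := sz_le_of_mem (by simp [h])
    have h3 : signsCost x.1 a ≤ (x.2.map (signsCost x.1)).sum :=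
      List.le_sum_of_mem (List.mem_map.2 ⟨a, by simp [h], rfl⟩)
    simp only [sz_prod', signsAlgCost] at *
    omega
  · have h1 := le_foldCost (fun s S => s ++ signs x.1 S) [] h
    simp only [signsAlgCost] at *
    omega
  · exact ((Dom.of_le fun _ => by omega).add ((((Dom.const 2)).add ((Dom.const 2).mul
      (Dom.of_le fun _ => by omega))).add (Dom.of_le fun _ => by omega)))

end Complexity

/-! ### The Pauli group in terms of symplectic representations -/

/-- The sign `(-1)^b`. -/
def bsign (b : Bool) : ℂ := if b then -1 else 1

@[simp] theorem bsign_false : bsign false = 1 := rfl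
@[simp] theorem bsign_true : bsign true = -1 := rfl

theorem bsign_xor (a b : Bool) : bsign (a ^^ b) = bsign a * bsign b := by
  cases a <;> cases b <;> simp

theorem bsign_injective : Function.Injective bsign := by
  intro a b h
  cases a <;> cases b <;> simp [bsign] at h ⊢ <;> norm_num [Complex.ext_iff] at h

/-! ### Tensor products and the algebra of single-qubit Pauli matrices. -/

section Tensor

variable {n : ℕ}

theorem tensor_mul (A B : Fin n → Matrix (Fin 2) (Fin 2) ℂ) :
    tensor A * tensor B = tensor fun i => A i * B i := by
  ext x y
  simp only [tensor, Matrix.mul_apply, Matrix.of_apply, Finset.prod_univ_sum,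
    Fintype.piFinset_univ, Finset.prod_mul_distrib]

theorem tensor_smul (c : Fin n → ℂ) (A : Fin n → Matrix (Fin 2) (Fin 2) ℂ) :
    (tensor fun i => c i • A i) = (∏ i, c i) • tensor A := by
  ext x y
  simp [tensor, Finset.prod_mul_distrib]

theorem tensor_one : tensor (fun _ : Fin n => (1 : Matrix (Fin 2) (Fin 2) ℂ)) = 1 := by
  ext x y
  simp only [tensor, Matrix.of_apply, Matrix.one_apply, Finset.prod_ite_zero, Finset.mem_univ,
    true_implies, funext_iff, Finset.prod_const_one]

theorem tensor_conjTranspose (A : Fin n → Matrix (Fin 2) (Fin 2) ℂ) :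
    (tensor A).conjTranspose = tensor fun i => (A i).conjTranspose := by
  ext x y
  simp [tensor]

theorem trace_tensor (A : Fin n → Matrix (Fin 2) (Fin 2) ℂ) :
    (tensor A).trace = ∏ i, (A i).trace := by
  simp only [tensor, Matrix.trace, Matrix.diag, Matrix.of_apply, Finset.prod_univ_sum,
    Fintype.piFinset_univ]

end Tensor

/-- The single-qubit operator `X^a Z^b`. -/
noncomputable def site (a b : Bool) : Matrix (Fin 2) (Fin 2) ℂ :=
  (if a then pauliX else 1) * (if b then pauliZ else 1)

theorem site_mul (a b c d : Bool) :
    site a b * site c d = bsign (b && c) • site (a ^^ c) (b ^^ d) := by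
  cases a <;> cases b <;> cases c <;> cases d <;> ext i j <;> fin_cases i <;> fin_cases j <;>
    simp [site, pauliX, pauliZ]

theorem site_conjTranspose (a b : Bool) :
    (site a b).conjTranspose = bsign (b && a) • site a b := by
  cases a <;> cases b <;> ext i j <;> fin_cases i <;> fin_cases j <;>
    simp [site, pauliX, pauliZ, Matrix.conjTranspose_apply]

theorem trace_site (a b : Bool) : (site a b).trace = if a || b then 0 else 2 := by
  cases a <;> cases b <;> simp [site, pauliX, pauliZ, Matrix.trace_fin_two]

/-- The dot product of two bit strings. -/
def bdot {n : ℕ} (x y : Fin n → Bool) : Bool := dot (List.ofFn x) (List.ofFn y)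

theorem zipWith_ofFn {α β γ : Type} {n : ℕ} (f : α → β → γ) (x : Fin n → α) (y : Fin n → β) :
    List.zipWith f (List.ofFn x) (List.ofFn y) = List.ofFn fun i => f (x i) (y i) := by
  induction n with
  | zero => simp
  | succ n ih => simp [List.ofFn_succ, ih]

/-- Signs turn parities into products. With `bsign_injective`, identities for `bdot` follow from
factorwise identities. -/
theorem bsign_bdot {n : ℕ} (x y : Fin n → Bool) :
    bsign (bdot x y) = ∏ i, bsign (x i && y i) := by
  have h : ∀ (l : List Bool) s, bsign (l.foldl Bool.xor s) = bsign s * (l.map bsign).prod := by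
    intro l
    induction l with
    | nil => simp
    | cons a l ih => intro s; simp [ih, bsign_xor, mul_assoc]
  rw [bdot, dot, zipWith_ofFn, h, List.map_ofFn, List.prod_ofFn]
  simp

theorem bdot_comm {n : ℕ} (x y : Fin n → Bool) : bdot x y = bdot y x := by
  apply bsign_injective
  simp [bsign_bdot, Bool.and_comm]

theorem bdot_xor {n : ℕ} (x y z : Fin n → Bool) :
    bdot (fun i => x i ^^ y i) z = (bdot x z ^^ bdot y z) := by
  apply bsign_injective
  simp only [bsign_bdot, bsign_xor, ← Finset.prod_mul_distrib]
  exact Finset.prod_congr rfl fun i _ => by rw [← bsign_xor, Bool.and_xor_distrib_right]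

theorem bdot_single {n : ℕ} (x : Fin n → Bool) (i : Fin n) :
    bdot x (fun j => decide (j = i)) = x i := by
  apply bsign_injective
  rw [bsign_bdot, Finset.prod_eq_single i]
  · simp
  · intro j _ hj; simp [hj]
  · simp

theorem bdot_zero {n : ℕ} (x : Fin n → Bool) : bdot x (fun _ => false) = false := by
  apply bsign_injective
  simp [bsign_bdot]

namespace Pauli

variable {n : ℕ}

theorem ext_iff' {P Q : Pauli n} :
    P = Q ↔ P.neg = Q.neg ∧ P.im = Q.im ∧ P.a = Q.a ∧ P.b = Q.b := by
  cases P; cases Q; simp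

instance : Mul (Pauli n) :=
  ⟨fun P Q => ⟨(P.neg ^^ Q.neg) ^^ ((P.im && Q.im) ^^ bdot P.b Q.a), P.im ^^ Q.im,
    fun i => P.a i ^^ Q.a i, fun i => P.b i ^^ Q.b i⟩⟩

instance : One (Pauli n) := ⟨⟨false, false, fun _ => false, fun _ => false⟩⟩

instance : Inv (Pauli n) := ⟨fun P => ⟨(P.neg ^^ P.im) ^^ bdot P.b P.a, P.im, P.a, P.b⟩⟩

instance : Neg (Pauli n) := ⟨fun P => ⟨!P.neg, P.im, P.a, P.b⟩⟩

theorem mul_def (P Q : Pauli n) : P * Q =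
  ⟨(P.neg ^^ Q.neg) ^^ ((P.im && Q.im) ^^ bdot P.b Q.a), P.im ^^ Q.im,
    fun i => P.a i ^^ Q.a i, fun i => P.b i ^^ Q.b i⟩ := rfl

theorem one_def : (1 : Pauli n) = ⟨false, false, fun _ => false, fun _ => false⟩ := rfl

theorem inv_def (P : Pauli n) : P⁻¹ = ⟨(P.neg ^^ P.im) ^^ bdot P.b P.a, P.im, P.a, P.b⟩ := rfl

theorem neg_def (P : Pauli n) : -P = ⟨!P.neg, P.im, P.a, P.b⟩ := rfl

theorem phase_eq (P : Pauli n) : P.phase = bsign P.neg * (if P.im then Complex.I else 1) := rfl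

theorem phase_ne_zero (P : Pauli n) : P.phase ≠ 0 := by
  rw [phase_eq]
  cases P.neg <;> cases P.im <;> simp

theorem phase_injective {P Q : Pauli n} (h : P.phase = Q.phase) : P.neg = Q.neg ∧ P.im = Q.im := by
  simp only [phase_eq] at h
  revert h
  cases P.neg <;> cases P.im <;> cases Q.neg <;> cases Q.im <;> simp [Complex.ext_iff] <;> norm_num

theorem op_eq (P : Pauli n) : P.op = P.phase • tensor fun i => site (P.a i) (P.b i) := by
  rw [op, tensor_mul]; rfl

theorem op_mul (P Q : Pauli n) : (P * Q).op = P.op * Q.op := by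
  simp only [op_eq, Matrix.smul_mul, Matrix.mul_smul, tensor_mul, site_mul, tensor_smul, smul_smul]
  rw [← bsign_bdot, mul_def]
  congr 1
  simp only [phase_eq]
  cases P.neg <;> cases Q.neg <;> cases P.im <;> cases Q.im <;> cases bdot P.b Q.a <;> simp

theorem op_one : (1 : Pauli n).op = 1 := by
  rw [op_eq, one_def]
  simp [phase_eq, site, tensor_one]

theorem op_neg (P : Pauli n) : (-P).op = -P.op := by
  rw [op_eq, op_eq, neg_def]
  simp only [phase_eq]
  cases P.neg <;> cases P.im <;> simp

/-- `X^a Z^b` maps the basis vector at 0 to the one at `a`, so column 0 has its only nonzero entry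
in row `a`, equal to the phase. This determines `a` and the phase. Flipping bit `i` of the input
multiplies the entry by `(-1)^(b i)`, which determines `b`. -/
theorem op_injective : Function.Injective (op : Pauli n → Operator n) := by
  have hs0 : ∀ a b : Bool, site a b (if a then 1 else 0) 0 = 1 := by
    intro a b; cases a <;> cases b <;> simp [site, pauliX, pauliZ]
  have hs1 : ∀ a b a' : Bool, site a' b (if a then 1 else 0) 0 ≠ 0 → a' = a := by
    intro a b a'; cases a <;> cases b <;> cases a' <;> simp [site, pauliX, pauliZ]
  have hs2 : ∀ a b : Bool, site a b (if a then 0 else 1) 1 = bsign b := by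
    intro a b; cases a <;> cases b <;> simp [site, pauliX, pauliZ]
  intro P Q h
  rw [op_eq, op_eq] at h
  have e : ∀ x y : Fin n → Fin 2, P.phase * ∏ i, site (P.a i) (P.b i) (x i) (y i) =
      Q.phase * ∏ i, site (Q.a i) (Q.b i) (x i) (y i) := fun x y => by
    simpa [tensor] using congrFun (congrFun h x) y
  have h1 := e (fun i => if P.a i then 1 else 0) fun _ => 0
  simp only [hs0, Finset.prod_const_one, mul_one] at h1
  have ha : P.a = Q.a := by
    funext i
    have h2 : ∏ i, site (Q.a i) (Q.b i) (if P.a i then 1 else 0) 0 ≠ 0 := by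
      intro h0
      rw [h0, mul_zero] at h1
      exact P.phase_ne_zero h1
    exact (hs1 _ _ _ (Finset.prod_ne_zero_iff.1 h2 i (Finset.mem_univ _))).symm
  have h3 : P.phase = Q.phase := by
    rw [ha] at h1
    simpa [hs0] using h1
  obtain ⟨h4, h5⟩ := phase_injective h3
  refine ext_iff'.2 ⟨h4, h5, ha, ?_⟩
  funext i
  have h6 := e (fun j => if j = i then (if P.a j then 0 else 1) else (if P.a j then 1 else 0))
    fun j => if j = i then 1 else 0
  rw [← h3] at h6
  have h7 := mul_left_cancel₀ P.phase_ne_zero h6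
  rw [Finset.prod_eq_single i, Finset.prod_eq_single i] at h7
  · simp only [if_true, hs2] at h7
    rw [ha, hs2] at h7
    exact bsign_injective h7
  · intro j _ hj; simp only [hj, if_false, ha, hs0]
  · simp
  · intro j _ hj; simp only [hj, if_false, hs0]
  · simp

/-- Associativity and the unit law are pulled back along the injective map `op`; the inverse is
checked on the bits. -/
instance : Group (Pauli n) :=
  Group.ofLeftAxioms (fun P Q R => op_injective (by simp only [op_mul, mul_assoc]))
    (fun P => op_injective (by simp [op_mul, op_one]))
    (fun P => by
      rw [mul_def, inv_def, one_def, ext_iff']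
      cases P.neg <;> cases P.im <;> simp)

instance : HasDistribNeg (Pauli n) where
  neg_neg P := op_injective (by simp [op_neg])
  neg_mul P Q := op_injective (by simp [op_neg, op_mul])
  mul_neg P Q := op_injective (by simp [op_neg, op_mul])

/-- The equivalence with tuples of bits. -/
def equivTuple (n : ℕ) : Pauli n ≃ (Bool × Bool) × ((Fin n → Bool) × (Fin n → Bool)) where
  toFun P := ((P.neg, P.im), (P.a, P.b))
  invFun t := ⟨t.1.1, t.1.2, t.2.1, t.2.2⟩
  left_inv _ := rfl
  right_inv _ := rfl

instance : Fintype (Pauli n) := Fintype.ofEquiv _ (equivTuple n).symm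
instance : DecidableEq (Pauli n) := (equivTuple n).injective.decidableEq

theorem card_eq : Fintype.card (Pauli n) = 4 * 4 ^ n := by
  rw [Fintype.card_congr (equivTuple n)]
  simp [← mul_pow]

theorem neg_ne (P : Pauli n) : -P ≠ P := by
  rw [neg_def, Ne, ext_iff']
  simp

/-- Whether two Pauli operators anticommute. -/
def symp (P Q : Pauli n) : Bool := bdot P.a Q.b ^^ bdot P.b Q.a

theorem mul_comm_or (P Q : Pauli n) : P * Q = if P.symp Q then -(Q * P) else Q * P := by
  have h : (if P.symp Q then -(Q * P) else Q * P) =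
      ⟨P.symp Q ^^ (Q * P).neg, (Q * P).im, (Q * P).a, (Q * P).b⟩ := by
    cases P.symp Q <;> simp [neg_def]
  rw [h, mul_def, mul_def, ext_iff']
  refine ⟨?_, Bool.xor_comm _ _, funext fun i => Bool.xor_comm _ _, funext fun i => Bool.xor_comm _ _⟩
  simp only [symp, bdot_comm P.a]
  cases P.neg <;> cases Q.neg <;> cases P.im <;> cases Q.im <;> cases bdot P.b Q.a <;>
    cases bdot Q.b P.a <;> rfl

theorem symp_eq_false_iff {P Q : Pauli n} : P.symp Q = false ↔ P * Q = Q * P := by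
  have h := mul_comm_or P Q
  cases hs : P.symp Q
  · simpa [hs] using h
  · rw [hs, if_pos rfl] at h
    simp [h, neg_ne]

theorem symp_eq_true_iff {P Q : Pauli n} : P.symp Q = true ↔ P * Q = -(Q * P) := by
  have h := mul_comm_or P Q
  cases hs : P.symp Q
  · rw [hs, if_neg (by simp)] at h
    simp [h, (neg_ne _).symm]
  · simpa [hs] using h

theorem symp_mul_left (P Q R : Pauli n) : (P * Q).symp R = (P.symp R ^^ Q.symp R) := by
  simp only [symp, mul_def, bdot_xor]
  cases bdot P.a R.b <;> cases bdot Q.a R.b <;> cases bdot P.b R.a <;> cases bdot Q.b R.a <;> rfl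

theorem symp_comm (P Q : Pauli n) : P.symp Q = Q.symp P := by
  simp only [symp, bdot_comm P.a, bdot_comm P.b, Bool.xor_comm]

theorem symp_mul_right (P Q R : Pauli n) : R.symp (P * Q) = (R.symp P ^^ R.symp Q) := by
  simp only [symp_comm R, symp_mul_left]

theorem mul_self_or (P : Pauli n) : P * P = 1 ∨ P * P = -1 := by
  rw [mul_def, one_def, neg_def, ext_iff', ext_iff']
  cases P.neg <;> cases P.im <;> cases bdot P.b P.a <;> simp

/-- An involution other than `1` and `-1` acts nontrivially on some qubit. -/
theorem exists_a_or_b (P : Pauli n) (h : P * P = 1) (h1 : P ≠ 1) (h2 : P ≠ -1) :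
    ∃ i, P.a i = true ∨ P.b i = true := by
  by_contra! hc
  simp only [Bool.not_eq_true] at hc
  have ha : P.a = fun _ => false := funext fun i => (hc i).1
  have hb : P.b = fun _ => false := funext fun i => (hc i).2
  rw [mul_def, one_def, ext_iff', ha, bdot_zero] at h
  rw [one_def, Ne, ext_iff'] at h1
  rw [one_def, neg_def, Ne, ext_iff'] at h2
  rcases P with ⟨s, t, a, b⟩
  cases s <;> cases t <;> simp_all

/-- The trace is multiplicative over tensor factors, and a factor `X`, `Z` or `XZ` is traceless. -/
theorem trace_op_eq_zero {P : Pauli n} (h : P * P = 1) (h1 : P ≠ 1) (h2 : P ≠ -1) :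
    P.op.trace = 0 := by
  obtain ⟨i, hi⟩ := exists_a_or_b P h h1 h2
  rw [op_eq, Matrix.trace_smul, trace_tensor, Finset.prod_eq_zero (Finset.mem_univ i), smul_zero]
  rw [trace_site]
  rcases hi with hi | hi <;> simp [hi]

/-- At a qubit where `P` contains `X`, a single `Z` anticommutes with it; where it contains `Z`, a
single `X` does. -/
theorem exists_symp {P : Pauli n} (h : P * P = 1) (h1 : P ≠ 1) (h2 : P ≠ -1) :
    ∃ Q : Pauli n, P.symp Q = true := by
  obtain ⟨i, hi⟩ := exists_a_or_b P h h1 h2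
  rcases hi with hi | hi
  · exact ⟨⟨false, false, fun _ => false, fun j => decide (j = i)⟩, by
      simp [symp, bdot_single, bdot_zero, hi]⟩
  · exact ⟨⟨false, false, fun j => decide (j = i), fun _ => false⟩, by
      simp [symp, bdot_single, bdot_zero, hi]⟩

theorem op_conjTranspose (P : Pauli n) : P.op.conjTranspose = (P⁻¹).op := by
  simp only [op_eq, Matrix.conjTranspose_smul, tensor_conjTranspose, site_conjTranspose, tensor_smul,
    smul_smul]
  rw [← bsign_bdot, inv_def]
  congr 1
  simp only [phase_eq]
  cases P.neg <;> cases P.im <;> cases bdot P.b P.a <;> simp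

/-- Pauli operators are unitary, so being self-adjoint means being one's own inverse. -/
theorem isHermitian_iff (P : Pauli n) : P.op.IsHermitian ↔ P * P = 1 := by
  rw [Matrix.IsHermitian, op_conjTranspose, op_injective.eq_iff, inv_eq_iff_mul_eq_one]

end Pauli

/-! ### Stabilizer groups -/

namespace Pauli

variable {n : ℕ}

/-- Abelian groups of Pauli operators that do not contain `-1`. -/
structure IsStab (G : Subgroup (Pauli n)) : Prop where
  comm : ∀ s ∈ G, ∀ t ∈ G, s * t = t * s
  neg_one : (-1 : Pauli n) ∉ G

namespace IsStab

variable {G : Subgroup (Pauli n)}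

theorem mul_self (h : IsStab G) {s : Pauli n} (hs : s ∈ G) : s * s = 1 := by
  rcases mul_self_or s with h1 | h1
  · exact h1
  · exact absurd (h1 ▸ G.mul_mem hs hs) h.neg_one

theorem ne_neg_one (h : IsStab G) {s : Pauli n} (hs : s ∈ G) : s ≠ -1 :=
  fun e => h.neg_one (e ▸ hs)

theorem neg_notMem (h : IsStab G) {s : Pauli n} (hs : s ∈ G) : -s ∉ G := fun hn =>
  h.neg_one (by simpa [h.mul_self hs] using G.mul_mem hn hs)

theorem mono (h : IsStab G) {H : Subgroup (Pauli n)} (hH : H ≤ G) : IsStab H :=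
  ⟨fun s hs t ht => h.comm s (hH hs) t (hH ht), fun h1 => h.neg_one (hH h1)⟩

end IsStab

/-- The group that is generated by `G` and a commuting involution `R`. -/
def adjoinSubgroup (G : Subgroup (Pauli n)) (R : Pauli n) (hR : R * R = 1)
    (hc : ∀ s ∈ G, s * R = R * s) : Subgroup (Pauli n) :=
  have hcomm : ∀ x, R * x ∈ G → x * R = R * x := fun x hx => by
    have h := hc _ hx
    rw [mul_assoc] at h
    exact mul_left_cancel h
  { carrier := {x | x ∈ G ∨ R * x ∈ G}
    one_mem' := Or.inl G.one_mem
    mul_mem' := by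
      intro x y hx hy
      rcases hx with hx | hx <;> rcases hy with hy | hy
      · exact Or.inl (G.mul_mem hx hy)
      · right
        have h := G.mul_mem hx hy
        rwa [← mul_assoc, hc x hx, mul_assoc] at h
      · right
        have h := G.mul_mem hx hy
        rwa [mul_assoc] at h
      · left
        have h := G.mul_mem hx hy
        rwa [← hcomm x hx, mul_assoc, ← mul_assoc R, hR, one_mul] at h
    inv_mem' := by
      intro x hx
      rcases hx with hx | hx
      · exact Or.inl (G.inv_mem hx)
      · right
        have h := G.inv_mem hx
        rwa [← hcomm x hx, mul_inv_rev, inv_eq_of_mul_eq_one_right hR] at h }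

section Adjoin

variable {G : Subgroup (Pauli n)} {R : Pauli n} {hR : R * R = 1} {hc : ∀ s ∈ G, s * R = R * s}

theorem mem_adjoinSubgroup {x : Pauli n} : x ∈ adjoinSubgroup G R hR hc ↔ x ∈ G ∨ R * x ∈ G :=
  Iff.rfl

theorem le_adjoinSubgroup : G ≤ adjoinSubgroup G R hR hc := fun _ h => Or.inl h

theorem self_mem_adjoinSubgroup : R ∈ adjoinSubgroup G R hR hc :=
  Or.inr (by rw [hR]; exact G.one_mem)

theorem IsStab.adjoin (h : IsStab G) (hn : -R ∉ G) : IsStab (adjoinSubgroup G R hR hc) := by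
  refine ⟨fun s hs t ht => ?_, ?_⟩
  · have hw : ∀ x, x ∈ G ∨ R * x ∈ G → ∃ g ∈ G, x = g ∨ x = R * g := by
      rintro x (hx | hx)
      · exact ⟨x, hx, Or.inl rfl⟩
      · exact ⟨_, hx, Or.inr (by rw [← mul_assoc, hR, one_mul])⟩
    obtain ⟨g, hg, hs⟩ := hw s hs
    obtain ⟨k, hk, ht⟩ := hw t ht
    have c1 : Commute g R := hc g hg
    have c2 : Commute k R := hc k hk
    have c3 : Commute g k := h.comm g hg k hk
    have c4 : Commute s t := by
      rcases hs with rfl | rfl <;> rcases ht with rfl | rfl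
      · exact c3
      · exact c1.mul_right c3
      · exact (c2.mul_right c3.symm).symm
      · exact ((Commute.refl R).mul_right c2.symm).mul_left (c1.mul_right c3)
    exact c4
  · rintro (h1 | h1)
    · exact h.neg_one h1
    · exact hn (by simpa using h1)

end Adjoin

/-! #### Counting the operators that commute with a stabilizer group -/

open Classical in
/-- The number of Pauli operators that commute with a stabilizer group. -/
theorem IsStab.card_mul_card_comm {G : Subgroup (Pauli n)} (h : IsStab G) :
    Fintype.card G * Fintype.card {Q : Pauli n // ∀ g ∈ G, g.symp Q = false} = 4 * 4 ^ n := by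
  -- The commutation sign is a character in each argument. Its sum over all `Q` vanishes unless `g =
  -- 1`, and its sum over `G` vanishes unless `Q` commutes with `G`; the double sum in both orders
  -- gives the count.
  let χ : Pauli n → Pauli n → ℤ := fun g Q => if g.symp Q then -1 else 1
  have hχ : ∀ b c : Bool, (if (b ^^ c) then -1 else 1 : ℤ) =
      (if b then -1 else 1) * (if c then -1 else 1) := by
    intro b c; cases b <;> cases c <;> rfl
  have h1 : ∀ g : G, ∑ Q, χ g Q = if g = 1 then 4 * 4 ^ n else 0 := by
    intro g
    split_ifs with hg
    · subst hg
      have : ∀ Q : Pauli n, χ ((1 : G) : Pauli n) Q = 1 := fun Q => by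
        simp only [χ]
        rw [if_neg]
        rw [Bool.not_eq_true, symp_eq_false_iff]
        simp
      rw [Finset.sum_congr rfl fun Q _ => this Q]
      simp [card_eq]
    · obtain ⟨Q₀, hQ⟩ := exists_symp (h.mul_self g.2) (by simpa using hg) (h.ne_neg_one g.2)
      have h2 : ∑ Q, χ g Q = ∑ Q, χ g (Q₀ * Q) :=
        (Fintype.sum_equiv (Equiv.mulLeft Q₀) _ _ fun Q => rfl).symm
      have h3 : ∀ Q, χ g (Q₀ * Q) = - χ g Q := fun Q => by
        simp only [χ, symp_mul_right, hQ, hχ, if_true]; ring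
      simp only [h3, Finset.sum_neg_distrib] at h2
      linarith
  have h2 : ∀ Q : Pauli n, ∑ g : G, χ g Q =
      if (∀ g ∈ G, g.symp Q = false) then (Fintype.card G : ℤ) else 0 := by
    intro Q
    split_ifs with hQ
    · rw [Finset.sum_congr rfl fun (g : G) _ => show χ g Q = 1 by simp [χ, hQ g g.2]]
      simp
    · push Not at hQ
      obtain ⟨g₀, hg₀, hs⟩ := hQ
      rw [ne_eq, Bool.not_eq_false] at hs
      have h2 : ∑ g : G, χ g Q = ∑ g : G, χ ((⟨g₀, hg₀⟩ * g : G) : Pauli n) Q :=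
        (Fintype.sum_equiv (Equiv.mulLeft (⟨g₀, hg₀⟩ : G)) _ _ fun Q => rfl).symm
      have h3 : ∀ g : G, χ ((⟨g₀, hg₀⟩ * g : G) : Pauli n) Q = - χ g Q := fun g => by
        simp only [χ, Subgroup.coe_mul, symp_mul_left, hs, hχ, if_true]; ring
      simp only [h3, Finset.sum_neg_distrib] at h2
      linarith
  have h3 : ∑ g : G, ∑ Q, χ g Q = ∑ Q, ∑ g : G, χ g Q := Finset.sum_comm
  simp only [h1, h2] at h3
  rw [Finset.sum_ite_eq' Finset.univ (1 : G), if_pos (Finset.mem_univ _), ← Finset.sum_filter,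
    Finset.sum_const, nsmul_eq_mul, ← Fintype.card_subtype] at h3
  have h4 := h3.symm
  rw [mul_comm] at h4
  exact_mod_cast h4

/-- The operator `i`. -/
def imag : Pauli n := ⟨false, true, fun _ => false, fun _ => false⟩

theorem imag_mul (P : Pauli n) : imag * P = ⟨P.neg ^^ P.im, !P.im, P.a, P.b⟩ := by
  rw [mul_def, imag, bdot_comm, bdot_zero]; simp

theorem imag_mul_imag_mul (P : Pauli n) : imag * P * (imag * P) = -(P * P) := by
  rw [imag_mul, mul_def, mul_def, neg_def, ext_iff']
  cases P.neg <;> cases P.im <;> simp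

theorem imag_symp (P Q : Pauli n) : Q.symp (imag * P) = Q.symp P := by
  rw [imag_mul, symp, symp]

/-- The multiples of the elements of `G` by the four phases. -/
def phaseMul (G : Subgroup (Pauli n)) (x : (Bool × Bool) × G) : Pauli n :=
  bif x.1.1 then imag * (bif x.1.2 then -x.2.1 else x.2.1) else bif x.1.2 then -x.2.1 else x.2.1

/-- Squares separate real phases (square `1`) from imaginary ones (square `-1`), and opposite signs
cannot be confused because `G` never contains both an element and its negative. -/
theorem IsStab.phaseMul_injective {G : Subgroup (Pauli n)} (h : IsStab G) :
    Function.Injective (phaseMul G) := by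
  have hsq : ∀ (t : Bool) (x : G), (bif t then -x.1 else x.1) * (bif t then -x.1 else x.1) = 1 := by
    intro t x
    cases t <;> simp [h.mul_self x.2]
  have key : ∀ (t u : Bool) (x y : G), (bif t then -x.1 else x.1) = (bif u then -y.1 else y.1) →
      t = u ∧ x = y := by
    intro t u x y e
    cases t <;> cases u <;> simp only [cond_true, cond_false, neg_inj] at e
    · exact ⟨rfl, Subtype.ext e⟩
    · exact absurd (e ▸ x.2) (h.neg_notMem y.2)
    · exact absurd (e ▸ y.2) (h.neg_notMem x.2)
    · exact ⟨rfl, Subtype.ext e⟩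
  rintro ⟨⟨s, t⟩, x⟩ ⟨⟨s', t'⟩, x'⟩ e
  have h1 := hsq t x
  have h2 := hsq t' x'
  have h3 := congrArg (fun P : Pauli n => P * P) e
  have hne := neg_ne (1 : Pauli n)
  have hst : s = s' := by
    cases s <;> cases s' <;> simp only [phaseMul, cond_true, cond_false, imag_mul_imag_mul, h1, h2]
      at h3
    · rfl
    · exact absurd h3.symm hne
    · exact absurd h3 hne
    · rfl
  subst hst
  have h4 : t = t' ∧ x = x' := by
    apply key
    cases s
    · exact e
    · exact mul_left_cancel e
  rw [h4.1, h4.2]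

theorem IsStab.phaseMul_comm {G : Subgroup (Pauli n)} (h : IsStab G) (x : (Bool × Bool) × G) :
    ∀ g ∈ G, g.symp (phaseMul G x) = false := by
  intro g hg
  have h1 : g.symp x.2.1 = false := symp_eq_false_iff.2 (h.comm _ hg _ x.2.2)
  have h2 : g.symp (-x.2.1) = false := by
    rw [symp_eq_false_iff] at *
    rw [mul_neg, h1, neg_mul]
  rcases x with ⟨⟨s, t⟩, x⟩
  cases s <;> cases t <;> simp only [phaseMul, cond_true, cond_false, imag_symp, h1, h2]

open Classical in
/-- The multiples of the elements of `G` by the four phases, among the operators that commute with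
`G`. -/
noncomputable def IsStab.phaseEmb {G : Subgroup (Pauli n)} (h : IsStab G) :
    (Bool × Bool) × G ↪ {Q : Pauli n // ∀ g ∈ G, g.symp Q = false} :=
  ⟨fun x => ⟨phaseMul G x, h.phaseMul_comm x⟩, fun _ _ e => h.phaseMul_injective (congrArg Subtype.val e)⟩

open Classical in
/-- A commuting involution lies in a stabilizer group of maximal order, up to sign. -/
theorem IsStab.mem_or_neg_mem {G : Subgroup (Pauli n)} (h : IsStab G) (hG : Nat.card G = 2 ^ n)
    {Q : Pauli n} (hQ : Q * Q = 1) (hc : ∀ g ∈ G, g * Q = Q * g) : Q ∈ G ∨ -Q ∈ G := by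
  have h2 := h.card_mul_card_comm
  rw [Nat.card_eq_fintype_card] at hG
  have h4 : (4 : ℕ) * 4 ^ n = 2 ^ n * (4 * 2 ^ n) := by
    rw [show (4 : ℕ) = 2 * 2 from rfl, mul_pow]; ring
  rw [h4, hG] at h2
  -- Exactly `4 * 2 ^ n` operators commute with `G`, as many as there are phase multiples of its
  -- elements, so the embedding `phaseEmb` is onto. The imaginary multiples are excluded since `Q`
  -- squares to `1`.
  have h5 := Nat.eq_of_mul_eq_mul_left (by positivity) h2
  have hb : Function.Bijective h.phaseEmb := by
    rw [Fintype.bijective_iff_injective_and_card]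
    refine ⟨h.phaseEmb.injective, ?_⟩
    simp [h5, hG]
  obtain ⟨⟨⟨s, t⟩, x⟩, e⟩ := hb.2 ⟨Q, fun g hg => symp_eq_false_iff.2 (hc g hg)⟩
  have e' : phaseMul G ((s, t), x) = Q := congrArg Subtype.val e
  have h6 := h.mul_self x.2
  cases s
  · cases t
    · exact Or.inl (e' ▸ x.2)
    · right
      rw [← e']
      simp [phaseMul]
  · exfalso
    rw [← e', phaseMul, cond_true, imag_mul_imag_mul] at hQ
    cases t <;> simp [h6, neg_ne] at hQ

open Classical in
/-- Stabilizer groups of less than maximal order can be extended. -/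
theorem IsStab.exists_extension {G : Subgroup (Pauli n)} (h : IsStab G)
    (hG : Nat.card G ≠ 2 ^ n) :
    ∃ R : Pauli n, R * R = 1 ∧ (∀ g ∈ G, g * R = R * g) ∧ R ∉ G ∧ -R ∉ G := by
  -- If only phase multiples of `G` commuted with `G`, the count would read `4 * |G| ^ 2 = 4 * 4 ^
  -- n`, which forces the order `2 ^ n`.
  have hn : ¬ Function.Surjective h.phaseEmb := by
    intro hs
    have h1 := Fintype.card_of_bijective ⟨h.phaseEmb.injective, hs⟩
    have h2 := h.card_mul_card_comm
    rw [← h1] at h2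
    simp only [Fintype.card_prod, Fintype.card_bool] at h2
    rw [Nat.card_eq_fintype_card] at hG
    apply hG
    have h3 : Fintype.card G ^ 2 = (2 ^ n) ^ 2 := by
      rw [← pow_mul, mul_comm n, pow_mul]; norm_num; nlinarith
    exact Nat.pow_left_injective two_ne_zero h3
  simp only [Function.Surjective, not_forall, not_exists] at hn
  obtain ⟨⟨Q, hQ⟩, hn⟩ := hn
  have hn' : ∀ x, phaseMul G x ≠ Q := fun x e => hn x (Subtype.ext e)
  have hii : imag * (imag * Q) = -Q := by
    simp [imag_mul, neg_def]
  -- If `Q` squares to `-1`, then `imag * Q` is an involution with the same commutation relations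
  -- and is still no phase multiple of an element of `G`.
  rcases mul_self_or Q with h1 | h1
  · exact ⟨Q, h1, fun g hg => symp_eq_false_iff.1 (hQ g hg),
      fun hm => hn' ((false, false), ⟨Q, hm⟩) rfl,
      fun hm => hn' ((false, true), ⟨-Q, hm⟩) (by simp [phaseMul])⟩
  · refine ⟨imag * Q, by rw [imag_mul_imag_mul, h1, neg_neg],
      fun g hg => symp_eq_false_iff.1 (by rw [imag_symp]; exact hQ g hg), fun hm => ?_, fun hm => ?_⟩
    · exact hn' ((true, true), ⟨_, hm⟩) (by simp [phaseMul, hii])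
    · exact hn' ((true, false), ⟨_, hm⟩) (by simp [phaseMul, hii])

/-- Every stabilizer group is contained in one of maximal order. -/
theorem IsStab.exists_max {G : Subgroup (Pauli n)} (h : IsStab G) :
    ∃ H, G ≤ H ∧ IsStab H ∧ Nat.card H = 2 ^ n := by
  obtain ⟨H, hGH, hH⟩ := Finite.exists_le_maximal (p := fun H : Subgroup (Pauli n) => IsStab H) h
  refine ⟨H, hGH, hH.prop, ?_⟩
  by_contra hc
  obtain ⟨R, hR, hcomm, h1, h2⟩ := hH.prop.exists_extension hc
  have h3 := hH.le_of_ge (hH.prop.adjoin (hR := hR) (hc := hcomm) h2) le_adjoinSubgroup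
  exact h1 (h3 self_mem_adjoinSubgroup)

/-! #### Stabilizer states -/

/-- A stabilizer group has a joint fixed vector. -/
theorem IsStab.exists_fixed {G : Subgroup (Pauli n)} (h : IsStab G) :
    ∃ ψ : (Fin n → Fin 2) → ℂ, star ψ ⬝ᵥ ψ = 1 ∧ ∀ s ∈ G, s.op.mulVec ψ = ψ := by
  classical
  -- The sum over the group absorbs left multiplication by its elements, so its columns are fixed
  -- vectors. Only the identity contributes to the trace; hence the sum is nonzero and some column
  -- can be normalized.
  have htr : (∑ g : G, g.1.op).trace = 2 ^ n := by
    rw [Matrix.trace_sum, Finset.sum_eq_single 1]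
    · simp [op_one, Matrix.trace_one]
    · intro g _ hg
      exact trace_op_eq_zero (h.mul_self g.2) (by simpa using hg) (h.ne_neg_one g.2)
    · simp
  have hne : (∑ g : G, g.1.op) ≠ 0 := by
    intro h0
    rw [h0, Matrix.trace_zero] at htr
    exact pow_ne_zero n two_ne_zero htr.symm
  have hfix : ∀ s ∈ G, s.op * (∑ g : G, g.1.op) = ∑ g : G, g.1.op := by
    intro s hs
    rw [Finset.mul_sum]
    exact Fintype.sum_equiv (Equiv.mulLeft (⟨s, hs⟩ : G)) _ _ fun g => by simp [op_mul]
  obtain ⟨y, hy⟩ : ∃ y, (∑ g : G, g.1.op).col y ≠ 0 := by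
    by_contra! hc
    exact hne (by ext x y; exact congrFun (hc y) x)
  set φ := (∑ g : G, g.1.op).col y with hφ
  have hφfix : ∀ s ∈ G, s.op.mulVec φ = φ := by
    intro s hs
    ext x
    exact congrFun (congrFun (hfix s hs) x) y
  have hsq : star φ ⬝ᵥ φ = ((∑ i, Complex.normSq (φ i) : ℝ) : ℂ) := by
    simp [dotProduct, Complex.normSq_eq_conj_mul_self]
  have hpos : 0 < ∑ i, Complex.normSq (φ i) := by
    obtain ⟨i, hi⟩ := Function.ne_iff.1 hy
    exact Finset.sum_pos' (fun i _ => Complex.normSq_nonneg _)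
      ⟨i, Finset.mem_univ _, Complex.normSq_pos.2 hi⟩
  set r := ∑ i, Complex.normSq (φ i)
  refine ⟨((Real.sqrt r)⁻¹ : ℂ) • φ, ?_, fun s hs => ?_⟩
  · rw [star_smul, smul_dotProduct, dotProduct_smul, hsq]
    have h1 : ((Real.sqrt r : ℝ) : ℂ) * (Real.sqrt r : ℝ) = (r : ℝ) := by
      rw [← Complex.ofReal_mul, Real.mul_self_sqrt hpos.le]
    have h2 : ((Real.sqrt r : ℝ) : ℂ) ≠ 0 := by
      simpa using (Real.sqrt_pos.2 hpos).ne'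
    simp only [smul_eq_mul, star_inv₀, Complex.star_def, Complex.conj_ofReal]
    rw [← h1]
    field_simp
  · rw [Matrix.mulVec_smul, hφfix s hs]

theorem trace_mul_vecMulVec (P : Operator n) (ψ : (Fin n → Fin 2) → ℂ) :
    (P * Matrix.vecMulVec ψ (star ψ)).trace = star ψ ⬝ᵥ P.mulVec ψ := by
  rw [Matrix.mul_vecMulVec, Matrix.trace_vecMulVec, dotProduct_comm]

open Classical in
/-- The expectation value of `P` in the state that is stabilized by `G`. -/
noncomputable def expec (G : Subgroup (Pauli n)) (P : Pauli n) : SignType :=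
  if P ∈ G then 1 else if -P ∈ G then -1 else 0

/-- If neither sign of `P` lies in `G`, maximality of the order yields a `g` in `G` that
anticommutes with `P`. As `g` fixes the state, moving it through the expectation value shows that
this value equals its own negative. -/
theorem IsStab.trace_state {G : Subgroup (Pauli n)} (h : IsStab G) (hG : Nat.card G = 2 ^ n)
    {ψ : (Fin n → Fin 2) → ℂ} (h1 : star ψ ⬝ᵥ ψ = 1) (hψ : ∀ s ∈ G, s.op.mulVec ψ = ψ)
    {P : Pauli n} (hP : P * P = 1) :
    (P.op * Matrix.vecMulVec ψ (star ψ)).trace = ((expec G P : ℝ) : ℂ) := by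
  rw [trace_mul_vecMulVec, expec]
  split_ifs with ha hb
  · rw [hψ P ha, h1]; simp
  · have h2 := hψ _ hb
    rw [op_neg, Matrix.neg_mulVec, neg_eq_iff_eq_neg] at h2
    rw [h2, dotProduct_neg, h1]; simp
  · have hc : ∃ g ∈ G, g.symp P = true := by
      by_contra! hc
      simp only [Bool.not_eq_true] at hc
      rcases h.mem_or_neg_mem hG hP fun g hg => symp_eq_false_iff.1 (hc g hg) with h2 | h2
      · exact ha h2
      · exact hb h2
    obtain ⟨g, hg, hs⟩ := hc
    have h2 := congrArg op (symp_eq_true_iff.1 hs)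
    rw [op_mul, op_neg, op_mul] at h2
    have h3 : star ψ ⬝ᵥ P.op.mulVec ψ = -(star ψ ⬝ᵥ P.op.mulVec ψ) := by
      have h4 : star ψ = Matrix.vecMul (star ψ) g.op := by
        conv_lhs => rw [← hψ g hg]
        rw [Matrix.star_mulVec, op_conjTranspose, inv_eq_of_mul_eq_one_right (h.mul_self hg)]
      conv_lhs => rw [h4, ← Matrix.dotProduct_mulVec, Matrix.mulVec_mulVec, h2, Matrix.neg_mulVec,
        ← Matrix.mulVec_mulVec, hψ g hg, dotProduct_neg]
    have h5 := self_eq_neg.1 h3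
    rw [h5]; simp

end Pauli

/-! ### Maximal stabilizer groups -/

/-- A finite group has a generating set of at most logarithmic size. -/
theorem two_pow_rank_le_card {G : Type*} [Group G] [Finite G] [Group.FG G] :
    2 ^ Group.rank G ≤ Nat.card G := by
  classical
  have := Fintype.ofFinite G
  suffices h : ∃ S : Finset G, Subgroup.closure (S : Set G) = ⊤ ∧ 2 ^ S.card ≤ Nat.card G by
    obtain ⟨S, hS, hc⟩ := h
    exact (Nat.pow_le_pow_right two_pos (Group.rank_le hS)).trans hc
  -- An element outside the closure of `S` at least doubles the closure, by Lagrange. So a set that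
  -- is maximal with this property generates the group.
  obtain ⟨S, -, hS⟩ := Finite.exists_le_maximal (a := ∅)
    (p := fun S : Finset G => 2 ^ S.card ≤ Nat.card (Subgroup.closure (S : Set G))) (by simp)
  refine ⟨S, ?_, hS.prop.trans (Subgroup.card_le_card_group _)⟩
  by_contra hne
  obtain ⟨g, hg⟩ : ∃ g, g ∉ Subgroup.closure (S : Set G) := by
    by_contra! hc
    exact hne ((Subgroup.eq_top_iff' _).2 hc)
  have hgS : g ∉ S := fun h => hg (Subgroup.subset_closure h)
  have hle : Subgroup.closure (S : Set G) < Subgroup.closure ((insert g S : Finset G) : Set G) := by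
    refine lt_of_le_of_ne (Subgroup.closure_mono (by simp)) fun e => hg ?_
    rw [e]
    exact Subgroup.subset_closure (by simp)
  have hcard : 2 * Nat.card (Subgroup.closure (S : Set G)) ≤
      Nat.card (Subgroup.closure ((insert g S : Finset G) : Set G)) := by
    obtain ⟨k, hk⟩ := Subgroup.card_dvd_of_le hle.le
    have h2 : k ≠ 1 := by
      rintro rfl
      rw [mul_one] at hk
      exact hle.ne (Subgroup.eq_of_le_of_card_ge hle.le hk.le)
    have h3 : k ≠ 0 := by
      rintro rfl
      have := Nat.card_pos (α := Subgroup.closure ((insert g S : Finset G) : Set G))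
      omega
    rw [hk, mul_comm]
    exact Nat.mul_le_mul_left _ (by omega)
  have := hS.le_of_ge (y := insert g S) (by
    rw [Finset.card_insert_of_notMem hgS, pow_succ, mul_comm]
    exact (Nat.mul_le_mul_left 2 hS.prop).trans hcard) (Finset.subset_insert _ _)
  exact hgS (this (Finset.mem_insert_self _ _))

/-- An Abelian group of exponent 2 has order dividing `2 ^ rank`; the reverse inequality holds for
every finite group. -/
theorem card_eq_two_pow_rank {G : Type*} [Group G] [Finite G] [Group.FG G]
    (hc : ∀ x y : G, x * y = y * x) (h2 : ∀ x : G, x * x = 1) :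
    Nat.card G = 2 ^ Group.rank G := by
  refine le_antisymm (Nat.le_of_dvd (by positivity) ?_) two_pow_rank_le_card
  let : CommGroup G := { ‹Group G› with mul_comm := hc }
  exact card_dvd_exponent_pow_rank' G fun g => by rw [pow_two]; exact h2 g

namespace Pauli

variable {n : ℕ}

/-- The operator of a symplectic representation, as a unit. -/
def toUnit : Pauli n →* (Operator n)ˣ where
  toFun P := ⟨P.op, (P⁻¹).op, by rw [← op_mul, mul_inv_cancel, op_one],
    by rw [← op_mul, inv_mul_cancel, op_one]⟩
  map_one' := Units.ext op_one
  map_mul' _ _ := Units.ext (op_mul _ _)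

theorem coe_toUnit (P : Pauli n) : (toUnit P : Operator n) = P.op := rfl

theorem toUnit_injective : Function.Injective (toUnit : Pauli n → (Operator n)ˣ) := fun _ _ h =>
  op_injective (congrArg Units.val h)

theorem toUnit_neg_one : toUnit (-1 : Pauli n) = -1 :=
  Units.ext (by rw [coe_toUnit, op_neg, op_one]; simp)

theorem pauliGroup_eq : pauliGroup n = (toUnit : Pauli n →* (Operator n)ˣ).range := by
  have h : {u : (Operator n)ˣ | ∃ P : Pauli n, (u : Operator n) = P.op} =
      ((toUnit : Pauli n →* (Operator n)ˣ).range : Set (Operator n)ˣ) := by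
    ext u
    constructor
    · rintro ⟨P, h⟩
      exact ⟨P, Units.ext h.symm⟩
    · rintro ⟨P, rfl⟩
      exact ⟨P, rfl⟩
  rw [pauliGroup, h, Subgroup.closure_eq]

/-- Stabilizer groups are elementary Abelian 2-groups, so the rank condition becomes a condition on
the order, which suits counting arguments. -/
theorem IsStab.rank_iff {G : Subgroup (Pauli n)} (h : IsStab G) :
    (∃ _ : Group.FG (G.map toUnit), Group.rank (G.map toUnit) = n) ↔ Nat.card G = 2 ^ n := by
  let e : G ≃* G.map toUnit := G.equivMapOfInjective toUnit toUnit_injective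
  have : Finite (G.map toUnit) := Finite.of_equiv _ e.toEquiv
  have hcard : ∀ _ : Group.FG (G.map toUnit), Nat.card G = 2 ^ Group.rank (G.map toUnit) := by
    intro _
    rw [Nat.card_congr e.toEquiv]
    refine card_eq_two_pow_rank (fun x y => ?_) fun x => ?_
    · obtain ⟨x, rfl⟩ := e.surjective x
      obtain ⟨y, rfl⟩ := e.surjective y
      rw [← map_mul, ← map_mul]
      exact congrArg e (Subtype.ext (h.comm _ x.2 _ y.2))
    · obtain ⟨x, rfl⟩ := e.surjective x
      rw [← map_mul, ← map_one e]
      exact congrArg e (Subtype.ext (h.mul_self x.2))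
  constructor
  · rintro ⟨hfg, hr⟩
    rw [hcard hfg, hr]
  · intro hc
    have hfg : Group.FG (G.map toUnit) := inferInstance
    refine ⟨hfg, Nat.pow_right_injective le_rfl ?_⟩
    simp only
    rw [← hcard hfg, hc]

theorem IsStab.map_iff {G : Subgroup (Pauli n)} :
    IsMaxStabilizerGroup (G.map toUnit) ↔ IsStab G ∧ Nat.card G = 2 ^ n := by
  constructor
  · intro h
    have hs : IsStab G := by
      refine ⟨fun s hs t ht => toUnit_injective ?_, fun h1 => h.neg_one_notMem ?_⟩
      · rw [map_mul, map_mul]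
        exact h.comm _ (Subgroup.mem_map_of_mem _ hs) _ (Subgroup.mem_map_of_mem _ ht)
      · rw [← toUnit_neg_one]
        exact Subgroup.mem_map_of_mem _ h1
    exact ⟨hs, hs.rank_iff.1 h.rank_eq⟩
  · rintro ⟨hs, hc⟩
    refine ⟨?_, ?_, ?_, hs.rank_iff.2 hc⟩
    · rw [pauliGroup_eq]
      exact Subgroup.map_le_range _ _
    · rintro _ ⟨s, hs', rfl⟩ _ ⟨t, ht, rfl⟩
      rw [← map_mul, ← map_mul, hs.comm s hs' t ht]
    · rw [← toUnit_neg_one]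
      rintro ⟨s, hs', e⟩
      exact hs.neg_one (toUnit_injective e ▸ hs')

/-- Every subgroup of the matrix Pauli group is the image under `toUnit` of a group of bit strings.
From here on, stabilizer groups can be handled in the finite group `Pauli n`. -/
theorem pureStabStates_eq (n : ℕ) : pureStabStates n =
    {ρ | ∃ G : Subgroup (Pauli n), IsStab G ∧ Nat.card G = 2 ^ n ∧
      ∃ ψ : (Fin n → Fin 2) → ℂ, star ψ ⬝ᵥ ψ = 1 ∧ (∀ s ∈ G, s.op.mulVec ψ = ψ) ∧
        ρ = Matrix.vecMulVec ψ (star ψ)} := by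
  ext ρ
  constructor
  · rintro ⟨G, hG, ψ, h1, h2, h3⟩
    have e : (G.comap toUnit).map toUnit = G :=
      Subgroup.map_comap_eq_self (by rw [← pauliGroup_eq]; exact hG.le_pauliGroup)
    rw [← e] at hG
    obtain ⟨hs, hc⟩ := IsStab.map_iff.1 hG
    exact ⟨_, hs, hc, ψ, h1, fun s hs => h2 _ hs, h3⟩
  · rintro ⟨G, hs, hc, ψ, h1, h2, h3⟩
    refine ⟨G.map toUnit, IsStab.map_iff.2 ⟨hs, hc⟩, ψ, h1, ?_, h3⟩
    rintro _ ⟨s, hs', rfl⟩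
    exact h2 s hs'

end Pauli

/-! ### The vertex representation of the reduced stabilizer polytope -/

namespace Pauli

variable {n m : ℕ}

/-- The operator `P` with a sign. -/
def signed (u : ℤˣ) (P : Pauli n) : Pauli n := if u = 1 then P else -P

theorem op_signed (u : ℤˣ) (P : Pauli n) : (signed u P).op = ((u : ℤ) : ℂ) • P.op := by
  rcases Int.units_eq_one_or u with rfl | rfl <;> simp [signed, op_neg]

theorem signed_mul_self (u : ℤˣ) {P : Pauli n} (h : P * P = 1) : signed u P * signed u P = 1 := by
  rcases Int.units_eq_one_or u with rfl | rfl <;> simp [signed, h]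

theorem signed_commute (u v : ℤˣ) {P Q : Pauli n} (h : Commute P Q) :
    Commute (signed u P) (signed v Q) := by
  rcases Int.units_eq_one_or u with rfl | rfl <;> rcases Int.units_eq_one_or v with rfl | rfl <;>
    simpa [signed]

theorem symp_self (P : Pauli n) : P.symp P = false := symp_eq_false_iff.2 rfl

theorem adj_iff (M : Fin m → Pauli n) (i j : Fin m) :
    (frustrationGraph M).Adj i j ↔ (M i).symp (M j) = true := by
  have h : (M i).op * (M j).op = -((M j).op * (M i).op) ↔ (M i).symp (M j) = true := by
    rw [← op_mul, ← op_mul, ← op_neg, op_injective.eq_iff, symp_eq_true_iff]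
  change i ≠ j ∧ _ ↔ _
  rw [h, and_iff_right_iff_imp]
  rintro h rfl
  rw [symp_self] at h
  exact Bool.false_ne_true h

theorem isIndepSet_iff (M : Fin m → Pauli n) (S : Finset (Fin m)) :
    (frustrationGraph M).IsIndepSet (S : Set (Fin m)) ↔
      ∀ i ∈ S, ∀ j ∈ S, (M i).symp (M j) = false := by
  constructor
  · intro h i hi j hj
    by_cases hij : i = j
    · rw [hij, symp_self]
    · have : ¬ (frustrationGraph M).Adj i j := h hi hj hij
      rwa [adj_iff, Bool.not_eq_true] at this
  · intro h i hi j hj _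
    rw [adj_iff, h i hi j hj]
    exact Bool.false_ne_true

/-- Maximal independent sets consist of the vertices that commute with all their members. -/
theorem mem_maxIndepSets_iff (M : Fin m → Pauli n) (S : Finset (Fin m)) :
    S ∈ maxIndepSets M ↔ ∀ i, i ∈ S ↔ ∀ j ∈ S, (M i).symp (M j) = false := by
  constructor
  · intro h i
    replace h : Maximal (fun T : Finset (Fin m) =>
      (frustrationGraph M).IsIndepSet (T : Set (Fin m))) S := h
    have h1 := (isIndepSet_iff M S).1 h.prop
    refine ⟨h1 i, fun hi => ?_⟩
    refine h.le_of_ge (y := insert i S) ((isIndepSet_iff M _).2 ?_) (Finset.subset_insert _ _)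
      (Finset.mem_insert_self _ _)
    intro j hj k hk
    rcases Finset.mem_insert.1 hj with rfl | hj <;> rcases Finset.mem_insert.1 hk with rfl | hk
    · exact symp_self _
    · exact hi k hk
    · rw [symp_comm]; exact hi j (by assumption)
    · exact h1 j hj k hk
  · intro h
    refine ⟨(isIndepSet_iff M S).2 fun i hi => (h i).1 hi, fun T hT hST i hi => ?_⟩
    exact (h i).2 fun j hj => (isIndepSet_iff M T).1 hT i hi j (hST hj)

/-! ### Ordered products over subsets of commuting involutions. -/

section Products

variable {ι : Type*} [LinearOrder ι]

/-- One more factor inserts its index into the subset, or removes the index if it is present,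
because the factors commute and square to `1`. -/
theorem exists_mul_sort_prod {G : Type*} [Group G] (g : ι → G) (hc : ∀ i j, Commute (g i) (g j))
    (h1 : ∀ i, g i * g i = 1) (i : ι) (T : Finset ι) :
    ∃ T' : Finset ι, g i * ((T.sort (· ≤ ·)).map g).prod = ((T'.sort (· ≤ ·)).map g).prod := by
  have hp : ∀ l : List ι, (l.map g).Pairwise Commute := fun l =>
    List.pairwise_map.2 (List.pairwise_of_forall fun i j => hc i j)
  have hins : ∀ T : Finset ι, i ∉ T →
      g i * ((T.sort (· ≤ ·)).map g).prod = (((insert i T).sort (· ≤ ·)).map g).prod := by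
    intro T hi
    rw [← List.prod_cons, ← List.map_cons]
    refine List.Perm.prod_eq' (List.Perm.map _ ?_) (hp _)
    rw [← Multiset.coe_eq_coe, ← Multiset.cons_coe, Finset.sort_eq, Finset.sort_eq,
      Finset.insert_val_of_notMem hi]
  by_cases hi : i ∈ T
  · refine ⟨T.erase i, ?_⟩
    have h2 := hins (T.erase i) (Finset.notMem_erase _ _)
    rw [Finset.insert_erase hi] at h2
    rw [← h2, ← mul_assoc, h1, one_mul]
  · exact ⟨_, hins T hi⟩

/-- Subset products are closed under multiplication by generators, hence exhaust the group.
Admissibility of signs thereby means that `-1` is not in the generated group. -/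
theorem mem_closure_iff_sort_prod {G : Type*} [Group G] (g : ι → G)
    (hc : ∀ i j, Commute (g i) (g j)) (h1 : ∀ i, g i * g i = 1) (x : G) :
    x ∈ Subgroup.closure (Set.range g) ↔
      ∃ T : Finset ι, ((T.sort (· ≤ ·)).map g).prod = x := by
  constructor
  · intro h
    induction h using Subgroup.closure_induction_left with
    | one => exact ⟨∅, by simp⟩
    | mul_left y hy z _ ih =>
      obtain ⟨i, rfl⟩ := hy
      obtain ⟨T, rfl⟩ := ih
      obtain ⟨T', h⟩ := exists_mul_sort_prod g hc h1 i T
      exact ⟨T', h.symm⟩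
    | inv_mul_cancel y hy z _ ih =>
      obtain ⟨i, rfl⟩ := hy
      obtain ⟨T, rfl⟩ := ih
      obtain ⟨T', h⟩ := exists_mul_sort_prod g hc h1 i T
      rw [inv_eq_of_mul_eq_one_right (h1 i)]
      exact ⟨T', h.symm⟩
  · rintro ⟨T, rfl⟩
    refine Subgroup.list_prod_mem _ fun y hy => ?_
    obtain ⟨i, _, rfl⟩ := List.mem_map.1 hy
    exact Subgroup.subset_closure ⟨i, rfl⟩

end Products

theorem op_list_prod (l : List (Pauli n)) : l.prod.op = (l.map op).prod := by
  induction l with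
  | nil => simp [op_one]
  | cons P l ih => simp [op_mul, ih]

/-- The group that is generated by the signed members of `S`. -/
def signedGroup (M : Fin m → Pauli n) (S : Finset (Fin m)) (f : S → ℤˣ) : Subgroup (Pauli n) :=
  Subgroup.closure (Set.range fun i => signed (f i) (M i))

theorem mem_admissibleSigns_iff {M : Fin m → Pauli n} (hM : ∀ i, M i * M i = 1)
    {S : Finset (Fin m)} (hS : ∀ i ∈ S, ∀ j ∈ S, (M i).symp (M j) = false) (f : S → ℤˣ) :
    f ∈ admissibleSigns M S ↔ (-1 : Pauli n) ∉ signedGroup M S f := by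
  rw [signedGroup, mem_closure_iff_sort_prod]
  · rw [not_exists]
    refine forall_congr' fun T => not_congr ?_
    rw [← op_injective.eq_iff, op_list_prod, op_neg, op_one, List.map_map]
    have h : (fun i : S => (((f i : ℤˣ) : ℤ) : ℂ) • (M i).op) =
        op ∘ fun i : S => signed (f i) (M i) := funext fun i => (op_signed _ _).symm
    rw [h]
  · exact fun i j => signed_commute _ _ (symp_eq_false_iff.1 (hS i i.2 j j.2))
  · exact fun i => signed_mul_self _ (hM i)

theorem isStab_signedGroup {M : Fin m → Pauli n} (hM : ∀ i, M i * M i = 1)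
    {S : Finset (Fin m)} (hS : ∀ i ∈ S, ∀ j ∈ S, (M i).symp (M j) = false) {f : S → ℤˣ}
    (hf : f ∈ admissibleSigns M S) : IsStab (signedGroup M S f) := by
  refine ⟨fun s hs t ht => ?_, (mem_admissibleSigns_iff hM hS f).1 hf⟩
  have h := Subgroup.isMulCommutative_closure (k := Set.range fun i : S => signed (f i) (M i)) (by
    rintro _ ⟨i, rfl⟩ _ ⟨j, rfl⟩
    exact signed_commute _ _ (symp_eq_false_iff.1 (hS i i.2 j j.2)))
  exact congrArg Subtype.val (h.is_comm.comm ⟨s, hs⟩ ⟨t, ht⟩)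

theorem sign_units (u : ℤˣ) : SignType.sign (u : ℤ) = if u = 1 then 1 else -1 := by
  rcases Int.units_eq_one_or u with rfl | rfl <;> simp

/-- The expectation values in a state whose stabilizer group contains the signed members of a
maximal independent set. -/
theorem expec_eq_vertex {M : Fin m → Pauli n} {S : Finset (Fin m)} (hS : S ∈ maxIndepSets M)
    (f : S → ℤˣ) {G : Subgroup (Pauli n)} (hG : IsStab G) (hfG : signedGroup M S f ≤ G) (i : Fin m) :
    expec G (M i) = vertex S f i := by
  have hmem : ∀ j : S, signed (f j) (M j) ∈ G := fun j => hfG (Subgroup.subset_closure ⟨j, rfl⟩)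
  rw [vertex]
  split_ifs with hi
  · have h := hmem ⟨i, hi⟩
    rw [sign_units]
    rw [signed] at h
    split_ifs at h ⊢ with hf
    · rw [expec, if_pos h]
    · rw [expec, if_pos h, if_neg fun h' => hG.neg_notMem h' h]
  · have h2 := (mem_maxIndepSets_iff M S).1 hS i
    obtain ⟨j, hj, hij⟩ : ∃ j ∈ S, (M i).symp (M j) ≠ false := by
      by_contra! hc
      exact hi (h2.2 hc)
    have hj' := hmem ⟨j, hj⟩
    have h3 : ∀ u, Commute (signed u (M i)) (signed (f ⟨j, hj⟩) (M j)) → False := by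
      intro u hu
      have h4 := signed_commute u (f ⟨j, hj⟩) hu
      apply hij
      rw [symp_eq_false_iff]
      have h5 : ∀ (v : ℤˣ) (P : Pauli n), signed v (signed v P) = P := fun v P => by
        rcases Int.units_eq_one_or v with rfl | rfl <;> simp [signed]
      rwa [h5, h5] at h4
    rw [expec, if_neg, if_neg]
    · intro h
      exact h3 (-1) (by rw [signed, if_neg (by decide)]; exact hG.comm _ h _ hj')
    · intro h
      exact h3 1 (by rw [signed, if_pos rfl]; exact hG.comm _ h _ hj')

/-- The expectation values that belong to a stabilizer group, as a real vector. -/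
noncomputable def expecVec (M : Fin m → Pauli n) (G : Subgroup (Pauli n)) : Fin m → ℝ :=
  realVec fun i => expec G (M i)

/-- The state of a stabilizer group is an average of the states of two extensions. -/
theorem expec_adjoin {G : Subgroup (Pauli n)} (hG : IsStab G) {R : Pauli n} (hR : R * R = 1)
    (hR' : -R * -R = 1) (hc : ∀ g ∈ G, g * R = R * g) (hc' : ∀ g ∈ G, g * -R = -R * g)
    (h1 : R ∉ G) (h2 : -R ∉ G) (P : Pauli n) :
    (expec G P : ℝ) = 2⁻¹ * (expec (adjoinSubgroup G R hR hc) P : ℝ) +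
      2⁻¹ * (expec (adjoinSubgroup G (-R) hR' hc') P : ℝ) := by
  have s1 := hG.adjoin (hR := hR) (hc := hc) h2
  have s2 := hG.adjoin (hR := hR') (hc := hc') (by rwa [neg_neg])
  by_cases ha : P ∈ G
  · rw [expec, expec, expec, if_pos ha, if_pos (le_adjoinSubgroup ha), if_pos (le_adjoinSubgroup ha)]
    norm_num
  by_cases hb : -P ∈ G
  · have e : ∀ H : Subgroup (Pauli n), IsStab H → -P ∈ H → expec H P = -1 := fun H hH h => by
      rw [expec, if_neg fun h' => hH.neg_notMem h' h, if_pos h]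
    rw [e _ hG hb, e _ s1 (le_adjoinSubgroup hb), e _ s2 (le_adjoinSubgroup hb)]
    norm_num
  · rw [expec, expec, expec, if_neg ha, if_neg hb]
    have e1 : P ∈ adjoinSubgroup G R hR hc ↔ R * P ∈ G := or_iff_right ha
    have e2 : -P ∈ adjoinSubgroup G R hR hc ↔ -(R * P) ∈ G :=
      (or_iff_right hb).trans (by rw [mul_neg])
    have e3 : P ∈ adjoinSubgroup G (-R) hR' hc' ↔ -(R * P) ∈ G :=
      (or_iff_right ha).trans (by rw [neg_mul])
    have e4 : -P ∈ adjoinSubgroup G (-R) hR' hc' ↔ R * P ∈ G :=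
      (or_iff_right hb).trans (by rw [neg_mul_neg])
    -- If `R * P` or its negative lies in `G`, the two extensions contain `P` with opposite signs
    -- and the contributions cancel; otherwise neither extension contains `P` up to sign.
    by_cases hx : R * P ∈ G
    · rw [if_pos (e1.2 hx), if_neg fun h => hG.neg_notMem hx (e3.1 h), if_pos (e4.2 hx)]
      norm_num
    by_cases hy : -(R * P) ∈ G
    · rw [if_neg (mt e1.1 hx), if_pos (e2.2 hy), if_pos (e3.2 hy)]
      norm_num
    · rw [if_neg (mt e1.1 hx), if_neg (mt e2.1 hy), if_neg (mt e3.1 hy), if_neg (mt e4.1 hx)]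
      norm_num

/-- Averaging argument by induction on the number of observables that `G` leaves undetermined. When
the determined ones form a maximal independent set, the vector is itself some `v_{S,f}`, with the
signs read off from `G`. -/
theorem expecVec_mem_convexHull {M : Fin m → Pauli n} (hM : ∀ i, M i * M i = 1)
    {G : Subgroup (Pauli n)} (hG : IsStab G) :
    expecVec M G ∈ convexHull ℝ (realVec '' vertices M) := by
  classical
  induction hk : m - (Finset.univ.filter fun i => M i ∈ G ∨ -M i ∈ G).card using
    Nat.strong_induction_on generalizing G with
  | _ k ih =>
  set T := Finset.univ.filter fun i => M i ∈ G ∨ -M i ∈ G with hT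
  have hmemT : ∀ i, i ∈ T ↔ M i ∈ G ∨ -M i ∈ G := by simp [hT]
  have hind : ∀ i ∈ T, ∀ j ∈ T, (M i).symp (M j) = false := by
    intro i hi j hj
    rw [symp_eq_false_iff]
    rcases (hmemT i).1 hi with hi | hi <;> rcases (hmemT j).1 hj with hj | hj <;>
      simpa using hG.comm _ hi _ hj
  by_cases hmax : T ∈ maxIndepSets M
  · let f : T → ℤˣ := fun i => if M i ∈ G then 1 else -1
    have hle : signedGroup M T f ≤ G := by
      rw [signedGroup, Subgroup.closure_le]
      rintro _ ⟨i, rfl⟩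
      simp only [f, signed]
      split_ifs with h1 h2 h2
      · exact h1
      · exact absurd rfl h2
      · exact absurd h2 (by decide)
      · exact ((hmemT i).1 i.2).resolve_left h1
    refine subset_convexHull ℝ _ ⟨vertex T f, ⟨T, hmax, f, ?_, rfl⟩, ?_⟩
    · exact (mem_admissibleSigns_iff hM hind f).2 fun h => hG.neg_one (hle h)
    · exact congrArg realVec (funext fun i => (expec_eq_vertex hmax f hG hle i).symm)
  · obtain ⟨j, hjT, hj⟩ : ∃ j, j ∉ T ∧ ∀ i ∈ T, (M j).symp (M i) = false := by
      by_contra! hc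
      refine hmax ((mem_maxIndepSets_iff M T).2 fun i => ⟨fun hi => hind i hi, fun hi => ?_⟩)
      by_contra hiT
      obtain ⟨k, hk, hik⟩ := hc i hiT
      exact hik (hi k hk)
    -- `M j` may anticommute with elements of `G` that are not among the observables. Passing to its
    -- centralizer discards these and keeps all observables in `T`, with their signs, so the
    -- expectation vector is unchanged.
    let H : Subgroup (Pauli n) := G ⊓ Subgroup.centralizer {M j}
    have hHG : H ≤ G := inf_le_left
    have hH : IsStab H := hG.mono hHG
    have hc : ∀ g ∈ H, g * M j = M j * g := fun g hg =>
      Subgroup.mem_centralizer_singleton_iff.1 hg.2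
    have hc' : ∀ g ∈ H, g * -M j = -M j * g := fun g hg => by rw [mul_neg, hc g hg, neg_mul]
    have hR' : -M j * -M j = 1 := by simp [hM j]
    have hjG : M j ∉ G ∧ -M j ∉ G := not_or.1 fun h => hjT ((hmemT j).2 h)
    have hTH : ∀ i ∈ T, M i ∈ H ∨ -M i ∈ H := by
      intro i hi
      have hci : M i * M j = M j * M i := symp_eq_false_iff.1 (by rw [symp_comm]; exact hj i hi)
      rcases (hmemT i).1 hi with h | h
      · exact Or.inl ⟨h, Subgroup.mem_centralizer_singleton_iff.2 hci⟩
      · exact Or.inr ⟨h, Subgroup.mem_centralizer_singleton_iff.2 (by simp [hci])⟩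
    have hvec : expecVec M G = expecVec M H := by
      refine congrArg realVec (funext fun i => ?_)
      by_cases hi : i ∈ T
      · rcases hTH i hi with h | h
        · rw [expec, expec, if_pos h, if_pos (hHG h)]
        · rw [expec, expec, if_pos h, if_pos (hHG h), if_neg fun h' => hG.neg_notMem h' (hHG h),
            if_neg fun h' => hH.neg_notMem h' h]
      · have h := not_or.1 fun h => hi ((hmemT i).2 h)
        rw [expec, expec, if_neg h.1, if_neg h.2, if_neg fun h' => h.1 (hHG h'),
          if_neg fun h' => h.2 (hHG h')]
    have step : ∀ K : Subgroup (Pauli n), IsStab K → H ≤ K → (M j ∈ K ∨ -M j ∈ K) →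
        expecVec M K ∈ convexHull ℝ (realVec '' vertices M) := by
      intro K hK hHK hjK
      refine ih _ ?_ hK rfl
      have hlt : T.card < (Finset.univ.filter fun i => M i ∈ K ∨ -M i ∈ K).card := by
        refine Finset.card_lt_card ⟨fun i hi => ?_, fun h => hjT (h (by simpa using hjK))⟩
        simpa using (hTH i hi).imp (fun h => hHK h) fun h => hHK h
      have hle : (Finset.univ.filter fun i => M i ∈ K ∨ -M i ∈ K).card ≤ m := by
        simpa using Finset.card_le_univ (Finset.univ.filter fun i => M i ∈ K ∨ -M i ∈ K)
      omega
    have h2 := convex_convexHull ℝ (realVec '' vertices M)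
      (step _ (hH.adjoin (hR := hM j) (hc := hc) fun h => hjG.2 (hHG h)) le_adjoinSubgroup
        (Or.inl self_mem_adjoinSubgroup))
      (step _ (hH.adjoin (hR := hR') (hc := hc') fun h => hjG.1 (hHG (by simpa using h)))
        le_adjoinSubgroup (Or.inr self_mem_adjoinSubgroup))
      (show (0 : ℝ) ≤ 2⁻¹ by norm_num) (show (0 : ℝ) ≤ 2⁻¹ by norm_num) (by norm_num)
    rw [hvec]
    convert h2 using 1
    funext i
    exact expec_adjoin hH (hM j) hR' hc hc' (fun h => hjG.1 (hHG h)) (fun h => hjG.2 (hHG h)) (M i)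

theorem expectations_state {M : Fin m → Pauli n} (hM : ∀ i, M i * M i = 1)
    {G : Subgroup (Pauli n)} (hG : IsStab G) (hc : Nat.card G = 2 ^ n)
    {ψ : (Fin n → Fin 2) → ℂ} (h1 : star ψ ⬝ᵥ ψ = 1) (hψ : ∀ s ∈ G, s.op.mulVec ψ = ψ) :
    expectations M (Matrix.vecMulVec ψ (star ψ)) = expecVec M G := by
  funext i
  rw [expectations, hG.trace_state hc h1 hψ (hM i), Complex.ofReal_re]
  rfl

/-- The vectors `v_{S,f}` form a vertex representation of the reduced stabilizer polytope. -/
theorem reducedPolytope_eq {M : Fin m → Pauli n} (hM : ∀ i, M i * M i = 1) :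
    reducedPolytope M = convexHull ℝ (realVec '' vertices M) := by
  have hlin : IsLinearMap ℝ (expectations M) := by
    constructor
    · intro ρ σ; funext i; simp [expectations, Matrix.mul_add]
    · intro c ρ; funext i; simp [expectations]
  rw [reducedPolytope, stabPolytope, hlin.image_convexHull, pureStabStates_eq]
  apply Set.Subset.antisymm
  · refine convexHull_min ?_ (convex_convexHull ℝ _)
    rintro _ ⟨_, ⟨G, hG, hc, ψ, h1, hψ, rfl⟩, rfl⟩
    rw [expectations_state hM hG hc h1 hψ]
    exact expecVec_mem_convexHull hM hG
  · refine convexHull_mono ?_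
    rintro _ ⟨_, ⟨S, hS, f, hf, rfl⟩, rfl⟩
    have hind := fun i hi => ((mem_maxIndepSets_iff M S).1 hS i).1 hi
    -- The choice of the maximal extension is irrelevant: maximality of `S` already forces all
    -- expectations.
    obtain ⟨G, hle, hG, hc⟩ := (isStab_signedGroup hM hind hf).exists_max
    obtain ⟨ψ, h1, hψ⟩ := hG.exists_fixed
    refine ⟨_, ⟨G, hG, hc, ψ, h1, hψ, rfl⟩, ?_⟩
    rw [expectations_state hM hG hc h1 hψ, expecVec]
    exact congrArg realVec (funext fun i => expec_eq_vertex hS f hG hle i)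

end Pauli

/-! ### Correctness of the first two phases -/

namespace Pauli

variable {n m : ℕ}

/-- The symplectic representation with lists of bits. -/
def code (P : Pauli n) : PauliCode := ((P.neg, P.im), (List.ofFn P.a, List.ofFn P.b))

theorem code_injective : Function.Injective (code : Pauli n → PauliCode) := by
  intro P Q h
  simp only [code, Prod.mk.injEq, List.ofFn_inj] at h
  exact ext_iff'.2 ⟨h.1.1, h.1.2, h.2.1, h.2.2⟩

theorem code_mul (P Q : Pauli n) : (P * Q).code = P.code.mul Q.code := by
  simp only [code, PauliCode.mul, zipWith_ofFn]
  rfl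

theorem code_neg (P : Pauli n) : (-P).code = P.code.neg := rfl

/-- The list of the codes of a family of observables. -/
def codes (M : Fin m → Pauli n) : List PauliCode := List.ofFn fun i => (M i).code

/-- The adjacency matrix of the frustration graph, in terms of the symplectic form. -/
def adjMatrix (M : Fin m → Pauli n) : List (List Bool) :=
  List.ofFn fun i => List.ofFn fun j => (M i).symp (M j)

theorem graphAlg_codes (M : Fin m → Pauli n) : graphAlg (codes M) = (codes M, adjMatrix M) := by
  simp only [graphAlg, codes, adjMatrix, List.map_ofFn]
  rfl

theorem ofList_ofFn_congr {α β : Type} {e : α → Data} {e' : β → Data} {v : Fin m → α}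
    {w : Fin m → β} (h : ∀ i, e (v i) = e' (w i)) :
    Data.ofList e (List.ofFn v) = Data.ofList e' (List.ofFn w) := by
  induction m with
  | zero => simp [Data.ofList]
  | succ m ih =>
    simp only [List.ofFn_succ, Data.ofList, h]
    rw [ih fun i => h i.succ]

theorem enc_codes (M : Fin m → Pauli n) : enc (codes M) = inputData M :=
  ofList_ofFn_congr fun _ => rfl

theorem enc_adjMatrix (M : Fin m → Pauli n) : enc (adjMatrix M) = graphData (frustrationGraph M) := by
  classical
  refine ofList_ofFn_congr fun i => ofList_ofFn_congr fun j => congrArg Data.ofBool ?_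
  rw [Bool.eq_iff_iff, decide_eq_true_iff, adj_iff]

/-! #### Maximal independent sets of induced subgraphs -/

/-- Maximal independent sets of the graph induced by the first `k` vertices. -/
def IsMis (M : Fin m → Pauli n) (k : ℕ) (S : Finset (Fin m)) : Prop :=
  ∀ i, i ∈ S ↔ i.1 < k ∧ ∀ j ∈ S, (M i).symp (M j) = false

/-- The first `k` entries of the characteristic vector of a set. -/
def charVec (k : ℕ) (S : Finset (Fin m)) : List Bool := (List.ofFn fun i => decide (i ∈ S)).take k

theorem length_charVec {k : ℕ} (hk : k ≤ m) (S : Finset (Fin m)) : (charVec k S).length = k := by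
  simp [charVec, hk]

theorem getElem_charVec {k : ℕ} (S : Finset (Fin m)) (i : ℕ) (h : i < (charVec k S).length) :
    (charVec k S)[i] = decide ((⟨i, by simp [charVec] at h; omega⟩ : Fin m) ∈ S) := by
  simp [charVec]

theorem any_zipWith_charVec (M : Fin m → Pauli n) {k : ℕ} {S : Finset (Fin m)}
    (hS : ∀ i ∈ S, i.1 < k) (i : Fin m) :
    (((List.ofFn fun j => (M i).symp (M j)).zipWith Bool.and (charVec k S)).any fun b => b) = true ↔
      ∃ j ∈ S, (M i).symp (M j) = true := by
  rw [List.any_eq_true]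
  constructor
  · rintro ⟨b, hb, hb'⟩
    obtain ⟨j, hj, rfl⟩ := List.mem_iff_getElem.1 hb
    simp only [List.length_zipWith, List.length_ofFn, lt_inf_iff] at hj
    rw [List.getElem_zipWith, getElem_charVec] at hb'
    simp only [List.getElem_ofFn, Bool.and_eq_true, decide_eq_true_eq] at hb'
    exact ⟨⟨j, hj.1⟩, hb'.2, hb'.1⟩
  · rintro ⟨j, hj, hij⟩
    have hlt : j.1 < ((List.ofFn fun j => (M i).symp (M j)).zipWith Bool.and
        (charVec k S)).length := by
      simp [charVec, hS j hj]
    refine ⟨_, List.getElem_mem hlt, ?_⟩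
    rw [List.getElem_zipWith, getElem_charVec]
    simp [hij, hj]

/-- A set is maximal independent iff each vertex is either a member or has a neighbour in the set,
but not both. This exclusive alternative is the `xor` of the test, and zipping with the
characteristic vector restricts it to the first `k` vertices. -/
theorem misTest_charVec (M : Fin m → Pauli n) {k : ℕ} {S : Finset (Fin m)}
    (hS : ∀ i ∈ S, i.1 < k) : misTest (adjMatrix M) (charVec k S) = true ↔ IsMis M k S := by
  have key : ∀ i : Fin m, (decide (i ∈ S) ^^ (((List.ofFn fun j => (M i).symp (M j)).zipWith
      Bool.and (charVec k S)).any fun b => b)) = true ↔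
      (i ∈ S ↔ ∀ j ∈ S, (M i).symp (M j) = false) := by
    intro i
    have h := any_zipWith_charVec M hS i
    have h' : (∀ j ∈ S, (M i).symp (M j) = false) ↔ ¬ ∃ j ∈ S, (M i).symp (M j) = true := by
      simp
    rw [h', ← h]
    cases ((List.ofFn fun j => (M i).symp (M j)).zipWith Bool.and (charVec k S)).any fun b => b <;>
      simp
  have hiff : misTest (adjMatrix M) (charVec k S) = true ↔
      ∀ i : Fin m, i.1 < k → (i ∈ S ↔ ∀ j ∈ S, (M i).symp (M j) = false) := by
    rw [misTest, List.all_eq_true]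
    constructor
    · intro h i hi
      rw [← key]
      have hlt : i.1 < ((adjMatrix M).zip (charVec k S)).length := by
        simp [adjMatrix, charVec, hi]
      have h1 := h _ (List.getElem_mem hlt)
      simp only [List.getElem_zip, getElem_charVec] at h1
      simpa [adjMatrix] using h1
    · intro h q hq
      obtain ⟨i, hi, rfl⟩ := List.mem_iff_getElem.1 hq
      have hi' := hi
      simp only [List.length_zip, adjMatrix, charVec, List.length_ofFn, List.length_take,
        lt_inf_iff] at hi'
      have h1 := (key ⟨i, hi'.1⟩).2 (h ⟨i, hi'.1⟩ hi'.2.1)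
      simp only [List.getElem_zip, getElem_charVec]
      simpa [adjMatrix] using h1
  rw [hiff]
  constructor
  · intro h i
    exact ⟨fun hi => ⟨hS i hi, (h i (hS i hi)).1 hi⟩, fun hi => (h i hi.1).2 hi.2⟩
  · intro h i hi
    rw [h i, and_iff_right hi]

theorem charVec_succ_of_notMem {k : ℕ} (hk : k < m) {S : Finset (Fin m)} (h : ⟨k, hk⟩ ∉ S) :
    charVec k S ++ [false] = charVec (k + 1) S := by
  rw [charVec, charVec, List.take_succ_eq_append_getElem (by simpa using hk)]
  simp [h]

theorem charVec_succ_insert (M : Fin m → Pauli n) {k : ℕ} (hk : k < m) (S : Finset (Fin m)) :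
    (List.ofFn fun j => (M ⟨k, hk⟩).symp (M j)).zipWith (fun r i => i && !r) (charVec k S) ++ [true] =
      charVec (k + 1) (insert ⟨k, hk⟩ (S.filter fun i => (M ⟨k, hk⟩).symp (M i) = false)) := by
  rw [charVec, charVec, List.take_succ_eq_append_getElem (by simpa using hk)]
  congr 1
  · apply List.ext_getElem
    · simp [hk.le]
    · intro i h1 h2
      have hik : i < k := by simp at h1; omega
      have hne : (⟨i, hik.trans hk⟩ : Fin m) ≠ ⟨k, hk⟩ := fun e => hik.ne (congrArg Fin.val e)
      rw [Bool.eq_iff_iff]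
      simp [hne]
  · simp

theorem exists_isMis (M : Fin m → Pauli n) (k : ℕ) {T : Finset (Fin m)} (h : ∀ i ∈ T, i.1 < k)
    (hT : ∀ i ∈ T, ∀ j ∈ T, (M i).symp (M j) = false) : ∃ S, T ⊆ S ∧ IsMis M k S := by
  obtain ⟨S, hTS, hS⟩ := Finite.exists_le_maximal (p := fun S : Finset (Fin m) =>
    (∀ i ∈ S, i.1 < k) ∧ ∀ i ∈ S, ∀ j ∈ S, (M i).symp (M j) = false) ⟨h, hT⟩
  refine ⟨S, hTS, fun i => ⟨fun hi => ⟨hS.prop.1 i hi, hS.prop.2 i hi⟩, fun hi => ?_⟩⟩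
  refine hS.le_of_ge (y := insert i S) ⟨?_, ?_⟩ (Finset.subset_insert _ _)
    (Finset.mem_insert_self _ _)
  · intro j hj
    rcases Finset.mem_insert.1 hj with rfl | hj
    · exact hi.1
    · exact hS.prop.1 j hj
  · intro j hj l hl
    rcases Finset.mem_insert.1 hj with rfl | hj <;> rcases Finset.mem_insert.1 hl with rfl | hl
    · exact symp_self _
    · exact hi.2 l hl
    · rw [symp_comm]; exact hi.2 j (by assumption)
    · exact hS.prop.2 j hj l hl

/-- Let `S` be maximal independent on `k + 1` vertices with last vertex `v`. Without `v`, it is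
already maximal on `k` vertices. With `v`, extend `S` minus `v` to a maximal set `T` on `k`
vertices: the members of `T` not adjacent to `v` are compatible with all of `S`, so they are exactly
the rest of `S`. Thus both kinds of candidates suffice, and `misTest` removes those that are not
maximal. -/
theorem setStep_spec (M : Fin m → Pauli n) {k : ℕ} (hk : k < m) {L : List (List Bool)}
    (hL : ∀ J, J ∈ L ↔ ∃ S, IsMis M k S ∧ J = charVec k S) :
    ∀ J, J ∈ setStep (adjMatrix M) L (List.ofFn fun j => (M ⟨k, hk⟩).symp (M j)) ↔
      ∃ S, IsMis M (k + 1) S ∧ J = charVec (k + 1) S := by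
  intro J
  rw [setStep, (nub_spec _).2, List.mem_filter, List.mem_flatMap]
  set v : Fin m := ⟨k, hk⟩ with hv
  constructor
  · rintro ⟨⟨I, hI, hJ⟩, ht⟩
    obtain ⟨S, hS, rfl⟩ := (hL I).1 hI
    have hSk : ∀ i ∈ S, i.1 < k := fun i hi => ((hS i).1 hi).1
    obtain ⟨S', hS', rfl⟩ : ∃ S', (∀ i ∈ S', i.1 < k + 1) ∧ J = charVec (k + 1) S' := by
      rcases List.mem_cons.1 hJ with rfl | hJ
      · exact ⟨S, fun i hi => (hSk i hi).trans k.lt_succ_self,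
          charVec_succ_of_notMem hk fun h => (hSk _ h).false⟩
      · rw [List.mem_singleton] at hJ
        refine ⟨_, ?_, hJ.trans (charVec_succ_insert M hk S)⟩
        intro i hi
        rcases Finset.mem_insert.1 hi with rfl | hi
        · exact k.lt_succ_self
        · exact (hSk i (Finset.mem_filter.1 hi).1).trans k.lt_succ_self
    exact ⟨S', (misTest_charVec M hS').1 ht, rfl⟩
  · rintro ⟨S, hS, rfl⟩
    refine ⟨?_, (misTest_charVec M fun i hi => ((hS i).1 hi).1).2 hS⟩
    have hlt : ∀ i ∈ S, i ≠ v → i.1 < k := fun i hi hne =>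
      lt_of_le_of_ne (Nat.lt_succ_iff.1 ((hS i).1 hi).1) fun e => hne (Fin.ext e)
    by_cases hvS : v ∈ S
    · obtain ⟨T, hT, hTm⟩ := exists_isMis M k (T := S.erase v)
        (fun i hi => hlt i (Finset.mem_of_mem_erase hi) (Finset.ne_of_mem_erase hi))
        fun i hi j hj => ((hS i).1 (Finset.mem_of_mem_erase hi)).2 j (Finset.mem_of_mem_erase hj)
      refine ⟨charVec k T, (hL _).2 ⟨T, hTm, rfl⟩, List.mem_cons_of_mem _ (List.mem_singleton.2 ?_)⟩
      rw [charVec_succ_insert M hk T]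
      congr 1
      ext i
      rw [Finset.mem_insert, Finset.mem_filter]
      constructor
      · intro hi
        by_cases hiv : i = v
        · exact Or.inl hiv
        · exact Or.inr ⟨hT (Finset.mem_erase.2 ⟨hiv, hi⟩), ((hS v).1 hvS).2 i hi⟩
      · rintro (rfl | ⟨hi, hvi⟩)
        · exact hvS
        · refine (hS i).2 ⟨((hTm i).1 hi).1.trans k.lt_succ_self, fun j hj => ?_⟩
          by_cases hjv : j = v
          · rw [hjv, symp_comm]; exact hvi
          · exact ((hTm i).1 hi).2 j (hT (Finset.mem_erase.2 ⟨hjv, hj⟩))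
    · refine ⟨charVec k S, (hL _).2 ⟨S, fun i => ?_, rfl⟩, List.mem_cons.2 (Or.inl
        (charVec_succ_of_notMem hk hvS).symm)⟩
      constructor
      · exact fun hi => ⟨hlt i hi fun e => hvS (e ▸ hi), ((hS i).1 hi).2⟩
      · exact fun hi => (hS i).2 ⟨hi.1.trans k.lt_succ_self, hi.2⟩

/-- The invariant is kept for all prefixes and without repetitions, since the lengths of the
intermediate lists govern the running time. -/
theorem sets_spec (M : Fin m → Pauli n) {k : ℕ} (hk : k ≤ m) :
    (((adjMatrix M).take k).foldl (setStep (adjMatrix M)) [[]]).Nodup ∧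
    ∀ J, J ∈ ((adjMatrix M).take k).foldl (setStep (adjMatrix M)) [[]] ↔
      ∃ S, IsMis M k S ∧ J = charVec k S := by
  induction k with
  | zero =>
    refine ⟨by simp, fun J => ?_⟩
    simp only [List.take_zero, List.foldl_nil, List.mem_singleton, charVec]
    exact ⟨fun h => ⟨∅, fun i => by simp, h⟩, fun ⟨_, _, h⟩ => h⟩
  | succ k ih =>
    have hlt : k < (adjMatrix M).length := by simpa [adjMatrix] using hk
    rw [List.take_succ_eq_append_getElem hlt, List.foldl_append]
    have hrow : (adjMatrix M)[k] = List.ofFn fun j => (M ⟨k, hk⟩).symp (M j) := by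
      simp [adjMatrix]
    rw [hrow]
    exact ⟨(nub_spec _).1, setStep_spec M hk (ih (Nat.le_of_succ_le hk)).2⟩

/-! #### Counting maximal independent sets -/

/-- The Pauli group has order `2 ^ (2 * n + 2)`, so each subgroup has a generating tuple of `2 * n +
2` elements, and counting tuples suffices. -/
theorem card_subgroup_le (n : ℕ) :
    Nat.card (Subgroup (Pauli n)) ≤ (4 * 4 ^ n) ^ (2 * n + 2) := by
  classical
  have hsurj : Function.Surjective fun g : Fin (2 * n + 2) → Pauli n =>
      Subgroup.closure (Set.range g) := by
    intro G
    have hfg : Group.FG G := inferInstance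
    obtain ⟨S, hS, hcl⟩ := Group.rank_spec G
    have hle : S.card ≤ 2 * n + 2 := by
      rw [hS]
      refine (Nat.pow_le_pow_iff_right (a := 2) (by norm_num)).1 ?_
      refine two_pow_rank_le_card.trans ((Subgroup.card_le_card_group G).trans (le_of_eq ?_))
      rw [Nat.card_eq_fintype_card, card_eq, pow_add, pow_mul]
      ring
    let e := S.equivFin
    -- Shorter generating sets are padded with `1`, which does not change the closure.
    refine ⟨fun i => if h : i.1 < S.card then ((e.symm ⟨i, h⟩ : S) : G) else 1, ?_⟩
    apply le_antisymm
    · rw [Subgroup.closure_le]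
      rintro _ ⟨i, rfl⟩
      simp only
      split_ifs
      · exact Subtype.prop _
      · exact G.one_mem
    · have h1 : G = (Subgroup.closure (S : Set G)).map G.subtype := by
        rw [hcl, ← MonoidHom.range_eq_map, Subgroup.range_subtype]
      conv_lhs => rw [h1]
      rw [MonoidHom.map_closure]
      refine Subgroup.closure_mono ?_
      rintro _ ⟨g, hg, rfl⟩
      refine ⟨⟨(e ⟨g, hg⟩).1, (e ⟨g, hg⟩).2.trans_le hle⟩, ?_⟩
      simp
  refine (Nat.card_le_card_of_surjective _ hsurj).trans (le_of_eq ?_)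
  rw [Nat.card_eq_fintype_card, Fintype.card_fun, card_eq, Fintype.card_fin]

/-- The set is recovered from its group: it consists of the first `k` vertices whose observables
commute with the whole group. -/
theorem isMis_closure_injective (M : Fin m → Pauli n) (k : ℕ) :
    Function.Injective fun S : {S // IsMis M k S} => Subgroup.closure (M '' (S.1 : Set (Fin m))) := by
  have key : ∀ S : {S // IsMis M k S}, ∀ i, i ∈ S.1 ↔ i.1 < k ∧
      ∀ g ∈ Subgroup.closure (M '' (S.1 : Set (Fin m))), (M i).symp g = false := by
    intro S i
    rw [S.2 i]
    refine and_congr_right fun _ => ⟨fun h g hg => ?_, fun h j hj =>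
      h _ (Subgroup.subset_closure ⟨j, hj, rfl⟩)⟩
    have hle : Subgroup.closure (M '' (S.1 : Set (Fin m))) ≤ Subgroup.centralizer {M i} := by
      rw [Subgroup.closure_le]
      rintro _ ⟨j, hj, rfl⟩
      exact Subgroup.mem_centralizer_singleton_iff.2 (symp_eq_false_iff.1 (h j hj)).symm
    exact symp_eq_false_iff.2 (Subgroup.mem_centralizer_singleton_iff.1 (hle hg)).symm
  intro S T h
  simp only at h
  refine Subtype.ext (Finset.ext fun i => ?_)
  rw [key S, key T, h]

/-- The exponent `(2 * n + 2) ^ 2` from the subgroup count is at most `12 * n ^ 2 + 4`, since `n ≤ n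
^ 2`; the factor 16 accounts for the summand 4. -/
theorem card_isMis_le (M : Fin m → Pauli n) (k : ℕ) :
    Nat.card {S // IsMis M k S} ≤ 16 * 2 ^ (12 * min m (n ^ 2)) := by
  have h1 : Nat.card {S // IsMis M k S} ≤ 2 ^ m := by
    refine (Nat.card_le_card_of_injective _ Subtype.val_injective).trans (le_of_eq ?_)
    rw [Nat.card_eq_fintype_card, Fintype.card_finset, Fintype.card_fin]
  have h2 : Nat.card {S // IsMis M k S} ≤ 16 * 2 ^ (12 * n ^ 2) := by
    refine (Nat.card_le_card_of_injective _ (isMis_closure_injective M k)).trans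
      ((card_subgroup_le n).trans ?_)
    have h3 : (4 * 4 ^ n) ^ (2 * n + 2) = 2 ^ ((2 * n + 2) * (2 * n + 2)) := by
      rw [pow_mul]
      congr 1
      rw [pow_add, pow_mul]
      ring
    have h4 : 16 * 2 ^ (12 * n ^ 2) = 2 ^ (12 * n ^ 2 + 4) := by rw [pow_add]; ring
    rw [h3, h4]
    refine Nat.pow_le_pow_right two_pos ?_
    have : n ≤ n ^ 2 := Nat.le_self_pow two_ne_zero n
    nlinarith
  rcases le_total m (n ^ 2) with h | h
  · rw [min_eq_left h]
    have h5 : 2 ^ m ≤ 2 ^ (12 * m) := Nat.pow_le_pow_right two_pos (by omega)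
    omega
  · rwa [min_eq_right h]

theorem length_sets_le (M : Fin m → Pauli n) {k : ℕ} (hk : k ≤ m) :
    (((adjMatrix M).take k).foldl (setStep (adjMatrix M)) [[]]).length ≤
      16 * 2 ^ (12 * min m (n ^ 2)) := by
  classical
  obtain ⟨h1, h2⟩ := sets_spec M hk
  refine le_trans ?_ (card_isMis_le M k)
  rw [← List.toFinset_card_of_nodup h1, Nat.card_eq_fintype_card, ← Finset.card_univ]
  refine (Finset.card_le_card (t := Finset.univ.image fun S : {S // IsMis M k S} => charVec k S.1)
    fun J hJ => ?_).trans Finset.card_image_le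
  obtain ⟨S, hS, rfl⟩ := (h2 J).1 (List.mem_toFinset.1 hJ)
  exact Finset.mem_image.2 ⟨⟨S, hS⟩, Finset.mem_univ _, rfl⟩

/-- The list of maximal independent sets. -/
def misList (M : Fin m → Pauli n) : List (Finset (Fin m)) :=
  ((adjMatrix M).foldl (setStep (adjMatrix M)) [[]]).map fun J =>
    Finset.univ.filter fun i : Fin m => J.getD i false = true

theorem misList_spec (M : Fin m → Pauli n) :
    (adjMatrix M).foldl (setStep (adjMatrix M)) [[]] = (misList M).map (charVec m) ∧
    (misList M).Nodup ∧ (∀ S, S ∈ misList M ↔ S ∈ maxIndepSets M) ∧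
    (misList M).length ≤ 16 * 2 ^ (12 * min m (n ^ 2)) := by
  obtain ⟨h1, h2⟩ := sets_spec M le_rfl
  have h3 := length_sets_le M le_rfl
  have ht : (adjMatrix M).take m = adjMatrix M := List.take_of_length_le (by simp [adjMatrix])
  rw [ht] at h1 h2 h3
  have hinv : ∀ S : Finset (Fin m),
      (Finset.univ.filter fun i : Fin m => (charVec m S).getD i false = true) = S := by
    intro S
    ext i
    simp [charVec, List.getD]
  have hmis : ∀ S, IsMis M m S ↔ S ∈ maxIndepSets M := by
    intro S
    rw [mem_maxIndepSets_iff]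
    exact forall_congr' fun i => by simp [i.2]
  refine ⟨?_, ?_, ?_, by simpa [misList] using h3⟩
  · rw [misList, List.map_map]
    symm
    refine (List.map_congr_left fun J hJ => ?_).trans (List.map_id _)
    obtain ⟨S, _, rfl⟩ := (h2 J).1 hJ
    simp only [Function.comp_apply, hinv, id]
  · refine List.Nodup.map_on (fun J hJ J' hJ' e => ?_) h1
    obtain ⟨S, _, rfl⟩ := (h2 J).1 hJ
    obtain ⟨S', _, rfl⟩ := (h2 J').1 hJ'
    rw [hinv, hinv] at e
    rw [e]
  · intro S
    rw [misList, List.mem_map, ← hmis]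
    constructor
    · rintro ⟨J, hJ, rfl⟩
      obtain ⟨S, hS, rfl⟩ := (h2 J).1 hJ
      rwa [hinv]
    · exact fun hS => ⟨_, (h2 _).2 ⟨S, hS, rfl⟩, hinv S⟩

end Pauli

/-! ### Correctness of the third phase -/

namespace Pauli

variable {n m : ℕ}

theorem elem_map_code (l : List (Pauli n)) (P : Pauli n) : (l.map code).elem P.code = decide (P ∈ l) := by
  rw [Bool.eq_iff_iff, List.elem_iff, decide_eq_true_iff, List.mem_map]
  exact ⟨fun ⟨Q, hQ, e⟩ => code_injective e ▸ hQ, fun h => ⟨P, h, rfl⟩⟩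

/-- The list `l` enumerates the group `G`. -/
structure Lists (l : List PauliCode) (G : Subgroup (Pauli n)) : Prop where
  exists_list : ∃ l' : List (Pauli n), l = l'.map code ∧ l'.Nodup ∧ ∀ Q, Q ∈ l' ↔ Q ∈ G

theorem Lists.elem_iff {l : List PauliCode} {G : Subgroup (Pauli n)} (h : Lists l G) (P : Pauli n) :
    l.elem P.code = true ↔ P ∈ G := by
  obtain ⟨l', rfl, -, h⟩ := h
  rw [elem_map_code, decide_eq_true_iff, h]

theorem Lists.length_le {l : List PauliCode} {G : Subgroup (Pauli n)} (h : Lists l G) :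
    l.length ≤ 4 * 4 ^ n := by
  obtain ⟨l', rfl, hn, -⟩ := h
  rw [List.length_map, ← card_eq (n := n)]
  exact hn.length_le_card

-- For `R` outside `G`, the cosets `G` and `R G` are disjoint, so appending needs no removal of
-- repetitions and exactly doubles the length.
open Classical in
theorem Lists.adjoin {l : List PauliCode} {G : Subgroup (Pauli n)} (h : Lists l G) {R : Pauli n}
    (hR : R * R = 1) (hc : ∀ s ∈ G, s * R = R * s) :
    Lists (ReducedStabilizer.adjoin l R.code) (adjoinSubgroup G R hR hc) ∧
      (ReducedStabilizer.adjoin l R.code).length = if R ∈ G then l.length else 2 * l.length := by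
  obtain ⟨l', rfl, hn, hm⟩ := h
  have hRR : ∀ Q : Pauli n, R * (R * Q) = Q := fun Q => by rw [← mul_assoc, hR, one_mul]
  rw [ReducedStabilizer.adjoin, elem_map_code]
  by_cases hRG : R ∈ G
  · simp only [(hm R).2 hRG, decide_true, cond_true, if_pos hRG, and_true]
    refine ⟨l', rfl, hn, fun Q => ?_⟩
    rw [hm, mem_adjoinSubgroup]
    exact ⟨Or.inl, fun hQ => hQ.elim id fun hQ => by simpa [hRR] using G.mul_mem hRG hQ⟩
  · simp only [mt (hm R).1 hRG, decide_false, cond_false, if_neg hRG]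
    refine ⟨⟨l' ++ l'.map (R * ·), ?_, ?_, fun Q => ?_⟩, by simp; omega⟩
    · rw [List.map_append, List.map_map, List.map_map]
      congr 1
      exact List.map_congr_left fun Q _ => (code_mul R Q).symm
    · rw [List.nodup_append]
      refine ⟨hn, hn.map (mul_right_injective R), ?_⟩
      rintro x hx _ hx' rfl
      obtain ⟨y, hy, rfl⟩ := List.mem_map.1 hx'
      have h1 := G.mul_mem ((hm _).1 hx) (G.inv_mem ((hm _).1 hy))
      simp only [mul_inv_cancel_right] at h1
      exact hRG h1
    · rw [List.mem_append, hm, List.mem_map, mem_adjoinSubgroup]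
      refine or_congr_right ⟨?_, fun h => ⟨R * Q, (hm _).2 h, hRR Q⟩⟩
      rintro ⟨x, hx, rfl⟩
      rw [hRR]
      exact (hm x).1 hx

/-- The group that is generated by the signed members of `S` among the first `k` observables. -/
def partGroup (M : Fin m → Pauli n) (S : Finset (Fin m)) (k : ℕ) (g : Fin m → ℤˣ) :
    Subgroup (Pauli n) :=
  Subgroup.closure {P | ∃ i ∈ S, i.1 < k ∧ P = signed (g i) (M i)}

/-- The first `k` entries of the vector with the signs `g` on `S`. -/
noncomputable def partVec (S : Finset (Fin m)) (k : ℕ) (g : Fin m → ℤˣ) : List SignType :=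
  (List.ofFn fun i => if i ∈ S then SignType.sign (g i : ℤ) else 0).take k

theorem length_partVec {S : Finset (Fin m)} {k : ℕ} (hk : k ≤ m) (g : Fin m → ℤˣ) :
    (partVec S k g).length = k := by simp [partVec, hk]

theorem partVec_succ (S : Finset (Fin m)) {k : ℕ} (hk : k < m) (g : Fin m → ℤˣ) :
    partVec S (k + 1) g =
      partVec S k g ++ [if ⟨k, hk⟩ ∈ S then SignType.sign (g ⟨k, hk⟩ : ℤ) else 0] := by
  rw [partVec, List.take_succ_eq_append_getElem (by simpa using hk), partVec]
  simp

theorem partVec_congr {S : Finset (Fin m)} {k : ℕ} {g g' : Fin m → ℤˣ}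
    (h : ∀ i, i.1 < k → g i = g' i) : partVec S k g = partVec S k g' := by
  apply List.ext_getElem
  · simp [partVec]
  · intro i h1 h2
    have hi : i < k := by simp [partVec] at h1; omega
    simp only [partVec, List.getElem_take, List.getElem_ofFn]
    rw [h _ hi]

theorem partGroup_congr {M : Fin m → Pauli n} {S : Finset (Fin m)} {k : ℕ} {g g' : Fin m → ℤˣ}
    (h : ∀ i, i.1 < k → g i = g' i) : partGroup M S k g = partGroup M S k g' := by
  rw [partGroup, partGroup]
  congr 1
  ext P
  refine exists_congr fun i => and_congr_right fun _ => and_congr_right fun hi => ?_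
  rw [h i hi]

/-! ### The invariant of the third phase. -/

section Step

variable {M : Fin m → Pauli n} {S : Finset (Fin m)} {k : ℕ}

theorem partGroup_comm (hS : ∀ i ∈ S, ∀ j ∈ S, (M i).symp (M j) = false) (g : Fin m → ℤˣ) {j : Fin m} (hj : j ∈ S) (u : ℤˣ) :
    ∀ s ∈ partGroup M S k g, s * signed u (M j) = signed u (M j) * s := by
  have h : partGroup M S k g ≤ Subgroup.centralizer {signed u (M j)} := by
    rw [partGroup, Subgroup.closure_le]
    rintro _ ⟨i, hi, -, rfl⟩
    exact Subgroup.mem_centralizer_singleton_iff.2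
      (signed_commute _ _ (symp_eq_false_iff.1 (hS i hi j hj)))
  exact fun s hs => Subgroup.mem_centralizer_singleton_iff.1 (h hs)

theorem isStab_partGroup (hS : ∀ i ∈ S, ∀ j ∈ S, (M i).symp (M j) = false) {g : Fin m → ℤˣ}
    (h : (-1 : Pauli n) ∉ partGroup M S k g) :
    IsStab (partGroup M S k g) := by
  refine ⟨fun s hs t ht => ?_, h⟩
  have h := Subgroup.isMulCommutative_closure
    (k := {P | ∃ i ∈ S, i.1 < k ∧ P = signed (g i) (M i)}) (by
      rintro _ ⟨i, hi, -, rfl⟩ _ ⟨j, hj, -, rfl⟩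
      exact signed_commute _ _ (symp_eq_false_iff.1 (hS i hi j hj)))
  exact congrArg Subtype.val (h.is_comm.comm ⟨s, hs⟩ ⟨t, ht⟩)

theorem partGroup_succ_of_notMem (hk : k < m) (h : ⟨k, hk⟩ ∉ S) (g : Fin m → ℤˣ) :
    partGroup M S (k + 1) g = partGroup M S k g := by
  rw [partGroup, partGroup]
  congr 1
  ext P
  refine exists_congr fun i => and_congr_right fun hi => and_congr_left fun _ =>
    ⟨fun hik => ?_, fun hik => hik.trans k.lt_succ_self⟩
  exact lt_of_le_of_ne (Nat.lt_succ_iff.1 hik) fun e => h (by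
    have : i = ⟨k, hk⟩ := Fin.ext e
    rwa [← this])

/-- The sign and the group enter through equations so that `g` may be an updated sign function whose
prefix group is that of the original one. -/
theorem partGroup_succ_of_mem (hk : k < m) (hkS : ⟨k, hk⟩ ∈ S) {g : Fin m → ℤˣ} {u : ℤˣ}
    {G : Subgroup (Pauli n)} (hu : g ⟨k, hk⟩ = u) (hG : partGroup M S k g = G)
    (hR : signed u (M ⟨k, hk⟩) * signed u (M ⟨k, hk⟩) = 1)
    (hc : ∀ s ∈ G, s * signed u (M ⟨k, hk⟩) = signed u (M ⟨k, hk⟩) * s) :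
    partGroup M S (k + 1) g = adjoinSubgroup G _ hR hc := by
  subst hu hG
  have hR' : signed (g ⟨k, hk⟩) (M ⟨k, hk⟩) ∈ partGroup M S (k + 1) g :=
    Subgroup.subset_closure ⟨_, hkS, k.lt_succ_self, rfl⟩
  have hle : partGroup M S k g ≤ partGroup M S (k + 1) g :=
    Subgroup.closure_mono fun P ⟨i, hi, hik, e⟩ => ⟨i, hi, hik.trans k.lt_succ_self, e⟩
  apply le_antisymm
  · conv_lhs => rw [partGroup]
    rw [Subgroup.closure_le]
    rintro _ ⟨i, hi, hik, rfl⟩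
    by_cases hik' : i = ⟨k, hk⟩
    · rw [hik']
      exact self_mem_adjoinSubgroup
    · refine le_adjoinSubgroup (Subgroup.subset_closure ⟨i, hi, ?_, rfl⟩)
      exact lt_of_le_of_ne (Nat.lt_succ_iff.1 hik) fun e => hik' (Fin.ext e)
  · rintro x (hx | hx)
    · exact hle hx
    · exact (Subgroup.mul_mem_cancel_left _ hR').1 (hle hx)

/-- Different signs lead to the same group, up to signs. -/
theorem partGroup_signs (g g' : Fin m → ℤˣ) {Q : Pauli n} (hQ : Q ∈ partGroup M S k g) :
    Q ∈ partGroup M S k g' ∨ -Q ∈ partGroup M S k g' := by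
  rw [partGroup] at hQ
  induction hQ using Subgroup.closure_induction with
  | mem x hx =>
    obtain ⟨i, hi, hik, rfl⟩ := hx
    have h : signed (g' i) (M i) ∈ partGroup M S k g' :=
      Subgroup.subset_closure ⟨i, hi, hik, rfl⟩
    rcases Int.units_eq_one_or (g i) with e | e <;> rcases Int.units_eq_one_or (g' i) with e' | e' <;>
      rw [e'] at h <;> rw [e] <;> simp [signed] at h ⊢ <;> simp [h]
  | one => exact Or.inl (Subgroup.one_mem _)
  | mul x y _ _ hx hy =>
    rcases hx with hx | hx <;> rcases hy with hy | hy <;> have h := Subgroup.mul_mem _ hx hy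
    · exact Or.inl h
    · exact Or.inr (by rwa [mul_neg] at h)
    · exact Or.inr (by rwa [neg_mul] at h)
    · exact Or.inl (by rwa [neg_mul_neg] at h)
  | inv x _ hx =>
    rcases hx with hx | hx <;> have h := Subgroup.inv_mem _ hx
    · exact Or.inl h
    · exact Or.inr (by rwa [inv_neg] at h)

variable (M S k) in
/-- The states of the third phase after `k` steps. -/
structure StatesSpec (A : List SignState) : Prop where
  sound : ∀ st ∈ A, ∃ g, st.1 = partVec S k g ∧ (-1 : Pauli n) ∉ partGroup M S k g ∧
    Lists st.2 (partGroup M S k g)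
  complete : ∀ g, (-1 : Pauli n) ∉ partGroup M S k g → ∃ st ∈ A, st.1 = partVec S k g ∧
    Lists st.2 (partGroup M S k g)
  nodup : (A.map Prod.fst).Nodup
  -- Equality with the group order makes the size of the Pauli group a bound on the number of
  -- partial sign vectors.
  length : A.length ≤ 2 ^ k ∧ ∀ st ∈ A, st.2.length = A.length

theorem StatesSpec.step_of_notMem {A : List SignState} (h : StatesSpec M S k A) (hk : k < m)
    (hkS : ⟨k, hk⟩ ∉ S) (P : PauliCode) : StatesSpec M S (k + 1) (signStep A (P, false)) := by
  have hs : signStep A (P, false) = A.map fun st => (st.1 ++ [0], st.2) := rfl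
  have hv : ∀ g, partVec S (k + 1) g = partVec S k g ++ [0] := fun g => by
    rw [partVec_succ S hk, if_neg hkS]
  rw [hs]
  constructor
  · intro st' hst'
    obtain ⟨st, hst, rfl⟩ := List.mem_map.1 hst'
    obtain ⟨g, h1, h2, h3⟩ := h.sound st hst
    refine ⟨g, ?_, ?_, ?_⟩
    · rw [hv, h1]
    · rwa [partGroup_succ_of_notMem hk hkS]
    · rwa [partGroup_succ_of_notMem hk hkS]
  · intro g hg
    rw [partGroup_succ_of_notMem hk hkS] at hg
    obtain ⟨st, hst, h1, h2⟩ := h.complete g hg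
    exact ⟨_, List.mem_map.2 ⟨st, hst, rfl⟩, by rw [hv, h1], by
      rwa [partGroup_succ_of_notMem hk hkS]⟩
  · rw [List.map_map]
    have : (Prod.fst ∘ fun st : SignState => (st.1 ++ [0], st.2)) = (fun v => v ++ [0]) ∘ Prod.fst :=
      rfl
    rw [this, ← List.map_map]
    exact h.nodup.map (List.append_left_injective _)
  · refine ⟨?_, fun st' hst' => ?_⟩
    · rw [List.length_map]
      exact h.length.1.trans (Nat.pow_le_pow_right two_pos (Nat.le_succ k))
    · obtain ⟨st, hst, rfl⟩ := List.mem_map.1 hst'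
      rw [List.length_map]
      exact h.length.2 st hst

open Classical in
theorem extend_eq {st : SignState} {G : Subgroup (Pauli n)} (h : Lists st.2 G) (R : Pauli n)
    (s : SignType) : extend R.code s st =
      if -R ∈ G then [] else [(st.1 ++ [s], ReducedStabilizer.adjoin st.2 R.code)] := by
  have h1 := h.elem_iff (-R)
  rw [code_neg] at h1
  rw [extend]
  by_cases h2 : -R ∈ G
  · rw [h1.2 h2, if_pos h2, cond_true]
  · rw [Bool.eq_false_iff.2 (mt h1.1 h2), if_neg h2, cond_false]

theorem flatMap_length {α β : Type*} {l : List α} {f : α → List β} {c : ℕ}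
    (h : ∀ a ∈ l, (f a).length = c) : (l.flatMap f).length = c * l.length := by
  induction l with
  | nil => simp
  | cons a l ih =>
    rw [List.flatMap_cons, List.length_append, h a List.mem_cons_self,
      ih fun b hb => h b (List.mem_cons_of_mem _ hb), List.length_cons]
    ring

theorem signStep_true (A : List SignState) (P : Pauli n) : signStep A (P.code, true) =
    A.flatMap fun st => extend (signed 1 P).code (SignType.sign ((1 : ℤˣ) : ℤ)) st ++
      extend (signed (-1) P).code (SignType.sign ((-1 : ℤˣ) : ℤ)) st := by
  rw [signed, if_pos rfl, signed, if_neg (by decide), code_neg, sign_units, sign_units, if_pos rfl,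
    if_neg (by decide)]
  rfl

open Classical in
theorem mem_extend_append {st x : SignState} {G : Subgroup (Pauli n)} (h : Lists st.2 G)
    (P : Pauli n) : x ∈ extend (signed 1 P).code (SignType.sign ((1 : ℤˣ) : ℤ)) st ++
      extend (signed (-1) P).code (SignType.sign ((-1 : ℤˣ) : ℤ)) st ↔
      ∃ u : ℤˣ, -signed u P ∉ G ∧ x = (st.1 ++ [SignType.sign (u : ℤ)],
        ReducedStabilizer.adjoin st.2 (signed u P).code) := by
  have key : ∀ u : ℤˣ, x ∈ extend (signed u P).code (SignType.sign (u : ℤ)) st ↔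
      -signed u P ∉ G ∧ x = (st.1 ++ [SignType.sign (u : ℤ)],
        ReducedStabilizer.adjoin st.2 (signed u P).code) := by
    intro u
    rw [extend_eq h]
    split_ifs with h1 <;> simp [h1]
  rw [List.mem_append, key, key]
  constructor
  · rintro (h | h)
    · exact ⟨1, h⟩
    · exact ⟨-1, h⟩
  · rintro ⟨u, h⟩
    rcases Int.units_eq_one_or u with rfl | rfl
    · exact Or.inl h
    · exact Or.inr h

theorem extend_subset (P : PauliCode) (s : SignType) (st : SignState) :
    (extend P s st).map Prod.fst = [] ∨ (extend P s st).map Prod.fst = [st.1 ++ [s]] := by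
  rw [extend]
  cases st.2.elem P.neg <;> simp

/-- A sign is refused exactly when it would put `-1` into the enlarged group, so every surviving
state stays admissible and no admissible sign is lost. -/
theorem StatesSpec.step_of_mem (hM : ∀ i, M i * M i = 1)
    (hS : ∀ i ∈ S, ∀ j ∈ S, (M i).symp (M j) = false) {A : List SignState}
    (h : StatesSpec M S k A) (hk : k < m) (hkS : ⟨k, hk⟩ ∈ S) :
    StatesSpec M S (k + 1) (signStep A ((M ⟨k, hk⟩).code, true)) := by
  classical
  rw [signStep_true]
  set v : Fin m := ⟨k, hk⟩ with hv
  have hR : ∀ u, signed u (M v) * signed u (M v) = 1 := fun u => signed_mul_self u (hM v)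
  have hvec : ∀ g, partVec S (k + 1) g = partVec S k g ++ [SignType.sign (g v : ℤ)] := fun g => by
    rw [partVec_succ S hk, if_pos hkS]
  constructor
  · intro x hx
    obtain ⟨st, hst, hx⟩ := List.mem_flatMap.1 hx
    obtain ⟨g, h1, h2, h3⟩ := h.sound st hst
    obtain ⟨u, hu, rfl⟩ := (mem_extend_append h3 _).1 hx
    have hg : ∀ i : Fin m, i.1 < k → Function.update g v u i = g i := fun i hi =>
      Function.update_of_ne (fun e => hi.ne (congrArg Fin.val e)) _ _
    have hgr := partGroup_succ_of_mem hk hkS (Function.update_self v u g)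
      (partGroup_congr (M := M) (S := S) hg) (hR u) (partGroup_comm hS g hkS u)
    refine ⟨Function.update g v u, ?_, ?_, ?_⟩
    · rw [hvec, Function.update_self, partVec_congr hg, h1]
    · rw [hgr]
      exact ((isStab_partGroup hS h2).adjoin hu).neg_one
    · rw [hgr]
      exact (h3.adjoin (hR u) _).1
  · intro g hg
    have hgr := partGroup_succ_of_mem hk hkS rfl rfl (hR (g v)) (partGroup_comm hS g hkS (g v))
    rw [hgr] at hg
    obtain ⟨st, hst, h1, h2⟩ := h.complete g fun hn => hg (le_adjoinSubgroup hn)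
    refine ⟨_, List.mem_flatMap.2 ⟨st, hst, (mem_extend_append h2 _).2 ⟨g v, fun hn => hg ?_, rfl⟩⟩,
      ?_, ?_⟩
    · exact Or.inr (by rwa [mul_neg, mul_one])
    · rw [hvec, h1]
    · rw [hgr]
      exact (h2.adjoin (hR _) _).1
  · rw [List.map_flatMap, List.nodup_flatMap]
    have hpm : SignType.sign ((1 : ℤˣ) : ℤ) ≠ SignType.sign ((-1 : ℤˣ) : ℤ) := by decide
    refine ⟨fun st _ => ?_, ?_⟩
    · rw [List.map_append]
      rcases extend_subset (signed 1 (M v)).code (SignType.sign ((1 : ℤˣ) : ℤ)) st with e | e <;>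
        rcases extend_subset (signed (-1) (M v)).code (SignType.sign ((-1 : ℤˣ) : ℤ)) st with e' | e' <;>
        rw [e, e'] <;> simp
    -- Dropping the last entry recovers the previous vector, so extensions of different states
    -- differ.
    · have hd : ∀ st : SignState, ∀ x ∈ (extend (signed 1 (M v)).code (SignType.sign ((1 : ℤˣ) : ℤ)) st ++
          extend (signed (-1) (M v)).code (SignType.sign ((-1 : ℤˣ) : ℤ)) st).map Prod.fst,
          x.dropLast = st.1 := by
        intro st x hx
        rw [List.map_append, List.mem_append] at hx
        rcases hx with hx | hx
        · rcases extend_subset (signed 1 (M v)).code (SignType.sign ((1 : ℤˣ) : ℤ)) st with e | e <;>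
            rw [e] at hx <;> simp at hx
          simp [hx]
        · rcases extend_subset (signed (-1) (M v)).code (SignType.sign ((-1 : ℤˣ) : ℤ)) st with e | e <;>
            rw [e] at hx <;> simp at hx
          simp [hx]
      refine (List.pairwise_map.1 h.nodup).imp fun {st st'} hne => ?_
      intro x hx hx'
      exact hne ((hd st x hx).symm.trans (hd st' x hx'))
  · have hone : ∀ P : Pauli n, signed 1 P = P ∧ signed (-1) P = -P := fun P =>
      ⟨by rw [signed, if_pos rfl], by rw [signed, if_neg (by decide)]⟩
    -- If one prefix group contains the observable up to sign, all of them do: one sign survives in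
    -- each state and no group grows. Otherwise both signs survive everywhere and every group
    -- doubles. Either way the numbers of states and of group elements stay equal.
    by_cases hc : ∃ st₀ ∈ A, ∃ g₀, Lists st₀.2 (partGroup M S k g₀) ∧
        (M v ∈ partGroup M S k g₀ ∨ -M v ∈ partGroup M S k g₀)
    · obtain ⟨_, _, g₀, _, hc⟩ := hc
      have hall : ∀ g, M v ∈ partGroup M S k g ∨ -M v ∈ partGroup M S k g := by
        intro g
        rcases hc with hc | hc
        · exact partGroup_signs g₀ g hc
        · simpa [or_comm] using partGroup_signs g₀ g hc
      have hlen : ∀ st ∈ A, (extend (signed 1 (M v)).code (SignType.sign ((1 : ℤˣ) : ℤ)) st ++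
          extend (signed (-1) (M v)).code (SignType.sign ((-1 : ℤˣ) : ℤ)) st).length = 1 := by
        intro st hst
        obtain ⟨g, h1, h2, h3⟩ := h.sound st hst
        have hs := isStab_partGroup hS h2
        rw [extend_eq h3, extend_eq h3, (hone _).1, (hone _).2, neg_neg]
        rcases hall g with hg | hg
        · rw [if_neg (hs.neg_notMem hg), if_pos hg]; rfl
        · rw [if_pos hg, if_neg fun h' => hs.neg_notMem h' hg]; rfl
      rw [flatMap_length hlen, one_mul]
      refine ⟨h.length.1.trans (Nat.pow_le_pow_right two_pos (Nat.le_succ k)), fun x hx => ?_⟩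
      obtain ⟨st, hst, hx⟩ := List.mem_flatMap.1 hx
      obtain ⟨g, h1, h2, h3⟩ := h.sound st hst
      obtain ⟨u, hu, rfl⟩ := (mem_extend_append h3 _).1 hx
      rw [(h3.adjoin (hR u) (partGroup_comm hS g hkS u)).2, if_pos, h.length.2 st hst]
      rcases Int.units_eq_one_or u with rfl | rfl
      · rw [(hone _).1] at hu ⊢
        exact (hall g).resolve_right hu
      · rw [(hone _).2] at hu ⊢
        rw [neg_neg] at hu
        exact (hall g).resolve_left hu
    · have hall : ∀ st ∈ A, ∀ g, Lists st.2 (partGroup M S k g) →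
          M v ∉ partGroup M S k g ∧ -M v ∉ partGroup M S k g := fun st hst g hg =>
        not_or.1 fun h' => hc ⟨st, hst, g, hg, h'⟩
      have hlen : ∀ st ∈ A, (extend (signed 1 (M v)).code (SignType.sign ((1 : ℤˣ) : ℤ)) st ++
          extend (signed (-1) (M v)).code (SignType.sign ((-1 : ℤˣ) : ℤ)) st).length = 2 := by
        intro st hst
        obtain ⟨g, h1, h2, h3⟩ := h.sound st hst
        obtain ⟨h4, h5⟩ := hall st hst g h3
        rw [extend_eq h3, extend_eq h3, (hone _).1, (hone _).2, neg_neg, if_neg h4, if_neg h5]; rfl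
      rw [flatMap_length hlen]
      refine ⟨by rw [pow_succ, mul_comm]; exact Nat.mul_le_mul_right _ h.length.1, fun x hx => ?_⟩
      obtain ⟨st, hst, hx⟩ := List.mem_flatMap.1 hx
      obtain ⟨g, h1, h2, h3⟩ := h.sound st hst
      obtain ⟨h4, h5⟩ := hall st hst g h3
      obtain ⟨u, hu, rfl⟩ := (mem_extend_append h3 _).1 hx
      rw [(h3.adjoin (hR u) (partGroup_comm hS g hkS u)).2, if_neg, h.length.2 st hst]
      rcases Int.units_eq_one_or u with rfl | rfl
      · rwa [(hone _).1]
      · rwa [(hone _).2]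

theorem zip_codes (M : Fin m → Pauli n) (S : Finset (Fin m)) :
    (codes M).zip (charVec m S) = List.ofFn fun i => ((M i).code, decide (i ∈ S)) := by
  rw [codes, charVec, List.take_of_length_le (by simp), List.zip, zipWith_ofFn]

theorem states_spec (hM : ∀ i, M i * M i = 1)
    (hS : ∀ i ∈ S, ∀ j ∈ S, (M i).symp (M j) = false) (hm : 0 < m) (hk : k ≤ m) :
    StatesSpec M S k ((((codes M).zip (charVec m S)).take k).foldl signStep (signInit (codes M))) := by
  rw [zip_codes]
  induction k with
  | zero =>
    -- All observables square to the identity, so `nub` leaves only its code; this is how the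
    -- program obtains the identity on the right number of qubits. It needs at least one observable,
    -- hence `hm`.
    have hinit : signInit (codes M) = [([], [(1 : Pauli n).code])] := by
      have h1 : (codes M).map (fun P => P.mul P) = List.ofFn fun _ : Fin m => (1 : Pauli n).code := by
        rw [codes, List.map_ofFn]
        congr 1
        funext i
        rw [Function.comp_apply, ← code_mul, hM]
      obtain ⟨h2, h3⟩ := nub_spec ((codes M).map fun P => P.mul P)
      have h4 : ∀ a, a ∈ nub ((codes M).map fun P => P.mul P) ↔ a = (1 : Pauli n).code := by
        intro a
        rw [h3, h1, List.mem_ofFn]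
        exact ⟨fun ⟨_, e⟩ => e.symm, fun e => ⟨⟨0, hm⟩, e.symm⟩⟩
      rw [signInit]
      congr 2
      refine List.perm_singleton.1 ((List.perm_ext_iff_of_nodup h2 (List.nodup_singleton _)).2 ?_)
      intro a
      rw [h4, List.mem_singleton]
    have hG : ∀ g, partGroup M S 0 g = ⊥ := by
      intro g
      rw [partGroup, Subgroup.closure_eq_bot_iff]
      rintro _ ⟨i, _, hi, _⟩
      exact absurd hi (Nat.not_lt_zero _)
    have hl : Lists [(1 : Pauli n).code] (⊥ : Subgroup (Pauli n)) :=
      ⟨[1], rfl, List.nodup_singleton _, fun Q => by rw [List.mem_singleton, Subgroup.mem_bot]⟩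
    rw [List.take_zero, List.foldl_nil, hinit]
    constructor
    · intro st hst
      rw [List.mem_singleton] at hst
      subst hst
      exact ⟨fun _ => 1, by simp [partVec], by
        rw [hG, Subgroup.mem_bot]; exact neg_ne 1, by rw [hG]; exact hl⟩
    · intro g _
      exact ⟨_, List.mem_singleton_self _, by simp [partVec], by rw [hG]; exact hl⟩
    · simp
    · simp
  | succ k ih =>
    rw [List.take_succ_eq_append_getElem (by simpa using hk), List.foldl_append]
    have h := ih (Nat.le_of_succ_le hk)
    by_cases hkS : ⟨k, hk⟩ ∈ S
    · simpa [hkS] using h.step_of_mem hM hS hk hkS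
    · simpa [hkS] using h.step_of_notMem hk hkS _

end Step

end Pauli

/-! ### Output of the third phase. -/

namespace Pauli

variable {n m : ℕ}

theorem partGroup_eq_signedGroup (M : Fin m → Pauli n) (S : Finset (Fin m)) (g : Fin m → ℤˣ) :
    partGroup M S m g = signedGroup M S fun i => g i := by
  rw [partGroup, signedGroup]
  congr 1
  ext P
  constructor
  · rintro ⟨i, hi, -, rfl⟩
    exact ⟨⟨i, hi⟩, rfl⟩
  · rintro ⟨i, rfl⟩
    exact ⟨i, i.2, i.1.2, rfl⟩

theorem indep_of_mem {M : Fin m → Pauli n} {S : Finset (Fin m)} (hS : S ∈ maxIndepSets M) :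
    ∀ i ∈ S, ∀ j ∈ S, (M i).symp (M j) = false :=
  fun i hi => ((mem_maxIndepSets_iff M S).1 hS i).1 hi

/-- The vectors that the third phase lists for a set. -/
def signVectors (M : Fin m → Pauli n) (S : Finset (Fin m)) : List (Fin m → SignType) :=
  (signs (codes M) (charVec m S)).map fun l i => l.getD i 0

theorem signs_spec {M : Fin m → Pauli n} (hM : ∀ i, M i * M i = 1) {S : Finset (Fin m)}
    (hS : S ∈ maxIndepSets M) :
    (signs (codes M) (charVec m S)).Nodup ∧ ∀ l, l ∈ signs (codes M) (charVec m S) ↔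
      ∃ f ∈ admissibleSigns M S, l = List.ofFn (vertex S f) := by
  have hind := indep_of_mem hS
  -- Without observables the initial group list is empty instead of listing the trivial group, so
  -- the invariant fails. The output is still right, because no step consults that list.
  rcases Nat.eq_zero_or_pos m with rfl | hm
  · have h : signs (codes M) (charVec 0 S) = [[]] := by simp [signs, codes, signInit]
    rw [h]
    refine ⟨List.nodup_singleton _, fun l => ?_⟩
    simp only [List.mem_singleton, List.ofFn_zero]
    refine ⟨fun h => ⟨fun _ => 1, (mem_admissibleSigns_iff hM hind _).2 ?_, h⟩, fun ⟨_, _, h⟩ => h⟩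
    have hb : signedGroup M S (fun _ => 1) = ⊥ := by
      rw [signedGroup, Subgroup.closure_eq_bot_iff]
      rintro _ ⟨i, _⟩
      exact i.1.elim0
    rw [hb, Subgroup.mem_bot]
    exact neg_ne 1
  · have h := states_spec hM hind hm le_rfl
    rw [List.take_of_length_le (by simp [zip_codes])] at h
    refine ⟨h.nodup, fun l => ?_⟩
    have hvec : ∀ g : Fin m → ℤˣ, partVec S m g = List.ofFn (vertex S fun i => g i) := by
      intro g
      rw [partVec, List.take_of_length_le (by simp)]
      congr 1
    rw [signs, List.mem_map]
    constructor
    · rintro ⟨st, hst, rfl⟩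
      obtain ⟨g, h1, h2, -⟩ := h.sound st hst
      rw [partGroup_eq_signedGroup] at h2
      exact ⟨_, (mem_admissibleSigns_iff hM hind _).2 h2, by rw [h1, hvec]⟩
    · rintro ⟨f, hf, rfl⟩
      -- The signs are extended by `1` outside `S`; neither the vector nor the group depends on this
      -- value.
      have hf' : (fun i : S => (fun i : Fin m => if h : i ∈ S then f ⟨i, h⟩ else 1) i) = f := by
        funext i
        simp
      obtain ⟨st, hst, h1, -⟩ := h.complete (fun i => if h : i ∈ S then f ⟨i, h⟩ else 1) (by
        rw [partGroup_eq_signedGroup, hf']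
        exact (mem_admissibleSigns_iff hM hind _).1 hf)
      refine ⟨st, hst, ?_⟩
      rw [h1, hvec, hf']

theorem signVectors_spec {M : Fin m → Pauli n} (hM : ∀ i, M i * M i = 1) {S : Finset (Fin m)}
    (hS : S ∈ maxIndepSets M) :
    signs (codes M) (charVec m S) = (signVectors M S).map List.ofFn ∧ (signVectors M S).Nodup ∧
      ∀ v, v ∈ signVectors M S ↔ ∃ f ∈ admissibleSigns M S, v = vertex S f := by
  obtain ⟨h1, h2⟩ := signs_spec hM hS
  have hinv : ∀ v : Fin m → SignType, (fun i : Fin m => (List.ofFn v).getD i 0) = v := by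
    intro v
    funext i
    simp [List.getD]
  refine ⟨?_, ?_, fun v => ?_⟩
  · rw [signVectors, List.map_map]
    symm
    refine (List.map_congr_left fun l hl => ?_).trans (List.map_id _)
    obtain ⟨f, _, rfl⟩ := (h2 l).1 hl
    simp only [Function.comp_apply, hinv, id]
  · refine List.Nodup.map_on (fun l hl l' hl' e => ?_) h1
    obtain ⟨f, _, rfl⟩ := (h2 l).1 hl
    obtain ⟨f', _, rfl⟩ := (h2 l').1 hl'
    rw [hinv, hinv] at e
    rw [e]
  · rw [signVectors, List.mem_map]
    constructor
    · rintro ⟨l, hl, rfl⟩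
      obtain ⟨f, hf, rfl⟩ := (h2 l).1 hl
      exact ⟨f, hf, hinv _⟩
    · rintro ⟨f, hf, rfl⟩
      exact ⟨_, (h2 _).2 ⟨f, hf, rfl⟩, hinv _⟩

theorem vertex_ne_zero_iff {S : Finset (Fin m)} (f : S → ℤˣ) (i : Fin m) :
    vertex S f i ≠ 0 ↔ i ∈ S := by
  rw [vertex]
  split_ifs with h
  · rw [sign_units]
    split_ifs <;> simp [h]
  · simp [h]

/-- The set is the support of its vectors, so different sets contribute disjoint lists. -/
theorem nodup_flatMap_signVectors {M : Fin m → Pauli n} (hM : ∀ i, M i * M i = 1)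
    {L : List (Finset (Fin m))} (hL : L.Nodup) (hmem : ∀ S ∈ L, S ∈ maxIndepSets M) :
    (L.flatMap (signVectors M)).Nodup := by
  rw [List.nodup_flatMap]
  refine ⟨fun S hS => (signVectors_spec hM (hmem S hS)).2.1, ?_⟩
  refine List.Pairwise.imp_of_mem ?_ hL
  intro S T hS hT hne v hv hv'
  obtain ⟨f, _, rfl⟩ := ((signVectors_spec hM (hmem S hS)).2.2 v).1 hv
  obtain ⟨f', _, e⟩ := ((signVectors_spec hM (hmem T hT)).2.2 _).1 hv'
  exact hne (Finset.ext fun i => by rw [← vertex_ne_zero_iff f, e, vertex_ne_zero_iff])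

theorem ofList_map {α β : Type} (e : β → Data) (f : α → β) (l : List α) :
    Data.ofList e (l.map f) = Data.ofList (fun a => e (f a)) l := by
  induction l with
  | nil => rfl
  | cons a l ih => simp [Data.ofList, ih]

theorem enc_sets (L : List (Finset (Fin m))) : enc (L.map (charVec m)) = setsData L := by
  refine (ofList_map _ _ _).trans ?_
  rw [setsData]
  congr 1
  funext S
  rw [charVec, List.take_of_length_le (by simp)]
  rfl

theorem signsAlg_eq (M : Fin m → Pauli n) (Ls : List (List Bool)) :
    signsAlg (codes M, Ls) = Ls.flatMap (signs (codes M)) := by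
  suffices h : ∀ (l : List (List Bool)) s,
      l.foldl (fun s S => s ++ signs (codes M) S) s = s ++ l.flatMap (signs (codes M)) by
    rw [signsAlg, h, List.nil_append]
  intro l
  induction l with
  | nil => simp
  | cons a l ih => intro s; simp [ih]

theorem enc_signsAlg {M : Fin m → Pauli n} (hM : ∀ i, M i * M i = 1)
    {L : List (Finset (Fin m))} (hmem : ∀ S ∈ L, S ∈ maxIndepSets M) :
    enc (signsAlg (codes M, L.map (charVec m))) = vectorsData (L.flatMap (signVectors M)) := by
  have h : signsAlg (codes M, L.map (charVec m)) = (L.flatMap (signVectors M)).map List.ofFn := by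
    rw [signsAlg_eq, List.flatMap_map, List.map_flatMap]
    exact List.flatMap_congr fun S hS => (signVectors_spec hM (hmem S hS)).1
  rw [h]
  exact ofList_map _ _ _

/-! ### The running time -/

theorem sz_code_le (P : Pauli n) : sz P.code ≤ 8 * n + 17 := by
  have h : ∀ v : Fin n → Bool, sz (List.ofFn v) ≤ 1 + n * (1 + 3) := fun v => by
    simpa using sz_list_le (l := List.ofFn v) (N := 3) fun b _ => sz_bool b
  have h1 := h P.a
  have h2 := h P.b
  have h3 := sz_bool P.neg
  have h4 := sz_bool P.im
  simp only [code, sz_prod]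
  omega

theorem sz_codes_le (M : Fin m → Pauli n) : sz (codes M) ≤ 1 + m * (8 * n + 18) := by
  have h := sz_list_le (l := codes M) (N := 8 * n + 17) fun P hP => by
    obtain ⟨i, rfl⟩ := (List.mem_ofFn' _ _).1 hP
    exact sz_code_le _
  refine h.trans (le_of_eq ?_)
  simp only [codes, List.length_ofFn]
  ring

theorem sz_bools_le {l : List Bool} (h : l.length ≤ m) : sz l ≤ 1 + 4 * m := by
  have := sz_list_le (l := l) (N := 3) fun b _ => sz_bool b
  omega

theorem sz_adjMatrix_le (M : Fin m → Pauli n) : sz (adjMatrix M) ≤ 1 + m * (2 + 4 * m) := by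
  have h := sz_list_le (l := adjMatrix M) (N := 1 + 4 * m) fun l hl => by
    obtain ⟨i, rfl⟩ := (List.mem_ofFn' _ _).1 hl
    exact sz_bools_le (by simp)
  refine h.trans (le_of_eq ?_)
  simp only [adjMatrix, List.length_ofFn]
  ring

/-- A bound for the number of maximal independent sets. -/
def setBound (n m : ℕ) : ℕ := 16 * 2 ^ (12 * min m (n ^ 2))

/-- A bound for the number of admissible signs, and for the orders of the groups. -/
def signBound (n m : ℕ) : ℕ := 4 * 2 ^ (2 * min m n)

theorem setsCost_le (M : Fin m → Pauli n) :
    foldCost (setStep (adjMatrix M)) [[]] (adjMatrix M) ≤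
      (m + 1) * (1 + setBound n m * (2 + 4 * m)) := by
  have h := foldCost_le (setStep (adjMatrix M)) [[]] (l := adjMatrix M)
    (B := 1 + setBound n m * (2 + 4 * m)) fun l₁ l₂ e => by
      have hl := congrArg List.length e
      simp only [adjMatrix, List.length_ofFn, List.length_append] at hl
      have hk : l₁.length ≤ m := by omega
      have e1 : l₁ = (adjMatrix M).take l₁.length := by rw [e, List.take_left']; rfl
      rw [e1]
      have h1 := sz_list_le (l := ((adjMatrix M).take l₁.length).foldl (setStep (adjMatrix M)) [[]])
        (N := 1 + 4 * m) fun J hJ => by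
          obtain ⟨S, _, rfl⟩ := ((sets_spec M hk).2 J).1 hJ
          exact sz_bools_le (by rw [length_charVec hk]; exact hk)
      refine h1.trans (Nat.add_le_add_left ?_ 1)
      exact Nat.mul_le_mul (length_sets_le M hk) (by omega)
  simpa [adjMatrix] using h

/-- A bound for the size of the list of states in the third phase. -/
def stateBound (n m : ℕ) : ℕ :=
  1 + signBound n m * (1 + (1 + (1 + 6 * m) + (1 + signBound n m * (8 * n + 18))))

theorem sz_signs_le {l : List SignType} (h : l.length ≤ m) : sz l ≤ 1 + 6 * m := by
  have := sz_list_le (l := l) (N := 5) fun b _ => sz_sign b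
  omega

theorem states_le {M : Fin m → Pauli n} (hM : ∀ i, M i * M i = 1) {S : Finset (Fin m)}
    (hS : S ∈ maxIndepSets M) {k : ℕ} (hk : k ≤ m) :
    ((((codes M).zip (charVec m S)).take k).foldl signStep (signInit (codes M))).length ≤
      signBound n m ∧
    sz ((((codes M).zip (charVec m S)).take k).foldl signStep (signInit (codes M))) ≤
      stateBound n m := by
  have hX : 4 ≤ signBound n m := by
    have := Nat.one_le_two_pow (n := 2 * min m n)
    unfold signBound
    omega
  rcases Nat.eq_zero_or_pos m with rfl | hm
  · have h0 : ((codes M).zip (charVec 0 S)).take k = [] := by simp [codes]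
    have h1 : signInit (codes M) = [([], [])] := by simp [signInit, codes, nub]
    rw [h0, List.foldl_nil, h1]
    refine ⟨by simp; omega, ?_⟩
    simp only [sz_cons, sz_prod, sz_nil, stateBound]
    have : signBound n 0 * 1 ≤
      signBound n 0 * (1 + (1 + (1 + 6 * 0) + (1 + signBound n 0 * (8 * n + 18)))) :=
      Nat.mul_le_mul_left _ (by omega)
    omega
  · have h := states_spec hM (indep_of_mem hS) hm hk
    set A := (((codes M).zip (charVec m S)).take k).foldl signStep (signInit (codes M)) with hA
    have hlen : A.length ≤ signBound n m := by
      have h1 : A.length ≤ 2 ^ m := h.length.1.trans (Nat.pow_le_pow_right two_pos hk)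
      -- Any state carries a repetition-free list of Pauli operators that is as long as `A`.
      have h2 : A.length ≤ 4 * 2 ^ (2 * n) := by
        rcases List.eq_nil_or_concat A with e | ⟨l, st, e⟩
        · rw [e]; simp
        · have hst : st ∈ A := by rw [e]; simp
          obtain ⟨g, _, _, h3⟩ := h.sound st hst
          rw [← h.length.2 st hst, pow_mul]
          exact h3.length_le
      unfold signBound
      rcases le_total m n with hmn | hmn
      · rw [min_eq_left hmn]
        have h5 : 2 ^ m ≤ 2 ^ (2 * m) := Nat.pow_le_pow_right two_pos (by omega)
        omega
      · rwa [min_eq_right hmn]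
    refine ⟨hlen, (sz_list_le (N := 1 + (1 + 6 * m) + (1 + signBound n m * (8 * n + 18)))
      fun st hst => ?_).trans ?_⟩
    · obtain ⟨g, h1, _, h3⟩ := h.sound st hst
      have h4 : sz st.1 ≤ 1 + 6 * m := sz_signs_le (by rw [h1, length_partVec hk]; exact hk)
      have h5 : sz st.2 ≤ 1 + st.2.length * (1 + (8 * n + 17)) := sz_list_le fun P hP => by
        obtain ⟨l', e, _⟩ := h3.exists_list
        rw [e] at hP
        obtain ⟨Q, _, rfl⟩ := List.mem_map.1 hP
        exact sz_code_le Q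
      have h6 : st.2.length * (1 + (8 * n + 17)) ≤ signBound n m * (8 * n + 18) :=
        Nat.mul_le_mul ((h.length.2 st hst).le.trans hlen) (by omega)
      rw [sz_prod']
      omega
    · exact Nat.add_le_add_left (Nat.mul_le_mul_right _ hlen) 1

theorem signsCost_le {M : Fin m → Pauli n} (hM : ∀ i, M i * M i = 1) {S : Finset (Fin m)}
    (hS : S ∈ maxIndepSets M) :
    signsCost (codes M) (charVec m S) ≤ (m + 1) * stateBound n m := by
  have h := foldCost_le signStep (signInit (codes M)) (l := (codes M).zip (charVec m S))
    (B := stateBound n m) fun l₁ l₂ e => by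
      have hl := congrArg List.length e
      simp only [zip_codes, List.length_ofFn, List.length_append] at hl
      have e1 : l₁ = ((codes M).zip (charVec m S)).take l₁.length := by rw [e, List.take_left']; rfl
      rw [e1]
      exact (states_le hM hS (by omega)).2
  simpa [signsCost, zip_codes] using h

theorem signs_length_le {M : Fin m → Pauli n} (hM : ∀ i, M i * M i = 1) {S : Finset (Fin m)}
    (hS : S ∈ maxIndepSets M) : (signs (codes M) (charVec m S)).length ≤ signBound n m := by
  have h := (states_le hM hS le_rfl).1
  rw [List.take_of_length_le (by simp [zip_codes])] at h
  rwa [signs, List.length_map]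

theorem signsAlgCost_le {M : Fin m → Pauli n} (hM : ∀ i, M i * M i = 1)
    {L : List (Finset (Fin m))} (hmem : ∀ S ∈ L, S ∈ maxIndepSets M) {B : ℕ} (hB : L.length ≤ B) :
    signsAlgCost (codes M) (L.map (charVec m)) ≤
      (B + 1) * (1 + B * signBound n m * (2 + 6 * m)) + B * ((m + 1) * stateBound n m) := by
  refine Nat.add_le_add ?_ ?_
  · have h := foldCost_le (fun s S => s ++ signs (codes M) S) [] (l := L.map (charVec m))
      (B := 1 + B * signBound n m * (2 + 6 * m)) fun l₁ l₂ e => by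
        obtain ⟨L₁, L₂, rfl, rfl, rfl⟩ := List.map_eq_append_iff.1 e
        have hmem' : ∀ S ∈ L₁, S ∈ maxIndepSets M := fun S hS => hmem S (by simp [hS])
        have e1 := signsAlg_eq M (L₁.map (charVec m))
        rw [signsAlg] at e1
        rw [e1]
        refine (sz_list_le (N := 1 + 6 * m) fun l hl => ?_).trans (Nat.add_le_add_left
          (Nat.mul_le_mul ?_ (by omega)) 1)
        · obtain ⟨J, hJ, hl⟩ := List.mem_flatMap.1 hl
          obtain ⟨S, hS, rfl⟩ := List.mem_map.1 hJ
          obtain ⟨f, _, rfl⟩ := ((signs_spec hM (hmem' S hS)).2 l).1 hl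
          exact sz_signs_le (by simp)
        · rw [List.length_append] at hB
          rw [List.length_flatMap]
          refine (List.sum_le_card_nsmul _ (signBound n m) fun x hx => ?_).trans ?_
          · simp only [List.map_map, List.mem_map, Function.comp_apply] at hx
            obtain ⟨S, hS, rfl⟩ := hx
            exact signs_length_le hM (hmem' S hS)
          · simp only [List.length_map, smul_eq_mul]
            exact Nat.mul_le_mul_right _ (by omega)
    refine h.trans (Nat.mul_le_mul_right _ ?_)
    simpa using hB
  · refine (List.sum_le_card_nsmul _ ((m + 1) * stateBound n m) fun x hx => ?_).trans ?_
    · simp only [List.map_map, List.mem_map, Function.comp_apply] at hx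
      obtain ⟨S, hS, rfl⟩ := hx
      exact signsCost_le hM (hmem S hS)
    · simp only [List.length_map, smul_eq_mul]
      exact Nat.mul_le_mul_right _ hB

/-- The base of the bound for the running time. -/
def timeBase (x : ℕ × ℕ) : ℕ := (x.1 + x.2 + 2) * 2 ^ (min x.2 x.1 + min x.2 (x.1 ^ 2))

theorem add_le_timeBase (x : ℕ × ℕ) : x.1 + x.2 + 2 ≤ timeBase x :=
  Nat.le_mul_of_pos_right _ (by positivity)

theorem fst_dom : Dom (fun x : ℕ × ℕ => x.1) timeBase :=
  Dom.of_le fun x => by have := add_le_timeBase x; omega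

theorem snd_dom : Dom (fun x : ℕ × ℕ => x.2) timeBase :=
  Dom.of_le fun x => by have := add_le_timeBase x; omega

theorem two_pow_dom : Dom (fun x : ℕ × ℕ => 2 ^ (min x.2 x.1 + min x.2 (x.1 ^ 2))) timeBase :=
  Dom.of_le fun x => Nat.le_mul_of_pos_left _ (by omega)

/-- The constant in the exponent becomes a power of the base, so it is harmless for `Dom`. -/
theorem setBound_dom : Dom (fun x : ℕ × ℕ => setBound x.1 x.2) timeBase := by
  refine ((Dom.const 16).mul (two_pow_dom.pow 12)).mono_left fun x => ?_
  rw [setBound, ← pow_mul]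
  exact Nat.mul_le_mul_left _ (Nat.pow_le_pow_right two_pos (by omega))

theorem signBound_dom : Dom (fun x : ℕ × ℕ => signBound x.1 x.2) timeBase := by
  refine ((Dom.const 4).mul (two_pow_dom.pow 2)).mono_left fun x => ?_
  rw [signBound, ← pow_mul]
  exact Nat.mul_le_mul_left _ (Nat.pow_le_pow_right two_pos (by omega))

theorem stateBound_dom : Dom (fun x : ℕ × ℕ => stateBound x.1 x.2) timeBase :=
  (Dom.const 1).add (signBound_dom.mul ((Dom.const 1).add (((Dom.const 1).add ((Dom.const 1).add
    ((Dom.const 6).mul snd_dom))).add ((Dom.const 1).add (signBound_dom.mul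
      (((Dom.const 8).mul fst_dom).add (Dom.const 18)))))))

/-- Inputs: families of Hermitian Pauli operators. -/
structure Input where
  n : ℕ
  m : ℕ
  M : Fin m → Pauli n
  sq : ∀ i, M i * M i = 1

/-- The base of the bound for the running time. -/
def Input.base (x : Input) : ℕ := timeBase (x.n, x.m)

theorem Input.dom_of {f : ℕ → ℕ → ℕ} (h : Dom (fun x : ℕ × ℕ => f x.1 x.2) timeBase) :
    Dom (fun x : Input => f x.n x.m) Input.base := h.comp fun x : Input => (x.n, x.m)

theorem Input.codes_dom : Dom (fun x : Input => sz (codes x.M)) Input.base :=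
  (Input.dom_of (f := fun n m => 1 + m * (8 * n + 18)) ((Dom.const 1).add (snd_dom.mul
    (((Dom.const 8).mul fst_dom).add (Dom.const 18))))).mono_left fun x => sz_codes_le x.M

theorem Input.adj_dom : Dom (fun x : Input => sz (codes x.M, adjMatrix x.M)) Input.base := by
  have h : Dom (fun x : Input => sz (adjMatrix x.M)) Input.base :=
    (Input.dom_of (f := fun _ m => 1 + m * (2 + 4 * m)) ((Dom.const 1).add (snd_dom.mul
      ((Dom.const 2).add ((Dom.const 4).mul snd_dom))))).mono_left fun x => sz_adjMatrix_le x.M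
  exact ((Dom.const 1).add Input.codes_dom).add h

theorem Input.setsCost_dom : Dom (fun x : Input =>
    foldCost (setStep (adjMatrix x.M)) [[]] (adjMatrix x.M)) Input.base :=
  (Input.dom_of (f := fun n m => (m + 1) * (1 + setBound n m * (2 + 4 * m)))
    ((snd_dom.add (Dom.const 1)).mul ((Dom.const 1).add (setBound_dom.mul ((Dom.const 2).add
      ((Dom.const 4).mul snd_dom)))))).mono_left fun x => setsCost_le x.M

theorem Input.sets_dom : Dom (fun x : Input => sz (codes x.M, (misList x.M).map (charVec x.m)))
    Input.base := by
  have h : Dom (fun x : Input => sz ((misList x.M).map (charVec x.m))) Input.base := by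
    refine (Input.dom_of (f := fun n m => 1 + setBound n m * (1 + (1 + 4 * m)))
      ((Dom.const 1).add (setBound_dom.mul ((Dom.const 1).add ((Dom.const 1).add
        ((Dom.const 4).mul snd_dom)))))).mono_left fun x => ?_
    refine (sz_list_le fun J hJ => ?_).trans (Nat.add_le_add_left (Nat.mul_le_mul_right _ ?_) 1)
    · obtain ⟨S, _, rfl⟩ := List.mem_map.1 hJ
      exact sz_bools_le (by rw [length_charVec le_rfl])
    · rw [List.length_map]
      exact (misList_spec x.M).2.2.2
  exact ((Dom.const 1).add Input.codes_dom).add h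

theorem Input.signsCost_dom : Dom (fun x : Input =>
    signsAlgCost (codes x.M) ((misList x.M).map (charVec x.m))) Input.base :=
  (Input.dom_of (f := fun n m => (setBound n m + 1) * (1 + setBound n m * signBound n m *
      (2 + 6 * m)) + setBound n m * ((m + 1) * stateBound n m))
    (((setBound_dom.add (Dom.const 1)).mul ((Dom.const 1).add ((setBound_dom.mul signBound_dom).mul
      ((Dom.const 2).add ((Dom.const 6).mul snd_dom))))).add (setBound_dom.mul
        ((snd_dom.add (Dom.const 1)).mul stateBound_dom)))).mono_left fun x =>
    signsAlgCost_le x.sq (fun S hS => ((misList_spec x.M).2.2.1 S).1 hS) (misList_spec x.M).2.2.2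

end Pauli
end ReducedStabilizer
-- The main theorem.
open ReducedStabilizer ReducedStabilizer.Pauli

theorem mainTheorem3 :
    ∃ (graphPhase setsPhase signsPhase : Prog) (c : ℕ) (p : MvPolynomial (Fin 2) ℕ),
      ∀ (n m : ℕ) (M : Fin m → Pauli n), (∀ i, (M i).op.IsHermitian) → Function.Injective M →
        ∃ (L : List (Finset (Fin m))) (W : Finset (Fin m) → List (Fin m → SignType)) (T : ℕ),
          -- the three phases of the algorithm
          (∃ t₁, Runs graphPhase (inputData M)
            (Data.cons (inputData M) (graphData (frustrationGraph M))) t₁) ∧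
          (∃ t₂, Runs setsPhase (Data.cons (inputData M) (graphData (frustrationGraph M)))
            (Data.cons (inputData M) (setsData L)) t₂) ∧
          (∃ t₃, Runs signsPhase (Data.cons (inputData M) (setsData L))
            (vectorsData (L.flatMap W)) t₃) ∧
          -- the second phase lists the maximal independent sets
          L.Nodup ∧ (∀ S, S ∈ L ↔ S ∈ maxIndepSets M) ∧
          -- the third phase lists, for each of them, the vectors of its admissible signs
          (∀ S ∈ L, (W S).Nodup ∧
            ∀ v, v ∈ W S ↔ ∃ f ∈ admissibleSigns M S, v = vertex S f) ∧
          -- the output is the V-representation of the reduced polytope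
          (L.flatMap W).Nodup ∧ {v | v ∈ L.flatMap W} = vertices M ∧
          reducedPolytope M = convexHull ℝ (realVec '' {v | v ∈ L.flatMap W}) ∧
          -- the running time
          Runs (Prog.seq graphPhase (Prog.seq setsPhase signsPhase)) (inputData M)
            (vectorsData (L.flatMap W)) T ∧
          T ≤ MvPolynomial.eval ![n, m] p * 2 ^ (c * (min m n + min m (n ^ 2))) := by
  obtain ⟨c₁, τ₁, hc₁, h₁⟩ := graphAlg_PT
  obtain ⟨c₂, τ₂, hc₂, h₂⟩ := setsAlg_comp
  obtain ⟨c₃, τ₃, hc₃, h₃⟩ := signsAlg_comp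
  have d₁ : Dom (fun x : Input => τ₁ (codes x.M)) Input.base :=
    (h₁.comp fun x : Input => codes x.M).trans Input.codes_dom
  have d₂ : Dom (fun x : Input => τ₂ (codes x.M, adjMatrix x.M)) Input.base :=
    (h₂.comp fun x : Input => (codes x.M, adjMatrix x.M)).trans
      (Input.adj_dom.add Input.setsCost_dom)
  have d₃ : Dom (fun x : Input => τ₃ (codes x.M, (misList x.M).map (charVec x.m))) Input.base :=
    (h₃.comp fun x : Input => (codes x.M, (misList x.M).map (charVec x.m))).trans
      (Input.sets_dom.add Input.signsCost_dom)
  -- One exponent covers the whole run: the times of the three phases, the sizes charged by the two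
  -- `seq` instructions, and their two unit steps.
  obtain ⟨K, hK⟩ := (((Dom.const 2).add (Input.codes_dom.add Input.adj_dom)).add ((d₁.add d₂).add d₃))
  -- The power `K` of `2 * (n + m + 2) * 2 ^ e` splits into a polynomial factor and `2 ^ (K * e)`,
  -- so `K` is also the constant in the exponent.
  refine ⟨c₁, c₂, c₃, K, (2 * (MvPolynomial.X 0 + MvPolynomial.X 1 + 2)) ^ K, ?_⟩
  intro n m M hH _
  have hM : ∀ i, M i * M i = 1 := fun i => (isHermitian_iff _).1 (hH i)
  obtain ⟨hL1, hL2, hL3, -⟩ := misList_spec M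
  have hmem : ∀ S ∈ misList M, S ∈ maxIndepSets M := fun S hS => (hL3 S).1 hS
  have hset : {v | v ∈ (misList M).flatMap (signVectors M)} = vertices M := by
    ext v
    simp only [Set.mem_ofPred_eq, List.mem_flatMap, vertices]
    refine exists_congr fun S => ?_
    rw [hL3]
    exact and_congr_right fun hS => (signVectors_spec hM hS).2.2 v
  obtain ⟨t₁, ht₁, r₁⟩ := hc₁ (codes M)
  obtain ⟨t₂, ht₂, r₂⟩ := hc₂ (codes M, adjMatrix M)
  obtain ⟨t₃, ht₃, r₃⟩ := hc₃ (codes M, (misList M).map (charVec m))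
  have hK' := hK ⟨n, m, M, hM⟩
  simp only [sz] at hK'
  rw [graphAlg_codes] at r₁
  rw [setsAlg, hL1] at r₂
  rw [enc_signsAlg hM hmem] at r₃
  simp only [enc_prod, enc_codes, enc_adjMatrix, enc_sets] at r₁ r₂ r₃ hK'
  refine ⟨misList M, signVectors M, _, ⟨t₁, r₁⟩, ⟨t₂, r₂⟩, ⟨t₃, r₃⟩, hL2, hL3,
    fun S hS => (signVectors_spec hM (hmem S hS)).2, nodup_flatMap_signVectors hM hL2 hmem, hset, ?_,
    Runs.seq r₁ (Runs.seq r₂ r₃), ?_⟩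
  · rw [hset]
    exact reducedPolytope_eq hM
  · have h4 : 1 + (inputData M).size + t₁ + (1 + (Data.cons (inputData M)
        (graphData (frustrationGraph M))).size + t₂ + t₃) ≤ (Input.base ⟨n, m, M, hM⟩ + 2) ^ K := by
      omega
    refine h4.trans ?_
    -- The shift by 2 from `Dom` is absorbed by the factor 2, as the base is at least 2.
    have h5 : Input.base ⟨n, m, M, hM⟩ + 2 ≤ 2 * (n + m + 2) * 2 ^ (min m n + min m (n ^ 2)) := by
      have := add_le_timeBase (n, m)
      simp only [Input.base] at *
      have e : 2 * (n + m + 2) * 2 ^ (min m n + min m (n ^ 2)) = 2 * timeBase (n, m) := by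
        rw [timeBase]; ring
      omega
    refine (Nat.pow_le_pow_left h5 K).trans (le_of_eq ?_)
    rw [mul_pow, ← pow_mul, mul_comm (_ + _) K]
    simp
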